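/- Let $\Sigma=\{0,1\}$. A promise problem (a pair of disjoint sets of positive and negative instances) is in AM if there are a polynomial $\ell$ and a BPP predicate $V(x,q,r)$, defined for $x\in\Sigma^*$ and $q,r\in\Sigma^{\ell(|x|)}$, such that for $q$ uniformly distributed in $\Sigma^{\ell(|x|)}$: if $x$ is a positive instance, then $\Pr_q[V(x,q,r(q))=1]\ge 2/3$ for some response function $r:\Sigma^{\ell(|x|)}\to\Sigma^{\ell(|x|)}$; if $x$ is a negative instance, then $\Pr_q[V(x,q,r(q))=1]\le 1/3$ for every response function $r$. (A BPP predicate is one that a probabilistic polynomial-time machine computes with error probability at most $1/3$ on every input.) If a part of the instance is specified by a black box, then the machine that computes $V$ may query the black box, one unit of time per query, its running time is polynomial in the length $|x|$ of the remaining, explicitly given part $x$, and $r$ may depend on the whole instance. (1) Stoquastic Largest Eigenvalue Problem. Let $p,d$ be polynomials with non-negative integer coefficients, $p(n)>0$ for all $n\ge 1$. An instance consists of an integer $n\ge 1$ (in unary), positive rational thresholds $\mu_+,\mu_-$ (in binary) with $\log_2\mu_+-\log_2\mu_-\ge 1/p(n)$, and a real symmetric $2^n\times 2^n$ matrix $G$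 with $0\le G_{x,y}\le 1$ for all $x,y\in\Sigma^n$, specified by a black box that on input $x,y\in\Sigma^n$ returns $G_{x,y}$ as a binary number with at most $d(n)$ digits. Let $\mu(G)$ be the largest eigenvalue of $G$. Positive instances satisfy $\mu(G)\ge\mu_+$, negative instances satisfy $\mu(G)\le\mu_-$. For all such $p,d$ this problem is in AM. (2) Stoquastic LH-MIN. Let $k\ge 0$ be an integer and $p_1,p_2,d$ polynomials with non-negative integer coefficients, $p_2(n)>0$ for all $n\ge 1$. An instance is a $k$-local Hamiltonian $H=\sum_{|S|=k}H_S$ on $n\ge\max(k,1)$ qubits, where $S$ runs over all $k$-element subsets of the qubits, and $H_S$ is a Hermitian operator on the qubits in $S$ (tensored with the identity on the others) with operator norm $\|H_S\|\le p_1(n)$, such that all off-diagonal matrix elements of $H$ in the standard basis are real and non-positive. It is given explicitly by a binary string of length at most $d(n)$ which lists $n$ (in unary) and all matrix elements of all $H_S$, with real and imaginary parts as binary fixed-point numbers. Let $\lambda(H)$ be the smallest eigenvalue of $H$. Positive instances satisfy $\lambda(H)\le 0$, negative instances satisfy $\lambda(H)\ge 1/p_2(n)$. For all such $k,p_1,p_2,d$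 this problem is in AM. -/

import Mathlib

open Polynomial

namespace StoqAM

/-! ### Machine model

Programs act on finitely many bit stacks (all stacks that the program mentions) and may query a
black box. An instruction looks at or changes one bit on top of one stack and costs one unit of
time, so that this is a multi-tape Turing machine with a black box and a structured finite control.
-/

/-- `Bits n` is the set of `n`-bit strings. -/
abbrev Bits (n : ℕ) : Type := Fin n → Bool

/-- A black box: it takes two binary strings and returns a binary string. -/
abbrev Oracle : Type := List Bool → List Bool → List Bool

/-- The trivial black box, which gives no information. -/
def noOracle : Oracle := fun _ _ => []

/-- The contents of the stacks; the head of a list is the top of the stack. -/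
abbrev Store : Type := ℕ → List Bool

/-- Programs. -/
inductive Prog : Type
  | skip : Prog
  | push (r : ℕ) (b : Bool) : Prog
  | pop (r : ℕ) : Prog
  | query (x y a : ℕ) : Prog
  | seq (P Q : Prog) : Prog
  | branch (r : ℕ) (ifEmpty ifFalse ifTrue : Prog) : Prog
  | loop (r : ℕ) (P : Prog) : Prog

/-- `Run O P s t s'`: with black box `O`, the program `P` started on `s` halts after exactly
`t` steps with the store `s'`. -/
inductive Run (O : Oracle) : Prog → Store → ℕ → Store → Prop
  | skip (s : Store) : Run O Prog.skip s 1 s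
  | push (r : ℕ) (b : Bool) (s : Store) :
      Run O (Prog.push r b) s 1 (Function.update s r (b :: s r))
  | pop (r : ℕ) (s : Store) :
      Run O (Prog.pop r) s 1 (Function.update s r (s r).tail)
  | query (x y a : ℕ) (s : Store) :
      Run O (Prog.query x y a) s 1 (Function.update s a (O (s x) (s y)))
  | seq {P Q : Prog} {s s' s'' : Store} {t t' : ℕ} :
      Run O P s t s' → Run O Q s' t' s'' → Run O (Prog.seq P Q) s (t + t') s''
  | branch_empty {r : ℕ} {P P₀ P₁ : Prog} {s s' : Store} {t : ℕ} :
      (s r).head? = none → Run O P s t s' → Run O (Prog.branch r P P₀ P₁) s (t + 1) s'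
  | branch_false {r : ℕ} {P P₀ P₁ : Prog} {s s' : Store} {t : ℕ} :
      (s r).head? = some false → Run O P₀ s t s' → Run O (Prog.branch r P P₀ P₁) s (t + 1) s'
  | branch_true {r : ℕ} {P P₀ P₁ : Prog} {s s' : Store} {t : ℕ} :
      (s r).head? = some true → Run O P₁ s t s' → Run O (Prog.branch r P P₀ P₁) s (t + 1) s'
  | loop_done {r : ℕ} {P : Prog} {s : Store} :
      s r = [] → Run O (Prog.loop r P) s 1 s
  | loop_step {r : ℕ} {P : Prog} {s s' s'' : Store} {t t' : ℕ} :
      s r ≠ [] → Run O P s t s' → Run O (Prog.loop r P) s' t' s'' →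
        Run O (Prog.loop r P) s (t + t' + 1) s''

/-- The model is deterministic: running time and result are unique. -/
theorem Run.unique {O : Oracle} {P : Prog} {s s₁ : Store} {t₁ : ℕ} (h₁ : Run O P s t₁ s₁) :
    ∀ {t₂ : ℕ} {s₂ : Store}, Run O P s t₂ s₂ → t₁ = t₂ ∧ s₁ = s₂ := by
  induction h₁ with
  | skip | push | pop | query => intro _ _ h₂; cases h₂; exact ⟨rfl, rfl⟩
  | seq _ _ ihP ihQ =>
    intro _ _ h₂
    cases h₂ with
    | seq a b => obtain ⟨rfl, rfl⟩ := ihP a; obtain ⟨rfl, rfl⟩ := ihQ b; exact ⟨rfl, rfl⟩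
  | branch_empty h _ ih | branch_false h _ ih | branch_true h _ ih =>
    intro _ _ h₂
    cases h₂ <;> first
      | (rename_i a; obtain ⟨rfl, rfl⟩ := ih a; exact ⟨rfl, rfl⟩)
      | simp_all
  | loop_done h =>
    intro _ _ h₂
    cases h₂ with
    | loop_done => exact ⟨rfl, rfl⟩
    | loop_step h' => exact absurd h h'
  | loop_step h _ _ ihP ihL =>
    intro _ _ h₂
    cases h₂ with
    | loop_done h' => exact absurd h' h
    | loop_step _ a b => obtain ⟨rfl, rfl⟩ := ihP a; obtain ⟨rfl, rfl⟩ := ihL b; exact ⟨rfl, rfl⟩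

/-- The store in which stack `i` holds the `i`-th of the given strings and all others are empty. -/
def inputStore (l : List (List Bool)) : Store := fun i => l.getD i []

/-- Started on the given input strings, `M` halts after at most `T` steps and outputs the bit `b`
(which it leaves on top of stack `0`). -/
def OutputsWithin (O : Oracle) (M : Prog) (T : ℕ) (inputs : List (List Bool)) (b : Bool) : Prop :=
  ∃ t ≤ T, ∃ s', Run O M (inputStore inputs) t s' ∧ (s' 0).head? = some b

/-! ### The class AM -/

/-- The probability of the event `A` for a uniformly distributed `n`-bit string. -/
noncomputable def uniformProb {n : ℕ} (A : Set (Bits n)) : ℝ := (A.ncard : ℝ) / 2 ^ n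

/-- A predicate of an instance string `x`, a question `q` and a response `r`, where `q` and `r` are
strings of length `ℓ(|x|)`; it may depend on the black box. -/
abbrev Predicate (ℓ : ℕ[X]) : Type :=
  Oracle → (x : List Bool) → Bits (ℓ.eval x.length) → Bits (ℓ.eval x.length) → Bool

/-- `V` is a BPP predicate, relative to each of the black boxes in `𝓞`: a program that tosses
polynomially many coins computes it in polynomial time with error probability at most `1/3`. -/
def IsBPPPredicate (𝓞 : Set Oracle) (ℓ : ℕ[X]) (V : Predicate ℓ) : Prop :=
  ∃ (M : Prog) (c T : ℕ[X]), ∀ O ∈ 𝓞, ∀ (x : List Bool) (q r : Bits (ℓ.eval x.length)),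
    (∀ w : Bits (c.eval x.length), ∃ b : Bool,
      OutputsWithin O M (T.eval x.length) [x, List.ofFn q, List.ofFn r, List.ofFn w] b) ∧
    2 / 3 ≤ uniformProb {w : Bits (c.eval x.length) |
      OutputsWithin O M (T.eval x.length) [x, List.ofFn q, List.ofFn r, List.ofFn w] (V O x q r)}

/-- The promise problem with positive instances `yes` and negative instances `no` is in AM. An
instance is a string together with a black box from `𝓞` that the verifier can query. -/
def InAMWithOracle (𝓞 : Set Oracle) (yes no : Set (List Bool × Oracle)) : Prop :=
  ∃ (ℓ : ℕ[X]) (V : Predicate ℓ), IsBPPPredicate 𝓞 ℓ V ∧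
    (∀ (x : List Bool) (O : Oracle), (x, O) ∈ yes →
      ∃ r : Bits (ℓ.eval x.length) → Bits (ℓ.eval x.length),
        2 / 3 ≤ uniformProb {q | V O x q (r q) = true}) ∧
    (∀ (x : List Bool) (O : Oracle), (x, O) ∈ no →
      ∀ r : Bits (ℓ.eval x.length) → Bits (ℓ.eval x.length),
        uniformProb {q | V O x q (r q) = true} ≤ 1 / 3)

/-- The class AM of ordinary promise problems (no black box). -/
def InAM (yes no : Set (List Bool)) : Prop :=
  InAMWithOracle {noOracle} {i | i.1 ∈ yes ∧ i.2 = noOracle} {i | i.1 ∈ no ∧ i.2 = noOracle}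

/-! ### Encodings -/

/-- Self-delimiting form of a bit string: each bit is preceded by `1`, and `0` ends the string. -/
def frame (s : List Bool) : List Bool := s.flatMap (fun b => [true, b]) ++ [false]

/-- A natural number in unary. -/
def unaryCode (n : ℕ) : List Bool := frame (List.replicate n true)

/-- A positive rational number: numerator and denominator in binary. -/
def ratCode (a : ℚ) : List Bool := frame a.num.natAbs.bits ++ frame a.den.bits

/-- An integer: sign bit, then the absolute value in binary. -/
def intCode (z : ℤ) : List Bool := frame (decide (z < 0) :: z.natAbs.bits)

/-- The number `d₀.d₁d₂d₃…` written in binary, as a function of its string of digits. -/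
noncomputable def binVal : List Bool → ℝ
  | [] => 0
  | b :: l => (if b then 1 else 0) + binVal l / 2

/-! ### The Stoquastic Largest Eigenvalue Problem -/

/-- The largest eigenvalue of a real symmetric matrix. -/
noncomputable def largestEigenvalue {n : ℕ} (G : Matrix (Bits n) (Bits n) ℝ) : ℝ :=
  sSup (spectrum ℝ G)

/-- `O` is a black box for the matrix `G`: asked for `x, y`, it returns `G x y` in binary, with at
most `d(n)` digits. -/
def IsBlackBox (d : ℕ[X]) {n : ℕ} (G : Matrix (Bits n) (Bits n) ℝ) (O : Oracle) : Prop :=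
  ∀ x y : Bits n, (O (List.ofFn x) (List.ofFn y)).length ≤ d.eval n ∧
    binVal (O (List.ofFn x) (List.ofFn y)) = G x y

/-- The conditions on `(n, G, μ₊, μ₋)`, except for the promise on the largest eigenvalue. -/
structure IsEigenvalueInstance (p : ℕ[X]) (n : ℕ) (G : Matrix (Bits n) (Bits n) ℝ)
    (μp μm : ℚ) : Prop where
  one_le : 1 ≤ n
  pos_plus : 0 < μp
  pos_minus : 0 < μm
  gap : 1 / ((p.eval n : ℕ) : ℝ) ≤ Real.logb 2 μp - Real.logb 2 μm
  symm : G.IsSymm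
  entry_nonneg : ∀ x y, 0 ≤ G x y
  entry_le_one : ∀ x y, G x y ≤ 1

/-- The string that specifies `n` and the thresholds. -/
def eigenvalueCode (n : ℕ) (μp μm : ℚ) : List Bool := unaryCode n ++ ratCode μp ++ ratCode μm

/-- Positive instances: `μ(G) ≥ μ₊`. -/
def largestEigenvalueYes (p d : ℕ[X]) : Set (List Bool × Oracle) :=
  {i | ∃ (n : ℕ) (G : Matrix (Bits n) (Bits n) ℝ) (μp μm : ℚ),
    IsEigenvalueInstance p n G μp μm ∧ i.1 = eigenvalueCode n μp μm ∧ IsBlackBox d G i.2 ∧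
      (μp : ℝ) ≤ largestEigenvalue G}

/-- Negative instances: `μ(G) ≤ μ₋`. -/
def largestEigenvalueNo (p d : ℕ[X]) : Set (List Bool × Oracle) :=
  {i | ∃ (n : ℕ) (G : Matrix (Bits n) (Bits n) ℝ) (μp μm : ℚ),
    IsEigenvalueInstance p n G μp μm ∧ i.1 = eigenvalueCode n μp μm ∧ IsBlackBox d G i.2 ∧
      largestEigenvalue G ≤ (μm : ℝ)}

/-! ### Stoquastic LH-MIN -/

/-- A family of operators: for each set `S` of qubits an operator on the qubits in `S`. -/
abbrev Interactions (n : ℕ) : Type :=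
  (S : Finset (Fin n)) → Matrix (S → Bool) (S → Bool) ℂ

/-- The operator `A` on the qubits in `S`, tensored with the identity on all other qubits. -/
def extendById {n : ℕ} (S : Finset (Fin n)) (A : Matrix (S → Bool) (S → Bool) ℂ) :
    Matrix (Bits n) (Bits n) ℂ :=
  fun x y => if ∀ i, i ∉ S → x i = y i then A (fun i => x i) (fun i => y i) else 0

/-- The `k`-local Hamiltonian `H = ∑ H_S`, where `S` runs over all sets of `k` qubits. -/
noncomputable def hamiltonian (k : ℕ) {n : ℕ} (h : Interactions n) : Matrix (Bits n) (Bits n) ℂ :=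
  ∑ S ∈ (Finset.univ : Finset (Fin n)).powersetCard k, extendById S (h S)

/-- The smallest eigenvalue of a Hermitian matrix. -/
noncomputable def smallestEigenvalue {n : ℕ} (H : Matrix (Bits n) (Bits n) ℂ) : ℝ :=
  sInf (spectrum ℝ H)

/-- All off-diagonal matrix elements in the standard basis are real and non-positive. -/
def IsStoquastic {n : ℕ} (H : Matrix (Bits n) (Bits n) ℂ) : Prop :=
  ∀ x y, x ≠ y → (H x y).im = 0 ∧ (H x y).re ≤ 0

/-- The conditions on a stoquastic `k`-local Hamiltonian with interactions bounded by `p₁(n)` in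
operator norm, except for the promise on the smallest eigenvalue. -/
structure IsStoquasticInstance (k : ℕ) (p₁ : ℕ[X]) (n : ℕ) (h : Interactions n) : Prop where
  one_le : 1 ≤ n
  local_le : k ≤ n
  hermitian : ∀ S : Finset (Fin n), S.card = k → (h S).IsHermitian
  norm_le : ∀ S : Finset (Fin n), S.card = k →
    ‖Matrix.toEuclideanCLM (n := S → Bool) (𝕜 := ℂ) (h S)‖ ≤ ((p₁.eval n : ℕ) : ℝ)
  stoquastic : IsStoquastic (hamiltonian k h)

/-- The position `⟨u| H_S |v⟩` of a matrix element of an interaction. -/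
abbrev Position (n : ℕ) : Type := (S : Finset (Fin n)) × (S → Bool) × (S → Bool)

/-- The assignment `u` of bits to the qubits in `S`, as a string of `n` bits (`0` outside `S`). -/
def padded {n : ℕ} (S : Finset (Fin n)) (u : S → Bool) : List Bool :=
  List.ofFn fun i : Fin n => if hi : i ∈ S then u ⟨i, hi⟩ else false

/-- The record `S, u, v, a, b` of a matrix element `⟨u| H_S |v⟩ = (a + b i) / 2 ^ m`. -/
def recordCode {n : ℕ} (e : Position n) (a b : ℤ) : List Bool :=
  frame (List.ofFn fun i : Fin n => decide (i ∈ e.1)) ++ frame (padded e.1 e.2.1) ++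
    frame (padded e.1 e.2.2) ++ intCode a ++ intCode b

/-- The string `s` describes the interactions `H_S` with `|S| = k`: it consists of `n`, the number
`m` of binary digits after the point, and a list of all matrix elements of these `H_S`. -/
def Describes (k : ℕ) {n : ℕ} (h : Interactions n) (s : List Bool) : Prop :=
  ∃ (m : ℕ) (re im : Position n → ℤ) (L : List (Position n)),
    L.Nodup ∧ (∀ e : Position n, e ∈ L ↔ e.1.card = k) ∧
    (∀ e ∈ L, h e.1 e.2.1 e.2.2 = ((re e : ℂ) + (im e : ℂ) * Complex.I) / 2 ^ m) ∧
    s = unaryCode n ++ unaryCode m ++ L.flatMap fun e => recordCode e (re e) (im e)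

/-- Positive instances of stoquastic LH-MIN, with descriptions of at most `d(n)` bits:
`λ(H) ≤ 0`. -/
def stoquasticLHYes (k : ℕ) (p₁ d : ℕ[X]) : Set (List Bool) :=
  {s | ∃ (n : ℕ) (h : Interactions n), IsStoquasticInstance k p₁ n h ∧ Describes k h s ∧
    s.length ≤ d.eval n ∧ smallestEigenvalue (hamiltonian k h) ≤ 0}

/-- Negative instances of stoquastic LH-MIN, with descriptions of at most `d(n)` bits:
`λ(H) ≥ 1 / p₂(n)`. -/
def stoquasticLHNo (k : ℕ) (p₁ p₂ d : ℕ[X]) : Set (List Bool) :=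
  {s | ∃ (n : ℕ) (h : Interactions n), IsStoquasticInstance k p₁ n h ∧ Describes k h s ∧
    s.length ≤ d.eval n ∧ 1 / ((p₂.eval n : ℕ) : ℝ) ≤ smallestEigenvalue (hamiltonian k h)}

end StoqAM

open StoqAM

namespace StoqAM

/-! Both problems come down to telling a large set of strings from a small one. Suppose that a test
accepts `A x y` labels for a step from `x` to `y`. Then the entries of `A ^ N` add up to the number
of labelled walks with `N` steps (`sum_isWalk`). If `G` is symmetric with non-negative entries and
largest eigenvalue `μ`, the entries of `G ^ N` add up to something between `μ ^ N` and `2 ^ n * μ ^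
N` (`eigenvalue_bounds`). For polynomially large `N` the promised gap outweighs the factor `2 ^ n`,
so that the walk counts of positive and negative instances differ by a factor of at least 12.

For the eigenvalue problem (`eigenvalue_walks`), `A` is `γ G` rounded up, where `γ` is chosen such
that `γ μ₊ = 2 ^ (2 N)`. Nonzero entries of `G` are at least `2 ^ (-N)`, so rounding causes a tiny
relative error, which is harmless even in the `N`-th power. For LH-MIN (`hamiltonian_walks`), `A` is
exactly `2 ^ m (2 ^ t - H)`. It is non-negative because `H` is stoquastic and `2 ^ t` bounds its
entries, and the largest eigenvalue of `2 ^ t - H` is `2 ^ t - λ(H)`. As `t` is logarithmic in the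
input length, the shift `2 ^ t` is polynomial and the relative gap stays inverse polynomial.

Set sizes are compared by the lower bound protocol of Goldwasser and Sipser. The question describes
a random affine hash function with values of `N β` bits, and the response is a walk whose hash value
is zero. Two free bits in front of each walk multiply the count by four. A large set contains a
string with hash value zero with probability at least 2/3, by pairwise independence and Chebyshev's
inequality (`le_uniformProb_hash`); a small set does so with probability at most 1/3, by a union
bound (`uniformProb_hash_le`).

It remains to run this verifier in the machine model. It is deterministic: the coin string matters
only through its length `N`, a polynomial in the input length, and serves as a unary counter. In the
language `Cmd` every loop runs `N` times, so polynomial running time is automatic (`run_compile`),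
and correctness is a matter of loop invariants for parsing, binary arithmetic and hashing on stacks
(`eval_verifier`). -/

/-! ### A language with bounded loops -/

/-- Commands whose loops run a number of times that is fixed in advance. -/
inductive Cmd : Type
  | skip : Cmd
  | push (r : ℕ) (b : Bool) : Cmd
  | pop (r : ℕ) : Cmd
  | query (x y a : ℕ) : Cmd
  | seq (c d : Cmd) : Cmd
  | branch (r : ℕ) (ifEmpty ifFalse ifTrue : Cmd) : Cmd
  | rep (c : Cmd) : Cmd

infixr:60 " ;; " => Cmd.seq

namespace Cmd

/-- The effect of a command on the store if every loop runs `N` times. -/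
def eval (O : Oracle) (N : ℕ) : Cmd → Store → Store
  | skip, s => s
  | push r b, s => Function.update s r (b :: s r)
  | pop r, s => Function.update s r (s r).tail
  | query x y a, s => Function.update s a (O (s x) (s y))
  | seq c d, s => eval O N d (eval O N c s)
  | branch r c c₀ c₁, s =>
    match s r with
    | [] => eval O N c s
    | false :: _ => eval O N c₀ s
    | true :: _ => eval O N c₁ s
  | rep c, s => (eval O N c)^[N] s

/-- Stacks `3`, `4` and those from `100` on are reserved for loop counters. -/
def okReg (r : ℕ) : Bool := r != 3 && r != 4 && Nat.ble r 99

/-- The command does not mention reserved stacks. -/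
def ok : Cmd → Bool
  | skip => true
  | push r _ => okReg r
  | pop r => okReg r
  | query x y a => okReg x && okReg y && okReg a
  | seq c d => c.ok && d.ok
  | branch r c c₀ c₁ => okReg r && c.ok && c₀.ok && c₁.ok
  | rep c => c.ok

/-- The program for a command that is nested in `k` loops; the length of stack `3` is the number of
times that each loop runs. -/
def compile : ℕ → Cmd → Prog
  | _, skip => .skip
  | _, push r b => .push r b
  | _, pop r => .pop r
  | _, query x y a => .query x y a
  | k, seq c d => .seq (compile k c) (compile k d)
  | k, branch r c c₀ c₁ => .branch r (compile k c) (compile k c₀) (compile k c₁)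
  | k, rep c =>
    .seq (.loop 3 (.seq (.pop 3) (.seq (.push 4 true) (.push (100 + k) true))))
      (.seq (.loop 4 (.seq (.pop 4) (.push 3 true)))
        (.loop (100 + k) (.seq (.pop (100 + k)) (compile (k + 1) c))))

/-- A bound on the running time of the compiled command. -/
noncomputable def cost : Cmd → ℕ[X]
  | skip | push _ _ | pop _ | query _ _ _ => 1
  | seq c d => c.cost + d.cost
  | branch _ c c₀ c₁ => c.cost + c₀.cost + c₁.cost + 1
  | rep c => X * (c.cost + 9) + 3

/-- The store `s` represents `v` at a point nested in `k` loops. -/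
structure Represents (N k : ℕ) (s v : Store) : Prop where
  eq : ∀ r, okReg r = true → s r = v r
  fuel : (s 3).length = N
  tmp : s 4 = []
  counters : ∀ j, k ≤ j → s (100 + j) = []

theorem okReg_iff {r : ℕ} : okReg r = true ↔ r ≠ 3 ∧ r ≠ 4 ∧ r < 100 := by
  simp [okReg, and_assoc]; omega

theorem Represents.update {N k : ℕ} {s v : Store} (h : Represents N k s v) {r : ℕ}
    (hr : okReg r = true) (l : List Bool) :
    Represents N k (Function.update s r l) (Function.update v r l) := by
  obtain ⟨h3, h4, h100⟩ := okReg_iff.1 hr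
  refine ⟨fun r' hr' => ?_, ?_, ?_, fun j hj => ?_⟩
  · by_cases e : r' = r
    · subst e; simp
    · simp [e, h.eq r' hr']
  · rw [Function.update_of_ne (Ne.symm h3)]; exact h.fuel
  · rw [Function.update_of_ne (Ne.symm h4)]; exact h.tmp
  · rw [Function.update_of_ne (by omega)]; exact h.counters j hj

/-- A loop of `Prog` uses up the stack that it tests. The fuel is therefore poured out onto two
stacks at once: one drives the coming loop, the other restores the fuel. Only the height survives,
since arbitrary bits are replaced by ones. -/
theorem run_fuel_to_counter (O : Oracle) {C : ℕ} (hC3 : C ≠ 3) (hC4 : C ≠ 4) (l : List Bool) :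
    ∀ s : Store, s 3 = l → ∃ s', Run O
      (.loop 3 (.seq (.pop 3) (.seq (.push 4 true) (.push C true)))) s (4 * l.length + 1) s' ∧
      s' 3 = [] ∧ s' 4 = List.replicate l.length true ++ s 4 ∧
      s' C = List.replicate l.length true ++ s C ∧ ∀ r, r ≠ 3 → r ≠ 4 → r ≠ C → s' r = s r := by
  induction l with
  | nil => intro s hs; exact ⟨s, .loop_done hs, hs, by simp, by simp, fun _ _ _ _ => rfl⟩
  | cons b l ih =>
    intro s hs
    have hrun := Run.seq (Run.pop (O := O) 3 s)
      (Run.seq (Run.push 4 true (Function.update s 3 (s 3).tail)) (Run.push C true _))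
    obtain ⟨s', h1, h2, h3, h4, h5⟩ := ih _ (by
      rw [Function.update_of_ne hC3.symm, Function.update_of_ne (by decide),
        Function.update_self, hs, List.tail_cons] :
      (Function.update (Function.update (Function.update s 3 (s 3).tail) 4
        (true :: Function.update s 3 (s 3).tail 4)) C
        (true :: Function.update (Function.update s 3 (s 3).tail) 4
        (true :: Function.update s 3 (s 3).tail 4) C)) 3 = l)
    refine ⟨s', ?_, h2, ?_, ?_, ?_⟩
    · have := Run.loop_step (by simp [hs]) hrun h1
      convert this using 1
      simp; ring
    · rw [h3]
      simp [hC4.symm, List.replicate_succ', List.append_assoc]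
    · rw [h4]
      simp [hC3, hC4, List.replicate_succ', List.append_assoc]
    · intro r r3 r4 rC
      rw [h5 r r3 r4 rC]; simp [r3, r4, rC]

theorem run_tmp_to_fuel (O : Oracle) (l : List Bool) :
    ∀ s : Store, s 4 = l → ∃ s', Run O (.loop 4 (.seq (.pop 4) (.push 3 true))) s
      (3 * l.length + 1) s' ∧ s' 4 = [] ∧ s' 3 = List.replicate l.length true ++ s 3 ∧
      ∀ r, r ≠ 3 → r ≠ 4 → s' r = s r := by
  induction l with
  | nil => intro s hs; exact ⟨s, .loop_done hs, hs, by simp, fun _ _ _ => rfl⟩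
  | cons b l ih =>
    intro s hs
    have hrun := Run.seq (Run.pop (O := O) 4 s) (Run.push 3 true (Function.update s 4 (s 4).tail))
    obtain ⟨s', h1, h2, h3, h5⟩ := ih _ (by
      rw [Function.update_of_ne (by decide), Function.update_self, hs, List.tail_cons] :
      (Function.update (Function.update s 4 (s 4).tail) 3
        (true :: Function.update s 4 (s 4).tail 3)) 4 = l)
    refine ⟨s', ?_, h2, ?_, ?_⟩
    · have := Run.loop_step (by simp [hs]) hrun h1
      convert this using 1
      simp; ring
    · rw [h3]
      simp [List.replicate_succ', List.append_assoc]
    · intro r r3 r4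
      rw [h5 r r3 r4]; simp [r3, r4]

/-- The compiled command computes `eval` within the time bound `cost`. -/
theorem run_compile (O : Oracle) (N : ℕ) (c : Cmd) : ∀ (k : ℕ) (s v : Store), c.ok = true →
    Represents N k s v → ∃ t ≤ c.cost.eval N, ∃ s', Run O (c.compile k) s t s' ∧
      Represents N k s' (c.eval O N v) ∧ ∀ j < k, s' (100 + j) = s (100 + j) := by
  induction c with
  | skip => intro k s v _ h; exact ⟨1, by simp [cost], s, .skip s, h, fun _ _ => rfl⟩
  | push r b =>
    intro k s v hok h
    refine ⟨1, by simp [cost], _, .push r b s, ?_, fun j _ => ?_⟩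
    · rw [h.eq r hok]; exact h.update hok _
    · rw [Function.update_of_ne (by have := okReg_iff.1 hok; omega)]
  | pop r =>
    intro k s v hok h
    refine ⟨1, by simp [cost], _, .pop r s, ?_, fun j _ => ?_⟩
    · rw [h.eq r hok]; exact h.update hok _
    · rw [Function.update_of_ne (by have := okReg_iff.1 hok; omega)]
  | query x y a =>
    intro k s v hok h
    simp only [ok, Bool.and_eq_true] at hok
    refine ⟨1, by simp [cost], _, .query x y a s, ?_, fun j _ => ?_⟩
    · rw [h.eq x hok.1.1, h.eq y hok.1.2]; exact h.update hok.2 _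
    · rw [Function.update_of_ne (by have := okReg_iff.1 hok.2; omega)]
  | seq c d ihc ihd =>
    intro k s v hok h
    simp only [ok, Bool.and_eq_true] at hok
    obtain ⟨t₁, ht₁, s₁, hr₁, h₁, hk₁⟩ := ihc k s v hok.1 h
    obtain ⟨t₂, ht₂, s₂, hr₂, h₂, hk₂⟩ := ihd k s₁ _ hok.2 h₁
    exact ⟨t₁ + t₂, by simp [cost]; omega, s₂, .seq hr₁ hr₂, h₂,
      fun j hj => (hk₂ j hj).trans (hk₁ j hj)⟩
  | branch r c c₀ c₁ ih ih₀ ih₁ =>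
    intro k s v hok h
    simp only [ok, Bool.and_eq_true] at hok
    have hr := h.eq r hok.1.1.1
    rcases hv : v r with _ | ⟨_ | _, l⟩
    · obtain ⟨t, ht, s', hrun, h', hk⟩ := ih k s v hok.1.1.2 h
      exact ⟨t + 1, by simp [cost]; omega, s', .branch_empty (by simp [hr, hv]) hrun,
        by simpa [eval, hv] using h', hk⟩
    · obtain ⟨t, ht, s', hrun, h', hk⟩ := ih₀ k s v hok.1.2 h
      exact ⟨t + 1, by simp [cost]; omega, s', .branch_false (by simp [hr, hv]) hrun,
        by simpa [eval, hv] using h', hk⟩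
    · obtain ⟨t, ht, s', hrun, h', hk⟩ := ih₁ k s v hok.2 h
      exact ⟨t + 1, by simp [cost]; omega, s', .branch_true (by simp [hr, hv]) hrun,
        by simpa [eval, hv] using h', hk⟩
  | rep c ih =>
    intro k s v hok h
    -- Inside the loop body the counter `100 + k` is in use, so only the counters from `k + 1` on
    -- are required to be empty; it is empty again when the loop ends.
    have main : ∀ (n : ℕ) (s v : Store), s (100 + k) = List.replicate n true →
        Represents N (k + 1) s v → ∃ t ≤ n * (c.cost.eval N + 2) + 1, ∃ s',
          Run O (.loop (100 + k) (.seq (.pop (100 + k)) (c.compile (k + 1)))) s t s' ∧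
          Represents N k s' ((c.eval O N)^[n] v) ∧ ∀ j < k, s' (100 + j) = s (100 + j) := by
      intro n
      induction n with
      | zero =>
        intro s v hs h
        refine ⟨1, by simp, s, .loop_done hs, ⟨h.eq, h.fuel, h.tmp, fun j hj => ?_⟩, fun _ _ => rfl⟩
        rcases hj.eq_or_lt with rfl | hj
        · exact hs
        · exact h.counters j hj
      | succ n ihn =>
        intro s v hs h
        have h0 : Represents N (k + 1) (Function.update s (100 + k) (s (100 + k)).tail) v := by
          refine ⟨fun r hr => ?_, ?_, ?_, fun j hj => ?_⟩
          · rw [Function.update_of_ne (by have := okReg_iff.1 hr; omega)]; exact h.eq r hr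
          · rw [Function.update_of_ne (by omega)]; exact h.fuel
          · rw [Function.update_of_ne (by omega)]; exact h.tmp
          · rw [Function.update_of_ne (by omega)]; exact h.counters j hj
        obtain ⟨t₁, ht₁, s₁, hr₁, h₁, hk₁⟩ := ih (k + 1) _ v hok h0
        obtain ⟨t₂, ht₂, s₂, hr₂, h₂, hk₂⟩ := ihn s₁ _ (by
          rw [hk₁ k (Nat.lt_succ_self k), Function.update_self, hs]; rfl) h₁
        refine ⟨1 + t₁ + t₂ + 1, by nlinarith, s₂,
          .loop_step (by simp [hs, List.replicate_succ]) (.seq (.pop _ s) hr₁) hr₂, h₂,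
          fun j hj => ?_⟩
        rw [hk₂ j hj, hk₁ j (by omega), Function.update_of_ne (by omega)]
    obtain ⟨s₁, hr₁, a1, a2, a3, a4⟩ :=
      run_fuel_to_counter O (C := 100 + k) (by omega) (by omega) (s 3) s rfl
    obtain ⟨s₂, hr₂, b1, b2, b3⟩ := run_tmp_to_fuel O (s₁ 4) s₁ rfl
    have hl : (s₁ 4).length = N := by rw [a2]; simp [h.tmp, h.fuel]
    rw [h.fuel] at hr₁ a3
    rw [hl] at hr₂ b2
    obtain ⟨t, ht, s₃, hr₃, h₃, hk₃⟩ := main N s₂ v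
      (by rw [b3 _ (by omega) (by omega), a3, h.counters k le_rfl, List.append_nil])
      ⟨fun r hr => by
        obtain ⟨r3, r4, r100⟩ := okReg_iff.1 hr
        rw [b3 r r3 r4, a4 r r3 r4 (by omega), h.eq r hr], by simp [b2, a1], b1, fun j hj => by
        rw [b3 _ (by omega) (by omega), a4 _ (by omega) (by omega) (by omega),
          h.counters j (by omega)]⟩
    refine ⟨_, ?_, s₃, .seq hr₁ (.seq hr₂ hr₃), h₃, fun j hj => ?_⟩
    -- The three loops take `4 * N + 1`, `3 * N + 1` and at most `N * (cost + 2) + 1` steps.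
    · simp only [cost, eval_add, eval_mul, eval_X, eval_ofNat]; nlinarith
    · rw [hk₃ j hj, b3 _ (by omega) (by omega), a4 _ (by omega) (by omega) (by omega)]

/-- Stack `r` is not changed by the command. -/
def keeps (r : ℕ) : Cmd → Bool
  | skip => true
  | push a _ => r != a
  | pop a => r != a
  | query _ _ a => r != a
  | seq c d => c.keeps r && d.keeps r
  | branch _ c c₀ c₁ => c.keeps r && c₀.keeps r && c₁.keeps r
  | rep c => c.keeps r

/-- A frame rule. As `keeps` is a Boolean function, its hypothesis can be settled by computation for
a concrete program, and stores need not be tracked on untouched stacks. -/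
theorem eval_keeps {O : Oracle} {N r : ℕ} : ∀ (c : Cmd) (s : Store), c.keeps r = true →
    c.eval O N s r = s r := by
  intro c
  induction c with
  | skip => intro s _; rfl
  | push a b | pop a | query x y a =>
    intro s h; simp only [keeps, bne_iff_ne] at h; simp [eval, h]
  | seq c d ihc ihd =>
    intro s h
    simp only [keeps, Bool.and_eq_true] at h
    simp [eval, ihd _ h.2, ihc _ h.1]
  | branch a c c₀ c₁ ih ih₀ ih₁ =>
    intro s h
    simp only [keeps, Bool.and_eq_true] at h
    rcases hv : s a with _ | ⟨_ | _, l⟩ <;> simp [eval, hv, ih, ih₀, ih₁, h]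
  | rep c ih =>
    intro s h
    have : ∀ n s, (c.eval O N)^[n] s r = s r := by
      intro n
      induction n with
      | zero => intro s; rfl
      | succ n ihn => intro s; rw [Function.iterate_succ_apply, ihn, ih _ h]
    exact this N s

end Cmd

/-! ### Commands as AM verifiers -/

theorem uniformProb_univ (n : ℕ) : uniformProb (Set.univ : Set (Bits n)) = 1 := by
  simp [uniformProb, Set.ncard_univ]

open Cmd in
/-- A bounded-loop command, followed by the test whether stack `11` is empty, is an AM verifier if it
separates the instances. -/
theorem inAMWithOracle_of_cmd {𝓞 : Set Oracle} {yes no : Set (List Bool × Oracle)} (M : Cmd)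
    (hM : M.ok = true) (c ℓ : ℕ[X])
    (hyes : ∀ x O, (x, O) ∈ yes → ∃ r : Bits (ℓ.eval x.length) → Bits (ℓ.eval x.length),
      2 / 3 ≤ uniformProb {q | M.eval O (c.eval x.length)
        (inputStore [x, List.ofFn q, List.ofFn (r q)]) 11 = []})
    (hno : ∀ x O, (x, O) ∈ no → ∀ r : Bits (ℓ.eval x.length) → Bits (ℓ.eval x.length),
      uniformProb {q | M.eval O (c.eval x.length)
        (inputStore [x, List.ofFn q, List.ofFn (r q)]) 11 = []} ≤ 1 / 3) :
    InAMWithOracle 𝓞 yes no := by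
  classical
  refine ⟨ℓ, fun O x q r => decide (M.eval O (c.eval x.length)
    (inputStore [x, List.ofFn q, List.ofFn r]) 11 = []), ?_, ?_, ?_⟩
  · let M' : Cmd := M ;; branch 11 (push 0 true) (push 0 false) (push 0 false)
    have key : ∀ (O : Oracle) (x : List Bool) (q r : Bits (ℓ.eval x.length))
        (w : Bits (c.eval x.length)), OutputsWithin O (M'.compile 0) ((M'.cost.comp c).eval x.length)
          [x, List.ofFn q, List.ofFn r, List.ofFn w] (decide (M.eval O (c.eval x.length)
            (inputStore [x, List.ofFn q, List.ofFn r]) 11 = [])) := by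
      intro O x q r w
      -- The coins `w` are on stack `3`, which is the fuel. The represented store omits them, so the
      -- result depends on their number `c.eval x.length` alone.
      obtain ⟨t, ht, s', hrun, hs', -⟩ := run_compile O (c.eval x.length) M' 0
        (inputStore [x, List.ofFn q, List.ofFn r, List.ofFn w])
        (inputStore [x, List.ofFn q, List.ofFn r]) (by simp [M', ok, hM, okReg]) (by
          refine ⟨fun r hr => ?_, by simp [inputStore], by simp [inputStore], fun j _ => ?_⟩
          · obtain ⟨r3, r4, -⟩ := okReg_iff.1 hr
            rcases r with _ | _ | _ | _ | r <;> simp_all [inputStore]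
          · simp [inputStore, List.getD, show 100 + j = j + 96 + 4 by omega])
      refine ⟨t, by simpa [eval_comp] using ht, s', hrun, ?_⟩
      rw [hs'.eq 0 (by decide)]
      simp only [M', Cmd.eval]
      rcases h : M.eval O (c.eval x.length) (inputStore [x, List.ofFn q, List.ofFn r]) 11 with
        _ | ⟨_ | _, l⟩ <;> simp
    refine ⟨M'.compile 0, c, M'.cost.comp c, fun O _ x q r => ⟨fun w => ⟨_, key O x q r w⟩, ?_⟩⟩
    -- Every coin string leads to the right answer, so the success probability is one.
    refine le_of_le_of_eq (by norm_num) ((uniformProb_univ (c.eval x.length)).symm.trans ?_)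
    exact congrArg uniformProb (Set.eq_univ_of_forall fun w => key O x q r w).symm
  · intro x O h; simpa using hyes x O h
  · intro x O h; simpa using hno x O h

/-! ### Sums over bit strings -/

/-- All bit strings of length `n`. -/
def bitLists (n : ℕ) : Finset (List Bool) :=
  (Finset.univ : Finset (Bits n)).map ⟨List.ofFn, List.ofFn_injective⟩

@[simp] theorem mem_bitLists {n : ℕ} {l : List Bool} : l ∈ bitLists n ↔ l.length = n := by
  constructor
  · rintro h
    obtain ⟨f, -, rfl⟩ := Finset.mem_map.1 h
    simp
  · rintro rfl
    exact Finset.mem_map.2 ⟨l.get, Finset.mem_univ _, by simp⟩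

theorem card_bitLists (n : ℕ) : (bitLists n).card = 2 ^ n := by simp [bitLists]

theorem sum_ofFn {M : Type*} [AddCommMonoid M] (n : ℕ) (f : List Bool → M) :
    ∑ x : Bits n, f (List.ofFn x) = ∑ l ∈ bitLists n, f l := by
  simp [bitLists]

theorem sum_bitLists_add {M : Type*} [AddCommMonoid M] (a b : ℕ) (f : List Bool → M) :
    ∑ l ∈ bitLists (a + b), f l = ∑ u ∈ bitLists a, ∑ v ∈ bitLists b, f (u ++ v) := by
  rw [← Finset.sum_product']
  refine Finset.sum_bij' (fun l _ => (l.take a, l.drop a)) (fun p _ => p.1 ++ p.2) ?_ ?_ ?_ ?_ ?_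
  · intro l hl; simp_all
  · rintro ⟨u, v⟩ h; simp_all
  · intro l _; simp
  · rintro ⟨u, v⟩ h
    simp only [Finset.mem_product, mem_bitLists] at h
    simp [← h.1]
  · intro l _; simp

theorem sum_bitLists_zero {M : Type*} [AddCommMonoid M] (f : List Bool → M) :
    ∑ l ∈ bitLists 0, f l = f [] := by
  rw [← sum_ofFn]; simp

theorem sum_bitLists_one {M : Type*} [AddCommMonoid M] (f : List Bool → M) :
    ∑ l ∈ bitLists 1, f l = f [false] + f [true] := by
  rw [show bitLists 1 = {[false], [true]} by decide]
  rw [Finset.sum_pair (by decide)]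

theorem sum_bitLists_succ {M : Type*} [AddCommMonoid M] (n : ℕ) (f : List Bool → M) :
    ∑ l ∈ bitLists (n + 1), f l = ∑ l ∈ bitLists n, (f (false :: l) + f (true :: l)) := by
  rw [add_comm n 1, sum_bitLists_add, sum_bitLists_one, Finset.sum_add_distrib]; rfl

theorem ncard_setOf_ofFn {n : ℕ} (P : List Bool → Prop) [DecidablePred P] :
    {q : Bits n | P (List.ofFn q)}.ncard = ∑ l ∈ bitLists n, if P l then 1 else 0 := by
  rw [← sum_ofFn n (fun l => if P l then 1 else 0), Finset.sum_boole, Nat.cast_id,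
    ← Set.ncard_coe_finset]
  simp

/-! ### Linear hashing -/

/-- The inner product of bit strings modulo two. -/
def dot : List Bool → List Bool → Bool
  | a :: u, b :: v => (a && b) ^^ dot u v
  | _, _ => false

/-- The hash value of `u` vanishes: `m` consecutive blocks of `q` are orthogonal to `u`. -/
def hashZero : ℕ → List Bool → List Bool → Bool
  | 0, _, _ => true
  | m + 1, u, q => !dot u (q.take u.length) && hashZero m u (q.drop u.length)

/-- The sum of `v` and `v'` modulo two is nonzero, and a nonzero linear form over the field with two
elements takes each value on half of the space. The induction removes leading bits until they
differ; then the leading bit of `a` settles the value. -/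
theorem two_mul_card_dot_eq {n : ℕ} : ∀ {v v' : List Bool}, v.length = n → v'.length = n →
    v ≠ v' → ∀ c : Bool, 2 * ∑ a ∈ bitLists n, (if (dot v a ^^ dot v' a) = c then 1 else 0) = 2 ^ n := by
  induction n with
  | zero => intro v v' h h' hne; simp_all [List.length_eq_zero_iff]
  | succ n ih =>
    intro v v' h h' hne c
    obtain ⟨b, v, rfl⟩ := List.exists_cons_of_length_eq_add_one h
    obtain ⟨b', v', rfl⟩ := List.exists_cons_of_length_eq_add_one h'
    simp only [List.length_cons, Nat.add_right_cancel_iff] at h h'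
    rw [sum_bitLists_succ]
    by_cases hb : b = b'
    · subst hb
      have hne' : v ≠ v' := fun e => hne (by rw [e])
      have := ih h h' hne' c
      rw [pow_succ, ← this, mul_assoc, Finset.sum_mul]
      congr 1
      refine Finset.sum_congr rfl fun a _ => ?_
      rw [mul_two]
      cases hx : dot v a <;> cases hy : dot v' a <;> cases b <;> cases c <;> simp [dot, hx, hy]
    · have : ∀ a, (if (dot (b :: v) (false :: a) ^^ dot (b' :: v') (false :: a)) = c then 1 else 0) +
          (if (dot (b :: v) (true :: a) ^^ dot (b' :: v') (true :: a)) = c then 1 else 0) = 1 := by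
        intro a
        obtain rfl : b' = !b := by revert hb; cases b <;> cases b' <;> simp
        cases hx : dot v a <;> cases hy : dot v' a <;> cases b <;> cases c <;> simp [dot, hx, hy]
      simp only [this, Finset.sum_const, card_bitLists, pow_succ]
      simp [mul_comm]

/-- The leading one of the vector makes the form nonzero: for fixed remaining bits, exactly one
choice of the first bit of `a` works. Prefixing a one turns linear hashing into affine hashing, so
the zero string needs no special treatment. -/
theorem sum_dot_true_cons {n : ℕ} (v : List Bool) :
    ∑ a ∈ bitLists (n + 1), (if dot (true :: v) a = false then 1 else 0) = 2 ^ n := by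
  rw [sum_bitLists_succ]
  have : ∀ a, (if dot (true :: v) (false :: a) = false then 1 else 0) +
      (if dot (true :: v) (true :: a) = false then 1 else 0) = 1 := by
    intro a
    cases hx : dot v a <;> simp [dot, hx]
  simp only [this, Finset.sum_const, card_bitLists]
  simp

/-- With first bit `c`, both forms vanish if and only if `v` and `v'` both have inner product `c`
with the rest. Hence there is one suitable `c` if the two inner products agree and none otherwise,
and agreement has probability one half. -/
theorem two_mul_sum_dot_pair {n : ℕ} {v v' : List Bool} (h : v.length = n) (h' : v'.length = n)
    (hne : v ≠ v') :
    2 * ∑ a ∈ bitLists (n + 1),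
      (if dot (true :: v) a = false ∧ dot (true :: v') a = false then 1 else 0) = 2 ^ n := by
  rw [sum_bitLists_succ, ← two_mul_card_dot_eq h h' hne false]
  congr 1
  refine Finset.sum_congr rfl fun a _ => ?_
  cases hx : dot v a <;> cases hy : dot v' a <;> simp [dot, hx, hy]

theorem hashZero_append {m : ℕ} {u a b : List Bool} (h : a.length = u.length) :
    hashZero (m + 1) u (a ++ b) = (!dot u a && hashZero m u b) := by
  simp [hashZero, ← h]

/-- The rows of the hash function are disjoint blocks of `q`, hence independent, and each
contributes a factor one half. Superfluous bits at the end of `q` do no harm. -/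
theorem sum_hashZero {K : ℕ} {v : List Bool} (hv : v.length = K) (m : ℕ) :
    ∀ l, m * (K + 1) ≤ l →
      2 ^ m * ∑ q ∈ bitLists l, (if hashZero m (true :: v) q then 1 else 0) = 2 ^ l := by
  induction m with
  | zero => intro l _; simp [hashZero, card_bitLists]
  | succ m ih =>
    intro l hl
    obtain ⟨l, rfl⟩ := Nat.exists_eq_add_of_le (show K + 1 ≤ l by nlinarith)
    have hl' : m * (K + 1) ≤ l := by nlinarith
    rw [sum_bitLists_add]
    have : ∀ a ∈ bitLists (K + 1), ∑ b ∈ bitLists l,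
        (if hashZero (m + 1) (true :: v) (a ++ b) then 1 else 0) =
        (if dot (true :: v) a = false then 1 else 0) *
          ∑ b ∈ bitLists l, (if hashZero m (true :: v) b then 1 else 0) := by
      intro a ha
      rw [Finset.mul_sum]
      refine Finset.sum_congr rfl fun b _ => ?_
      rw [hashZero_append (by simp_all)]
      cases dot (true :: v) a <;> simp
    rw [Finset.sum_congr rfl this, ← Finset.sum_mul, sum_dot_true_cons, pow_add 2 (K + 1) l, ← ih l hl']
    ring

theorem sum_hashZero_pair {K : ℕ} {v v' : List Bool} (hv : v.length = K) (hv' : v'.length = K)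
    (hne : v ≠ v') (m : ℕ) : ∀ l, m * (K + 1) ≤ l →
      4 ^ m * ∑ q ∈ bitLists l,
        (if hashZero m (true :: v) q ∧ hashZero m (true :: v') q then 1 else 0) = 2 ^ l := by
  induction m with
  | zero => intro l _; simp [hashZero, card_bitLists]
  | succ m ih =>
    intro l hl
    obtain ⟨l, rfl⟩ := Nat.exists_eq_add_of_le (show K + 1 ≤ l by nlinarith)
    have hl' : m * (K + 1) ≤ l := by nlinarith
    rw [sum_bitLists_add]
    have : ∀ a ∈ bitLists (K + 1), ∑ b ∈ bitLists l,
        (if hashZero (m + 1) (true :: v) (a ++ b) ∧ hashZero (m + 1) (true :: v') (a ++ b)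
          then 1 else 0) =
        (if dot (true :: v) a = false ∧ dot (true :: v') a = false then 1 else 0) *
          ∑ b ∈ bitLists l,
            (if hashZero m (true :: v) b ∧ hashZero m (true :: v') b then 1 else 0) := by
      intro a ha
      rw [Finset.mul_sum]
      refine Finset.sum_congr rfl fun b _ => ?_
      rw [hashZero_append (by simp_all), hashZero_append (by simp_all)]
      cases dot (true :: v) a <;> cases dot (true :: v') a <;> simp
    rw [Finset.sum_congr rfl this, ← Finset.sum_mul, pow_add 2 (K + 1) l, ← ih l hl', pow_succ 2 K,
      ← two_mul_sum_dot_pair hv hv' hne]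
    ring

/-- The expected number of elements with hash value zero. Strings are reversed because the verifier
records a witness on a stack, where the bit that was read last is on top. -/
theorem sum_sum_hashZero {K m l : ℕ} (S : Finset (List Bool)) (hS : ∀ s ∈ S, s.length = K)
    (hl : m * (K + 1) ≤ l) :
    2 ^ m * ∑ q ∈ bitLists l, ∑ s ∈ S, (if hashZero m (true :: s.reverse) q then 1 else 0) =
      S.card * 2 ^ l := by
  rw [Finset.sum_comm, Finset.mul_sum, Finset.sum_congr rfl fun s hs =>
    sum_hashZero (v := s.reverse) (by simpa using hS s hs) m l hl]
  simp

/-- Union bound: the probability is at most the expected number of elements with hash value zero,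
which is `S.card / 2 ^ m`. -/
theorem uniformProb_hash_le {K m l : ℕ} (S : Finset (List Bool)) (hS : ∀ s ∈ S, s.length = K)
    (hl : m * (K + 1) ≤ l) (h : 3 * S.card ≤ 2 ^ m) (A : Set (Bits l))
    (hA : ∀ q ∈ A, ∃ s ∈ S, hashZero m (true :: s.reverse) (List.ofFn q) = true) :
    uniformProb A ≤ 1 / 3 := by
  classical
  have h1 : A.ncard ≤ ∑ q ∈ bitLists l, ∑ s ∈ S,
      (if hashZero m (true :: s.reverse) q then 1 else 0) := by
    refine (Set.ncard_le_ncard (t := {q : Bits l | ∃ s ∈ S,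
      hashZero m (true :: s.reverse) (List.ofFn q) = true}) hA (Set.toFinite _)).trans ?_
    rw [ncard_setOf_ofFn (fun q => ∃ s ∈ S, hashZero m (true :: s.reverse) q = true)]
    refine Finset.sum_le_sum fun q _ => ?_
    split_ifs with hq
    · obtain ⟨s, hs, hz⟩ := hq
      exact le_of_eq_of_le (by simp [hz])
        (Finset.single_le_sum (f := fun s => if hashZero m (true :: s.reverse) q then 1 else 0)
          (fun _ _ => Nat.zero_le _) hs)
    · exact Nat.zero_le _
  have h2 := sum_sum_hashZero S hS hl
  have h3 : 3 * A.ncard ≤ 2 ^ l := by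
    refine Nat.le_of_mul_le_mul_left (c := 2 ^ m) ?_ (by positivity)
    calc 2 ^ m * (3 * A.ncard) ≤ 3 * (S.card * 2 ^ l) := by rw [← h2]; nlinarith [Nat.zero_le (2 ^ m)]
      _ ≤ 2 ^ m * 2 ^ l := by rw [← mul_assoc]; gcongr
  rw [uniformProb, div_le_div_iff₀ (by positivity) (by norm_num)]
  have : (3 : ℝ) * A.ncard ≤ 2 ^ l := by exact_mod_cast h3
  linarith

/-- Second moment method. The number `Y` of elements with hash value zero has mean `E ≥ 4` and, by
pairwise independence, variance at most `E`. By Chebyshev's inequality, `Y = 0` has probability at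
most `1 / E ≤ 1 / 4`. -/
theorem le_uniformProb_hash {K m l : ℕ} (S : Finset (List Bool)) (hS : ∀ s ∈ S, s.length = K)
    (hl : m * (K + 1) ≤ l) (h : 4 * 2 ^ m ≤ S.card) :
    2 / 3 ≤ uniformProb {q : Bits l | ∃ s ∈ S,
      hashZero m (true :: s.reverse) (List.ofFn q) = true} := by
  classical
  set Y : List Bool → ℝ := fun q =>
    ∑ s ∈ S, (if hashZero m (true :: s.reverse) q then 1 else 0) with hY
  set E : ℝ := S.card / 2 ^ m with hE
  have hE4 : 4 ≤ E := by
    rw [hE, le_div_iff₀ (by positivity)]; exact_mod_cast h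
  have m1 : ∑ q ∈ bitLists l, Y q = E * 2 ^ l := by
    have := sum_sum_hashZero S hS hl
    rw [hE, div_mul_eq_mul_div, eq_div_iff (by positivity), mul_comm]
    simp only [hY]
    exact_mod_cast this
  -- Expand the square: the diagonal pairs contribute `E`, and the pairs of distinct elements at
  -- most `E ^ 2`.
  have m2 : ∑ q ∈ bitLists l, Y q ^ 2 ≤ (E + E ^ 2) * 2 ^ l := by
    have e1 : ∀ q, Y q ^ 2 = ∑ s ∈ S, ∑ s' ∈ S,
        (if hashZero m (true :: s.reverse) q ∧ hashZero m (true :: s'.reverse) q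
          then (1 : ℝ) else 0) := by
      intro q
      rw [sq, hY, Finset.sum_mul_sum]
      refine Finset.sum_congr rfl fun s _ => Finset.sum_congr rfl fun s' _ => ?_
      cases hashZero m (true :: s.reverse) q <;> cases hashZero m (true :: s'.reverse) q <;> simp
    have e2 : ∀ s ∈ S, ∑ s' ∈ S, ∑ q ∈ bitLists l,
        (if hashZero m (true :: s.reverse) q ∧ hashZero m (true :: s'.reverse) q
          then (1 : ℝ) else 0) ≤ 2 ^ l / 2 ^ m + E * (2 ^ l / 2 ^ m) := by
      intro s hs
      rw [← Finset.add_sum_erase _ _ hs]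
      refine add_le_add ?_ ?_
      · have := sum_hashZero (v := s.reverse) (by simpa using hS s hs) m l hl
        simp only [and_self]
        rw [le_div_iff₀ (by positivity), mul_comm]
        exact_mod_cast this.le
      · have : ∀ s' ∈ S.erase s, ∑ q ∈ bitLists l,
            (if hashZero m (true :: s.reverse) q ∧ hashZero m (true :: s'.reverse) q
              then (1 : ℝ) else 0) = 2 ^ l / 4 ^ m := by
          intro s' hs'
          obtain ⟨hne, hs'⟩ := Finset.mem_erase.1 hs'
          have := sum_hashZero_pair (v := s.reverse) (v' := s'.reverse) (by simpa using hS s hs)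
            (by simpa using hS s' hs') (by simpa using hne.symm) m l hl
          rw [eq_div_iff (by positivity), mul_comm]
          exact_mod_cast this
        rw [Finset.sum_congr rfl this, Finset.sum_const, nsmul_eq_mul, hE,
          show (4 : ℝ) ^ m = 2 ^ m * 2 ^ m by rw [← mul_pow]; norm_num]
        have hc : ((S.erase s).card : ℝ) ≤ S.card := by
          exact_mod_cast Finset.card_le_card (Finset.erase_subset _ _)
        calc ((S.erase s).card : ℝ) * (2 ^ l / (2 ^ m * 2 ^ m))
            ≤ S.card * (2 ^ l / (2 ^ m * 2 ^ m)) := by gcongr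
          _ = _ := by field_simp
    calc ∑ q ∈ bitLists l, Y q ^ 2 = ∑ s ∈ S, ∑ s' ∈ S, ∑ q ∈ bitLists l,
        (if hashZero m (true :: s.reverse) q ∧ hashZero m (true :: s'.reverse) q
          then (1 : ℝ) else 0) := by
          simp_rw [e1]
          rw [Finset.sum_comm]
          exact Finset.sum_congr rfl fun s _ => Finset.sum_comm
      _ ≤ ∑ s ∈ S, (2 ^ l / 2 ^ m + E * (2 ^ l / 2 ^ m)) := Finset.sum_le_sum e2
      _ = (E + E ^ 2) * 2 ^ l := by
          rw [Finset.sum_const, nsmul_eq_mul, hE]; field_simp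
  have var : ∑ q ∈ bitLists l, (Y q - E) ^ 2 ≤ E * 2 ^ l := by
    have : ∑ q ∈ bitLists l, (Y q - E) ^ 2 =
        ∑ q ∈ bitLists l, Y q ^ 2 - 2 * E * ∑ q ∈ bitLists l, Y q + E ^ 2 * 2 ^ l := by
      rw [Finset.mul_sum, ← Finset.sum_sub_distrib]
      have : E ^ 2 * 2 ^ l = ∑ _q ∈ bitLists l, E ^ 2 := by
        rw [Finset.sum_const, card_bitLists, nsmul_eq_mul]; push_cast; ring
      rw [this, ← Finset.sum_add_distrib]
      exact Finset.sum_congr rfl fun q _ => by ring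
    rw [this, m1]; nlinarith
  -- Where no element has hash value zero, the squared deviation from the mean is exactly `E ^ 2`.
  have bad : (∑ q ∈ bitLists l, if ∃ s ∈ S, hashZero m (true :: s.reverse) q = true
      then (0 : ℝ) else 1) * E ^ 2 ≤ E * 2 ^ l := by
    refine le_trans ?_ var
    rw [Finset.sum_mul]
    refine Finset.sum_le_sum fun q _ => ?_
    split_ifs with hq
    · rw [zero_mul]; positivity
    · have : Y q = 0 := Finset.sum_eq_zero fun s hs => by
        rw [if_neg fun e => hq ⟨s, hs, e⟩]
      rw [this]; simp
  have good : ((∑ q ∈ bitLists l, if ∃ s ∈ S, hashZero m (true :: s.reverse) q = true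
      then 1 else 0 : ℕ) : ℝ) = 2 ^ l - ∑ q ∈ bitLists l,
        if ∃ s ∈ S, hashZero m (true :: s.reverse) q = true then (0 : ℝ) else 1 := by
    rw [eq_sub_iff_add_eq]
    push_cast
    rw [← Finset.sum_add_distrib]
    have : (2 : ℝ) ^ l = ∑ _q ∈ bitLists l, 1 := by simp [card_bitLists]
    rw [this]
    refine Finset.sum_congr rfl fun q _ => ?_
    split_ifs <;> simp
  rw [uniformProb, ncard_setOf_ofFn (fun q => ∃ s ∈ S, hashZero m (true :: s.reverse) q = true),
    good, le_div_iff₀ (by positivity)]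
  have hp : (0 : ℝ) < 2 ^ l := by positivity
  set B := ∑ q ∈ bitLists l,
    if ∃ s ∈ S, hashZero m (true :: s.reverse) q = true then (0 : ℝ) else 1
  have : B * E ≤ 2 ^ l := by nlinarith
  have hB : 0 ≤ B := Finset.sum_nonneg fun q _ => by split_ifs <;> norm_num
  nlinarith

/-! ### Counting walks -/

/-- The string `s` describes a walk with `i` steps from `x`: each step consists of the next vertex
and a label of length `κ`, which must be admissible. -/
def isWalk (edge : List Bool → List Bool → List Bool → Bool) (n κ : ℕ) :
    ℕ → List Bool → List Bool → Bool
  | 0, _, _ => true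
  | i + 1, x, s => edge x (s.take n) ((s.drop n).take κ) &&
      isWalk edge n κ i (s.take n) (s.drop (n + κ))

/-- Two arbitrary bits, a starting point and a walk with `i` steps. -/
def isWitness (edge : List Bool → List Bool → List Bool → Bool) (n κ i : ℕ) (s : List Bool) :
    Bool :=
  isWalk edge n κ i ((s.drop 2).take n) (s.drop (2 + n))

/-- The number of admissible labels of a step. -/
def edgeMatrix (edge : List Bool → List Bool → List Bool → Bool) (n κ : ℕ) :
    Matrix (Bits n) (Bits n) ℕ :=
  fun x y => ∑ z ∈ bitLists κ, if edge (List.ofFn x) (List.ofFn y) z then 1 else 0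

/-- Splitting off the first step (vertex, label, remaining walk) corresponds to `A ^ (i + 1) = A * A
^ i`: the sum over labels yields the factor `A x y`, and the induction hypothesis counts the rest.
-/
theorem sum_isWalk (edge : List Bool → List Bool → List Bool → Bool) (n κ i : ℕ) :
    ∀ x : Bits n, ∑ s ∈ bitLists (i * (n + κ)),
      (if isWalk edge n κ i (List.ofFn x) s then 1 else 0) =
        ∑ y, (edgeMatrix edge n κ ^ i) x y := by
  induction i with
  | zero =>
    intro x
    rw [Nat.zero_mul, sum_bitLists_zero]
    simp [isWalk, Matrix.one_apply]
  | succ i ih =>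
    intro x
    rw [show (i + 1) * (n + κ) = n + (κ + i * (n + κ)) by ring, sum_bitLists_add, ← sum_ofFn,
      pow_succ']
    simp_rw [Matrix.mul_apply]
    conv_rhs => rw [Finset.sum_comm]
    refine Finset.sum_congr rfl fun y _ => ?_
    rw [← Finset.mul_sum, ← ih y, sum_bitLists_add, edgeMatrix, Finset.sum_mul]
    refine Finset.sum_congr rfl fun z hz => ?_
    rw [Finset.mul_sum]
    refine Finset.sum_congr rfl fun s _ => ?_
    rw [mem_bitLists] at hz
    have e1 : (List.ofFn y ++ (z ++ s)).take n = List.ofFn y := by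
      rw [List.take_append_of_le_length (by simp), List.take_of_length_le (by simp)]
    have e2 : (List.ofFn y ++ (z ++ s)).drop n = z ++ s := by
      rw [List.drop_append_of_le_length (by simp), List.drop_eq_nil_of_le (by simp)]; rfl
    rw [isWalk, ← List.drop_drop, e1, e2, List.take_append_of_le_length (by omega),
      List.take_of_length_le hz.le, List.drop_append_of_le_length (by omega),
      List.drop_eq_nil_of_le hz.le, List.nil_append]
    cases edge (List.ofFn x) (List.ofFn y) z <;> simp

/-- The strings that describe walks with `i` steps. -/
def witnesses (edge : List Bool → List Bool → List Bool → Bool) (n κ i : ℕ) :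
    Finset (List Bool) :=
  {s ∈ bitLists (2 + (n + i * (n + κ))) | isWitness edge n κ i s = true}

/-- The factor four comes from the two arbitrary bits. It provides the room that
`le_uniformProb_hash` needs when the number of walks just reaches `2 ^ m`. -/
theorem card_witnesses (edge : List Bool → List Bool → List Bool → Bool) (n κ i : ℕ) :
    (witnesses edge n κ i).card = 4 * ∑ x, ∑ y, (edgeMatrix edge n κ ^ i) x y := by
  rw [witnesses, Finset.card_filter, sum_bitLists_add]
  have : ∀ u ∈ bitLists 2, ∑ v ∈ bitLists (n + i * (n + κ)),
      (if isWitness edge n κ i (u ++ v) = true then (1 : ℕ) else 0) =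
        ∑ x, ∑ y, (edgeMatrix edge n κ ^ i) x y := by
    intro u hu
    rw [mem_bitLists] at hu
    rw [sum_bitLists_add, ← sum_ofFn]
    refine Finset.sum_congr rfl fun x _ => ?_
    rw [← sum_isWalk]
    refine Finset.sum_congr rfl fun s _ => ?_
    have e0 : (u ++ (List.ofFn x ++ s)).drop 2 = List.ofFn x ++ s := by
      rw [List.drop_append_of_le_length hu.ge, List.drop_eq_nil_of_le hu.le]; rfl
    rw [isWitness, ← List.drop_drop, e0, List.take_append_of_le_length (by simp),
      List.take_of_length_le (by simp), List.drop_append_of_le_length (by simp),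
      List.drop_eq_nil_of_le (by simp), List.nil_append]
  rw [Finset.sum_congr rfl this, Finset.sum_const, card_bitLists]
  simp

/-! ### The largest eigenvalue of a non-negative symmetric matrix -/

section Spectral

open Matrix

variable {n : ℕ} {G : Matrix (Bits n) (Bits n) ℝ}

theorem exists_eigenvalue_decomposition (hG : G.IsSymm) :
    ∃ (U : Matrix (Bits n) (Bits n) ℝ) (e : Bits n → ℝ), Uᵀ * U = 1 ∧ U * Uᵀ = 1 ∧
      (∀ N, G ^ N = U * diagonal (fun i => e i ^ N) * Uᵀ) ∧ spectrum ℝ G = Set.range e := by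
  have hH : G.IsHermitian := by rw [IsHermitian, conjTranspose_eq_transpose_of_trivial]; exact hG
  refine ⟨hH.eigenvectorUnitary, hH.eigenvalues, ?_, ?_, fun N => ?_,
    hH.spectrum_real_eq_range_eigenvalues⟩
  · have := Unitary.coe_star_mul_self hH.eigenvectorUnitary
    rwa [star_eq_conjTranspose, conjTranspose_eq_transpose_of_trivial] at this
  · have := Unitary.coe_mul_star_self hH.eigenvectorUnitary
    rwa [Unitary.coe_star, star_eq_conjTranspose, conjTranspose_eq_transpose_of_trivial] at this
  · conv_lhs => rw [hH.spectral_theorem, ← map_pow, diagonal_pow]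
    rw [Unitary.conjStarAlgAut_apply, star_eq_conjTranspose,
      conjTranspose_eq_transpose_of_trivial]
    rfl

/-- The quadratic form of a symmetric matrix in terms of its eigenvalues. -/
theorem sum_mul_pow_mul {U : Matrix (Bits n) (Bits n) ℝ} {e : Bits n → ℝ} {N : ℕ}
    (hN : G ^ N = U * diagonal (fun i => e i ^ N) * Uᵀ) (u : Bits n → ℝ) :
    ∑ x, ∑ y, u x * (G ^ N) x y * u y = ∑ j, e j ^ N * (∑ x, U x j * u x) ^ 2 := by
  have hxy : ∀ x y, (G ^ N) x y = ∑ j, U x j * e j ^ N * U y j := fun x y => by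
    rw [hN, mul_apply]
    simp only [mul_diagonal, transpose_apply]
  simp only [hxy, sq, Finset.mul_sum, Finset.sum_mul]
  calc _ = ∑ x, ∑ j, ∑ y, u x * (U x j * e j ^ N * U y j) * u y :=
        Finset.sum_congr rfl fun x _ => Finset.sum_comm
    _ = ∑ j, ∑ x, ∑ y, u x * (U x j * e j ^ N * U y j) * u y := Finset.sum_comm
    _ = _ := Finset.sum_congr rfl fun j _ => Finset.sum_congr rfl fun x _ =>
        Finset.sum_congr rfl fun y _ => by ring

/-- Parseval's identity, read off from the quadratic form of the identity matrix with all
eigenvalues set to one. -/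
theorem sum_sq_coordinates {U : Matrix (Bits n) (Bits n) ℝ} (hU : U * Uᵀ = 1) (u : Bits n → ℝ) :
    ∑ j, (∑ x, U x j * u x) ^ 2 = ∑ x, u x ^ 2 := by
  have h : (1 : Matrix (Bits n) (Bits n) ℝ) ^ 0 = U * diagonal (fun i => (fun _ => (1 : ℝ)) i ^ 0) * Uᵀ := by
    simp [hU]
  have := sum_mul_pow_mul (e := fun _ => 1) h u
  simp only [pow_zero, one_mul] at this
  rw [← this]
  refine Finset.sum_congr rfl fun x _ => ?_
  simp [one_apply, sq]

/-- Expand in an orthonormal eigenbasis. An eigenvector for `μ`, whose entries are at most one in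
absolute value, gives the lower bound; the vector of ones, with squared norm `2 ^ n`, gives the
upper one. The upper bound also holds for odd `N` and negative eigenvalues because `μ` dominates all
of them in absolute value. -/
theorem eigenvalue_bounds (hG : G.IsSymm) (h0 : ∀ x y, 0 ≤ G x y) (N : ℕ) :
    0 ≤ largestEigenvalue G ∧ largestEigenvalue G ^ N ≤ ∑ x, ∑ y, (G ^ N) x y ∧
      ∑ x, ∑ y, (G ^ N) x y ≤ 2 ^ n * largestEigenvalue G ^ N := by
  obtain ⟨U, e, hU, hU', hpow, hspec⟩ := exists_eigenvalue_decomposition hG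
  have hfin : (Set.range e).Finite := Set.finite_range e
  have hle : ∀ j, e j ≤ largestEigenvalue G := fun j => by
    rw [largestEigenvalue, hspec]; exact le_csSup hfin.bddAbove ⟨j, rfl⟩
  obtain ⟨j₀, hj₀⟩ : largestEigenvalue G ∈ Set.range e := by
    rw [largestEigenvalue, hspec]; exact (Set.range_nonempty e).csSup_mem hfin
  set μ := largestEigenvalue G
  have hcol : ∀ i j, ∑ x, U x i * U x j = if i = j then 1 else 0 := fun i j => by
    have := congrFun (congrFun hU i) j
    simpa [mul_apply, one_apply] using this
  have hnorm : ∀ j, ∑ x, U x j ^ 2 = 1 := fun j => by simpa [sq] using hcol j j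
  have hquad : ∀ M j, ∑ x, ∑ y, U x j * (G ^ M) x y * U y j = e j ^ M := fun M j => by
    rw [sum_mul_pow_mul (hpow M)]
    simp [hcol]
  have hentry : ∀ x j, |U x j| ≤ 1 := fun x j => by
    rw [← sq_le_one_iff_abs_le_one, ← hnorm j]
    exact Finset.single_le_sum (f := fun x => U x j ^ 2) (fun _ _ => sq_nonneg _)
      (Finset.mem_univ x)
  -- Perron–Frobenius: replacing an eigenvector by its entrywise absolute values does not decrease
  -- the modulus of the quadratic form, as `G` has non-negative entries, and the form is at most `μ`
  -- on unit vectors.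
  have habs : ∀ j, |e j| ≤ μ := fun j => by
    calc |e j| = |∑ x, ∑ y, U x j * (G ^ 1) x y * U y j| := by rw [hquad, pow_one]
      _ ≤ ∑ x, ∑ y, |U x j| * (G ^ 1) x y * |U y j| := by
        refine (Finset.abs_sum_le_sum_abs _ _).trans (Finset.sum_le_sum fun x _ => ?_)
        refine (Finset.abs_sum_le_sum_abs _ _).trans (Finset.sum_le_sum fun y _ => ?_)
        rw [abs_mul, abs_mul, pow_one, abs_of_nonneg (h0 x y)]
      _ = ∑ i, e i ^ 1 * (∑ x, U x i * |U x j|) ^ 2 := sum_mul_pow_mul (hpow 1) _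
      _ ≤ ∑ i, μ * (∑ x, U x i * |U x j|) ^ 2 := by
        gcongr with i; simpa using hle i
      _ = μ := by
        rw [← Finset.mul_sum, sum_sq_coordinates hU']
        simp [hnorm]
  have hμ : 0 ≤ μ := (abs_nonneg _).trans (habs j₀)
  have hpos : ∀ M x y, 0 ≤ (G ^ M) x y := fun M => by
    induction M with
    | zero => intro x y; rw [pow_zero, one_apply]; split_ifs <;> norm_num
    | succ M ih =>
      intro x y
      rw [pow_succ, mul_apply]
      exact Finset.sum_nonneg fun z _ => mul_nonneg (ih x z) (h0 z y)
  refine ⟨hμ, ?_, ?_⟩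
  · rw [← hj₀, ← hquad N j₀]
    refine Finset.sum_le_sum fun x _ => Finset.sum_le_sum fun y _ => ?_
    calc U x j₀ * (G ^ N) x y * U y j₀ ≤ |U x j₀ * (G ^ N) x y * U y j₀| := le_abs_self _
      _ = |U x j₀| * (G ^ N) x y * |U y j₀| := by
        rw [abs_mul, abs_mul, abs_of_nonneg (hpos N x y)]
      _ ≤ 1 * (G ^ N) x y * 1 := by
        have := hpos N x y
        gcongr
        · exact hentry x j₀
        · exact hentry y j₀
      _ = _ := by ring
  · calc ∑ x, ∑ y, (G ^ N) x y = ∑ x, ∑ y, (1 : ℝ) * (G ^ N) x y * 1 := by simp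
      _ = ∑ j, e j ^ N * (∑ x, U x j * 1) ^ 2 := sum_mul_pow_mul (hpow N) fun _ => 1
      _ ≤ ∑ j, μ ^ N * (∑ x, U x j * 1) ^ 2 := by
        refine Finset.sum_le_sum fun j _ => mul_le_mul_of_nonneg_right ?_ (sq_nonneg _)
        calc e j ^ N ≤ |e j ^ N| := le_abs_self _
          _ = |e j| ^ N := abs_pow _ _
          _ ≤ μ ^ N := by gcongr; exact habs j
      _ = 2 ^ n * μ ^ N := by
        rw [← Finset.mul_sum, sum_sq_coordinates hU']
        simp [mul_comm]

/-- Entrywise comparison of powers of non-negative matrices. -/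
theorem sum_pow_le_sum_pow {A B : Matrix (Bits n) (Bits n) ℝ} (hA : ∀ x y, 0 ≤ A x y)
    (hAB : ∀ x y, A x y ≤ B x y) (N : ℕ) :
    ∑ x, ∑ y, (A ^ N) x y ≤ ∑ x, ∑ y, (B ^ N) x y := by
  have : ∀ x y, 0 ≤ (A ^ N) x y ∧ (A ^ N) x y ≤ (B ^ N) x y := by
    induction N with
    | zero => intro x y; simp only [pow_zero, le_refl, and_true, one_apply]; split_ifs <;> norm_num
    | succ N ih =>
      intro x y
      simp only [pow_succ, mul_apply]
      exact ⟨Finset.sum_nonneg fun z _ => mul_nonneg (ih x z).1 (hA z y),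
        Finset.sum_le_sum fun z _ => mul_le_mul (ih x z).2 (hAB z y) (hA z y)
          ((ih x z).1.trans (ih x z).2)⟩
  exact Finset.sum_le_sum fun x _ => Finset.sum_le_sum fun y _ => (this x y).2

/-- Complexification does not change the real spectrum: whether `r - M` is invertible depends on its
determinant, which is the image of the real one. Then the supremum of `c` minus a set is `c` minus
its infimum. -/
theorem smallestEigenvalue_map_ofReal (M : Matrix (Bits n) (Bits n) ℝ) (hM : M.IsSymm) (c : ℝ) :
    smallestEigenvalue (M.map Complex.ofReal) =
      c - largestEigenvalue (algebraMap ℝ (Matrix (Bits n) (Bits n) ℝ) c - M) := by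
  have h1 : spectrum ℝ (M.map Complex.ofReal) = spectrum ℝ M := by
    ext r
    rw [spectrum.mem_iff, spectrum.mem_iff, isUnit_iff_isUnit_det, isUnit_iff_isUnit_det]
    have : algebraMap ℝ (Matrix (Bits n) (Bits n) ℂ) r - M.map Complex.ofReal =
        Complex.ofRealHom.mapMatrix (algebraMap ℝ (Matrix (Bits n) (Bits n) ℝ) r - M) := by
      ext x y
      by_cases h : x = y <;> simp [algebraMap_matrix_apply, h]
    rw [this, ← RingHom.map_det, isUnit_iff_ne_zero, isUnit_iff_ne_zero]
    simp
  obtain ⟨U, e, -, -, -, hspec⟩ := exists_eigenvalue_decomposition hM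
  have hfin : (spectrum ℝ M).Finite := hspec ▸ Set.finite_range e
  have hne : (spectrum ℝ M).Nonempty := hspec ▸ Set.range_nonempty e
  rw [smallestEigenvalue, h1, largestEigenvalue, ← spectrum.singleton_sub_eq,
    csSup_sub (Set.singleton_nonempty c) (Set.finite_singleton c).bddAbove hne hfin.bddBelow,
    csSup_singleton]
  ring

end Spectral
namespace Cmd

/-! ### Loops -/

variable {O : Oracle} {N : ℕ}

/-- Repeat a command `N ^ 3` times. -/
def long (c : Cmd) : Cmd := rep (rep (rep c))

theorem eval_long (c : Cmd) (s : Store) : (long c).eval O N s = (c.eval O N)^[N ^ 3] s := by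
  simp only [long, eval, ← Function.iterate_mul]
  rw [show N * N * N = N ^ 3 by ring]

/-- Pop all bits from a stack, and run a command for each of them. -/
def forEach (r : ℕ) (c₀ c₁ : Cmd) : Cmd := long (branch r skip (pop r ;; c₀) (pop r ;; c₁))

/-- The loop invariant rule. In `motive l s` the list `l` consists of the bits that remain to be
processed; once the stack is empty, the surplus rounds do nothing. A program can thus treat a stack
of any height up to `N ^ 3` without knowing the height. -/
theorem forEach_induction {r : ℕ} {c₀ c₁ : Cmd} (h₀ : c₀.keeps r = true) (h₁ : c₁.keeps r = true)
    (motive : List Bool → Store → Prop)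
    (step : ∀ b l s, s r = b :: l → motive (b :: l) s →
      motive l ((bif b then c₁ else c₀).eval O N (Function.update s r l)))
    (s : Store) (hs : (s r).length ≤ N ^ 3) (init : motive (s r) s) :
    motive [] ((forEach r c₀ c₁).eval O N s) ∧ (forEach r c₀ c₁).eval O N s r = [] := by
  rw [forEach, eval_long]
  generalize N ^ 3 = i at hs ⊢
  induction i generalizing s with
  | zero =>
    have : s r = [] := List.length_eq_zero_iff.1 (Nat.le_zero.1 hs)
    rw [this] at init
    exact ⟨init, this⟩
  | succ i ih =>
    rw [Function.iterate_succ_apply]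
    rcases hv : s r with _ | ⟨b, l⟩
    · have e : (branch r skip (pop r ;; c₀) (pop r ;; c₁)).eval O N s = s := by simp [eval, hv]
      rw [e]
      exact ih s init (by simp [hv])
    · have e : (branch r skip (pop r ;; c₀) (pop r ;; c₁)).eval O N s =
          (bif b then c₁ else c₀).eval O N (Function.update s r l) := by
        cases b <;> simp [eval, hv]
      have hr : (bif b then c₁ else c₀).eval O N (Function.update s r l) r = l := by
        rw [eval_keeps _ _ (by cases b <;> simp [h₀, h₁]), Function.update_self]
      rw [e]
      refine ih _ ?_ (by rw [hr]; simpa [hv] using hs)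
      rw [hr]
      exact step b l s hv (hv ▸ init)

/-! ### Moving data -/

/-- Empty a stack. -/
def clear (a : ℕ) : Cmd := forEach a skip skip

theorem eval_clear {a : ℕ} {s : Store} (h : (s a).length ≤ N ^ 3) :
    (clear a).eval O N s = Function.update s a [] := by
  have := (forEach_induction (O := O) (N := N) (c₀ := skip) (c₁ := skip) (r := a) rfl rfl
    (fun _ _ => True) (fun _ _ _ _ _ => trivial) s h trivial).2
  funext r
  by_cases hr : r = a
  · subst hr; simpa [clear] using this
  · rw [Function.update_of_ne hr]
    exact eval_keeps _ _ (by simp [clear, forEach, long, keeps, hr])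

/-- Pour one stack on another one. -/
def move (a b : ℕ) : Cmd := forEach a (push b false) (push b true)

theorem eval_move {a b : ℕ} (hab : a ≠ b) {s : Store} (h : (s a).length ≤ N ^ 3) :
    (move a b).eval O N s =
      Function.update (Function.update s b ((s a).reverse ++ s b)) a [] := by
  obtain ⟨h1, h2⟩ := forEach_induction (O := O) (N := N) (c₀ := push b false) (c₁ := push b true)
    (r := a) (by simp [keeps, hab]) (by simp [keeps, hab])
    (fun l t => l.reverse ++ t b = (s a).reverse ++ s b)
    (fun v l t _ ih => by
      rw [← ih]
      cases v <;> simp [eval, hab.symm]) s h rfl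
  funext r
  by_cases hr : r = a
  · subst hr; simpa [move] using h2
  by_cases hr' : r = b
  · subst hr'; simpa [move, hr] using h1
  · rw [Function.update_of_ne hr, Function.update_of_ne hr']
    exact eval_keeps _ _ (by simp [move, forEach, long, keeps, hr, hr'])

/-- Copy a stack on another one, with stack `20` as temporary memory. -/
def copy (a b : ℕ) : Cmd :=
  move a 20 ;; forEach 20 (push a false ;; push b false) (push a true ;; push b true)

/-- Pouring reverses a stack, so pouring it on stack `20` and from there on both targets restores
the original order. -/
theorem eval_copy {a b : ℕ} (hab : a ≠ b) (ha : a ≠ 20) (hb : b ≠ 20) {s : Store}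
    (h : (s a).length ≤ N ^ 3) (h20 : s 20 = []) :
    (copy a b).eval O N s = Function.update s b (s a ++ s b) := by
  rw [copy, eval, eval_move ha h]
  set t := Function.update (Function.update s 20 ((s a).reverse ++ s 20)) a [] with ht
  have t20 : t 20 = (s a).reverse := by simp [ht, ha.symm, h20]
  obtain ⟨h1, h2⟩ := forEach_induction (O := O) (N := N) (r := 20)
    (c₀ := push a false ;; push b false) (c₁ := push a true ;; push b true)
    (by simp [keeps, ha.symm, hb.symm]) (by simp [keeps, ha.symm, hb.symm])
    (fun l u => l.reverse ++ u a = s a ∧ l.reverse ++ u b = s a ++ s b)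
    (fun v l u _ ih => by
      refine ⟨Eq.trans ?_ ih.1, Eq.trans ?_ ih.2⟩ <;> cases v <;>
        simp [eval, hab, ha, hb, hab.symm]) t
    (by simpa [t20] using h) (by simp [t20]; simp [ht, hb, hab.symm])
  funext r
  by_cases hr : r = a
  · subst hr; simpa [hab] using h1.1
  by_cases hr' : r = b
  · subst hr'; simpa using h1.2
  by_cases hr20 : r = 20
  · subst hr20; rw [h2, Function.update_of_ne hr', h20]
  · rw [Function.update_of_ne hr',
      eval_keeps _ _ (by simp [forEach, long, keeps, hr, hr', hr20]), ht]
    simp [hr, hr20]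

/-- Move `K` bits from stack `2` to an empty stack `b`, where `K` is the height of stack `a`, and record
them on stack `12`. -/
def readBits (a b : ℕ) : Cmd :=
  copy a 37 ;;
  forEach 37
    (branch 2 skip (pop 2 ;; push 12 false ;; push 33 false) (pop 2 ;; push 12 true ;; push 33 true))
    (branch 2 skip (pop 2 ;; push 12 false ;; push 33 false) (pop 2 ;; push 12 true ;; push 33 true)) ;;
  move 33 b

theorem eval_readBits {a b : ℕ} (ha : a ∉ [2, 12, 20, 33, 37]) (hb : b ∉ [2, 12, 20, 33, 37])
    {s : Store} {u v : List Bool} (h2 : s 2 = u ++ v) (hu : (s a).length = u.length)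
    (hN : u.length ≤ N ^ 3) (h20 : s 20 = []) (h33 : s 33 = []) (h37 : s 37 = [])
    (hsb : s b = []) :
    (readBits a b).eval O N s =
      Function.update (Function.update (Function.update s 2 v) 12 (u.reverse ++ s 12)) b u := by
  simp only [List.mem_cons, List.not_mem_nil, or_false, not_or] at ha hb
  obtain ⟨a2, a12, a20, a33, a37⟩ := ha
  obtain ⟨b2, b12, b20, b33, b37⟩ := hb
  rw [readBits, eval, eval_copy a37 a20 (by decide) (by omega) h20, eval]
  set t := Function.update s 37 (s a ++ s 37) with ht
  have t37 : t 37 = s a := by simp [ht, h37]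
  obtain ⟨h1, h2⟩ := forEach_induction (O := O) (N := N) (r := 37)
    (c₀ := branch 2 skip (pop 2 ;; push 12 false ;; push 33 false)
      (pop 2 ;; push 12 true ;; push 33 true))
    (c₁ := branch 2 skip (pop 2 ;; push 12 false ;; push 33 false)
      (pop 2 ;; push 12 true ;; push 33 true)) rfl rfl
    -- Here `w₁` has been read and `w₂` is still to be read. Stack `37` is a mere unary counter,
    -- which is why both branches of the loop coincide.
    (fun l t => ∃ w₁ w₂, u = w₁ ++ w₂ ∧ l.length = w₂.length ∧ t 2 = w₂ ++ v ∧
      t 12 = w₁.reverse ++ s 12 ∧ t 33 = w₁.reverse)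
    (by
      rintro c l r hr ⟨w₁, w₂, e, hl, h2, h12, h33⟩
      obtain ⟨d, w₂, rfl⟩ := List.exists_cons_of_length_eq_add_one hl.symm
      refine ⟨w₁ ++ [d], w₂, by simp [e], by simpa using hl, ?_⟩
      cases c <;> cases d <;> simp [eval, h2, h12, h33]) t
    (by rw [t37]; omega) ⟨[], u, rfl, by rw [t37, hu], by simp [ht, h2], by simp [ht],
      by simp [ht, h33]⟩
  obtain ⟨w₁, w₂, e, hl, k2, k12, k33⟩ := h1
  obtain rfl : w₂ = [] := List.length_eq_zero_iff.1 hl.symm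
  obtain rfl : u = w₁ := by simpa using e
  set t' := (forEach 37 (branch 2 skip (pop 2 ;; push 12 false ;; push 33 false)
      (pop 2 ;; push 12 true ;; push 33 true)) (branch 2 skip
      (pop 2 ;; push 12 false ;; push 33 false) (pop 2 ;; push 12 true ;; push 33 true))).eval O N t
    with ht'
  rw [eval_move (Ne.symm b33) (by simpa [k33] using hN)]
  have keep : ∀ r, r ≠ 2 → r ≠ 12 → r ≠ 33 → r ≠ 37 → t' r = s r := fun r h2 h12 h33 h37 => by
    rw [ht', eval_keeps _ _ (by simp [forEach, long, keeps, h2, h12, h33, h37]), ht,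
      Function.update_of_ne h37]
  funext r
  by_cases r33 : r = 33
  · subst r33; simp [Ne.symm b33, h33]
  by_cases rb : r = b
  · subst rb; simp [b33, k33, keep r b2 b12 b33 b37, hsb]
  by_cases r2 : r = 2
  · subst r2; simp [Ne.symm b2, k2]
  by_cases r12 : r = 12
  · subst r12; simp [Ne.symm b12, k12]
  by_cases r37 : r = 37
  · subst r37; simp [Ne.symm b37, h2, h37]
  · simp [r33, rb, r2, r12, keep r r2 r12 r33 r37]

/-- Read a framed string from stack `a` and put it on stack `b`. -/
def parse (a b : ℕ) : Cmd :=
  long (branch 38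
    (branch a skip (pop a ;; push 38 true)
      (pop a ;; branch a skip (pop a ;; push 33 false) (pop a ;; push 33 true)))
    skip skip) ;;
  pop 38 ;; move 33 b

/-- The flag on stack `38` stops the reading when the terminating zero appears. That zero takes a
round of its own, hence the strict inequality for the length. -/
theorem eval_parse {a b : ℕ} (ha : a ∉ [33, 38]) (hb : b ∉ [33, 38]) (hab : a ≠ b)
    {s : Store} {u v : List Bool} (hs : s a = frame u ++ v) (hN : u.length < N ^ 3)
    (h33 : s 33 = []) (h38 : s 38 = []) :
    (parse a b).eval O N s = Function.update (Function.update s a v) b (u ++ s b) := by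
  simp only [List.mem_cons, List.not_mem_nil, or_false, not_or] at ha hb
  obtain ⟨a33, a38⟩ := ha
  obtain ⟨b33, b38⟩ := hb
  set body := branch 38
    (branch a skip (pop a ;; push 38 true)
      (pop a ;; branch a skip (pop a ;; push 33 false) (pop a ;; push 33 true)))
    skip skip with hbody
  -- Once the flag is raised, the body is the identity, so the remaining rounds do not touch the
  -- bits that follow.
  have done : ∀ (i : ℕ) (t : Store), t 38 = [true] → (body.eval O N)^[i] t = t := by
    intro i t ht
    apply Function.iterate_fixed
    simp [hbody, eval, ht]
  have main : ∀ (i : ℕ) (u w : List Bool) (t : Store), u.length < i → t 38 = [] →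
      t a = frame u ++ v → t 33 = w → (body.eval O N)^[i] t =
        Function.update (Function.update (Function.update t a v) 33 (u.reverse ++ w)) 38 [true] := by
    intro i
    induction i with
    | zero => intro u w t hu; simp at hu
    | succ i ih =>
      intro u w t hu t38 ta t33
      rw [Function.iterate_succ_apply]
      rcases u with _ | ⟨d, u⟩
      · simp only [frame, List.flatMap_nil, List.nil_append, List.singleton_append] at ta
        have : body.eval O N t = Function.update (Function.update t a v) 38 [true] := by
          simp [hbody, eval, t38, ta, Ne.symm a38]
        rw [this, done i _ (by simp)]
        funext r
        by_cases r38 : r = 38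
        · subst r38; simp
        by_cases r33 : r = 33
        · subst r33; simp [Ne.symm a33, t33]
        · simp [r38, r33]
      · have ta' : t a = true :: d :: (frame u ++ v) := by simp [ta, frame]
        have : body.eval O N t =
            Function.update (Function.update t a (frame u ++ v)) 33 (d :: w) := by
          cases d <;> simp [hbody, eval, t38, ta', Ne.symm a33, t33]
        rw [this, ih u (d :: w) _ (by simpa using hu) (by simp [Ne.symm a38, t38])
          (by simp [a33]) (by simp)]
        funext r
        by_cases r38 : r = 38
        · subst r38; simp
        by_cases r33 : r = 33
        · subst r33; simp
        by_cases ra : r = a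
        · subst ra; simp [r38, r33]
        · simp [r38, r33, ra]
  rw [parse, eval, eval_long, main (N ^ 3) u [] s hN h38 hs h33, eval, eval,
    eval_move (Ne.symm b33) (by simp; omega)]
  funext r
  by_cases r33 : r = 33
  · subst r33; simp [Ne.symm b33, Ne.symm a33, h33]
  by_cases rb : r = b
  · subst rb; simp [b33, b38, hab.symm]
  by_cases r38 : r = 38
  · subst r38; simp [Ne.symm b38, Ne.symm a38, h38]
  · simp [r33, rb, r38]

end Cmd
-- Hash functions split into blocks of rows
theorem dot_take : ∀ (u q : List Bool), dot u (q.take u.length) = dot u q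
  | [], q => by simp [dot]
  | a :: u, [] => by simp [dot]
  | a :: u, b :: q => by simp [dot, dot_take u q]

theorem hashZero_add (u : List Bool) (b : ℕ) : ∀ (a : ℕ) (q : List Bool),
    hashZero (a + b) u q = (hashZero a u q && hashZero b u (q.drop (a * u.length)))
  | 0, q => by simp [hashZero]
  | a + 1, q => by
    rw [Nat.add_right_comm, hashZero, hashZero, hashZero_add u b a, List.drop_drop, Bool.and_assoc,
      show u.length + a * u.length = (a + 1) * u.length by ring]

namespace Cmd

/-! ### The verifier -/

variable {O : Oracle} {N : ℕ}

/-- Move one bit from stack `2` to stack `12`. -/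
def readBit : Cmd := branch 2 skip (pop 2 ;; push 12 false) (pop 2 ;; push 12 true)

/-- One step of the walk: read the next vertex and a label, check the label, advance. -/
def walkStep (edge : Cmd) : Cmd :=
  readBits 13 17 ;; readBits 14 18 ;; edge ;; clear 16 ;; copy 17 16 ;; clear 17

/-- Reject unless the next block of stack `1` is orthogonal to stack `12`. -/
def hashRow : Cmd :=
  forEach 12 (pop 1 ;; push 19 false)
    (push 19 true ;; branch 1 skip (pop 1) (pop 1 ;; branch 21 (push 21 true) (pop 21) (pop 21))) ;;
  move 19 12 ;; branch 21 skip (push 11 true ;; pop 21) (push 11 true ;; pop 21)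

/-- The verifier for witnesses of many walks; `prep` reads the instance, `edge` checks labels. -/
def verifier (prep edge : Cmd) : Cmd :=
  prep ;; readBit ;; readBit ;; readBits 13 16 ;; rep (walkStep edge) ;; push 12 true ;;
    rep (copy 15 37 ;; forEach 37 hashRow hashRow)

/-- The stacks that may change while the verifier is at work. -/
def volatile : List ℕ := [1, 2, 11, 12, 16, 17, 18, 19, 21, 39]

/-- The two stores agree except for the volatile stacks. -/
def Agree (s s₀ : Store) : Prop := ∀ r, r ∉ volatile → s r = s₀ r

theorem Agree.update {s s₀ : Store} (h : Agree s s₀) {r : ℕ} (hr : r ∈ volatile) (l : List Bool) :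
    Agree (Function.update s r l) s₀ := by
  intro r' hr'
  rw [Function.update_of_ne (by rintro rfl; exact hr' hr)]
  exact h r' hr'

/-- The prepared store `s₀` holds the size parameters, and temporary stacks are empty. -/
structure Prepared (N n κ β : ℕ) (s₀ : Store) : Prop where
  size : (s₀ 13).length = n
  label : (s₀ 14).length = κ
  bits : (s₀ 15).length = β
  h20 : s₀ 20 = []
  h33 : s₀ 33 = []
  h37 : s₀ 37 = []
  size_le : n ≤ N ^ 3
  label_le : κ ≤ N ^ 3
  bits_le : β ≤ N ^ 3

/-- The command `edge` checks labels as `P` does, when started on stores that agree with `s₀`. -/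
structure EdgeSpec (O : Oracle) (N n κ : ℕ) (edge : Cmd) (s₀ : Store)
    (P : List Bool → List Bool → List Bool → Bool) : Prop where
  keeps : ∀ s, Agree s s₀ → (s 16).length = n → (s 17).length = n → (s 18).length = κ →
    ∀ r ∈ [1, 2, 12, 16, 17, 19, 21], edge.eval O N s r = s r
  spec : ∀ s, Agree s s₀ → (s 16).length = n → (s 17).length = n → (s 18).length = κ →
    Agree (edge.eval O N s) s₀ ∧ edge.eval O N s 18 = [] ∧
      (edge.eval O N s 11 = [] ↔ s 11 = [] ∧ P (s 16) (s 17) (s 18) = true)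

/-- Composition of the specifications of the parts. The next vertex replaces the current one on
stack `16`, the bits that were read are appended to the record on stack `12`, and stack `11` stays
empty only as long as no label has been refused. -/
theorem eval_walkStep {n κ β : ℕ} {edge : Cmd} {s₀ : Store}
    {P : List Bool → List Bool → List Bool → Bool} (hp : Prepared N n κ β s₀)
    (he : EdgeSpec O N n κ edge s₀ P) {s : Store} (hs : Agree s s₀) {y z v : List Bool}
    (h2 : s 2 = y ++ (z ++ v)) (hy : y.length = n) (hz : z.length = κ) (h16 : (s 16).length = n)
    (h17 : s 17 = []) (h18 : s 18 = []) :
    let s' := (walkStep edge).eval O N s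
    Agree s' s₀ ∧ s' 2 = v ∧ s' 12 = (y ++ z).reverse ++ s 12 ∧ s' 16 = y ∧ s' 17 = [] ∧
      s' 18 = [] ∧ s' 1 = s 1 ∧ s' 19 = s 19 ∧ s' 21 = s 21 ∧
      (s' 11 = [] ↔ s 11 = [] ∧ P (s 16) y z = true) := by
  have agr : ∀ {r}, r ∉ volatile → s r = s₀ r := fun hr => hs _ hr
  intro s'
  have e1 := eval_readBits (O := O) (N := N) (a := 13) (b := 17) (by decide) (by decide) h2
    (by rw [agr (by decide), hp.size, hy]) (hy ▸ hp.size_le) ((agr (by decide)).trans hp.h20)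
    ((agr (by decide)).trans hp.h33) ((agr (by decide)).trans hp.h37) h17
  set s₁ := Function.update (Function.update (Function.update s 2 (z ++ v)) 12
    (y.reverse ++ s 12)) 17 y with hs₁
  have a1 : Agree s₁ s₀ := ((hs.update (by decide) _).update (by decide) _).update (by decide) _
  have e2 := eval_readBits (O := O) (N := N) (a := 14) (b := 18) (s := s₁) (u := z) (v := v)
    (by decide) (by decide) (by simp [hs₁])
    (by rw [a1 14 (by decide), hp.label, hz]) (hz ▸ hp.label_le) ((a1 _ (by decide)).trans hp.h20)
    ((a1 _ (by decide)).trans hp.h33) ((a1 _ (by decide)).trans hp.h37) (by simp [hs₁, h18])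
  set s₂ := Function.update (Function.update (Function.update s₁ 2 v) 12
    (z.reverse ++ s₁ 12)) 18 z with hs₂
  have a2 : Agree s₂ s₀ := ((a1.update (by decide) _).update (by decide) _).update (by decide) _
  have b16 : s₂ 16 = s 16 := by simp [hs₂, hs₁]
  have b17 : s₂ 17 = y := by simp [hs₂, hs₁]
  have b18 : s₂ 18 = z := by simp [hs₂]
  obtain ⟨a3, c18, c11⟩ := he.spec s₂ a2 (by rw [b16, h16]) (by rw [b17, hy]) (by rw [b18, hz])
  set s₃ := edge.eval O N s₂ with hs₃
  have keep : ∀ r ∈ [1, 2, 12, 16, 17, 19, 21], s₃ r = s₂ r := 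
    he.keeps s₂ a2 (by rw [b16, h16]) (by rw [b17, hy]) (by rw [b18, hz])
  have c16 := keep 16 (by decide)
  have c17 := keep 17 (by decide)
  have e4 := eval_clear (O := O) (N := N) (a := 16) (s := s₃)
    (by rw [c16, b16, h16]; exact hp.size_le)
  have e5 := eval_copy (O := O) (N := N) (a := 17) (b := 16) (by decide) (by decide) (by decide)
    (s := Function.update s₃ 16 [])
    (by simp [c17, b17, hy, hp.size_le])
    (by simp [a3 20 (by decide), hp.h20])
  have e6 := eval_clear (O := O) (N := N) (a := 17)
    (s := Function.update (Function.update s₃ 16 []) 16 y)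
    (by simp [c17, b17, hy, hp.size_le])
  have key : s' = Function.update (Function.update (Function.update s₃ 16 []) 16 y) 17 [] := by
    simp only [s', walkStep, eval]
    rw [e1, e2, ← hs₃, e4, e5]
    simpa [c17, b17] using e6
  rw [key]
  refine ⟨((a3.update (by decide) _).update (by decide) _).update (by decide) _, ?_, ?_, ?_, ?_, ?_,
    ?_, ?_, ?_, ?_⟩
  · simp [keep 2 (by decide), hs₂]
  · simp [keep 12 (by decide), hs₂, hs₁]
  · simp
  · simp
  · simp [c18]
  · simp [keep 1 (by decide), hs₂, hs₁]
  · simp [keep 19 (by decide), hs₂, hs₁]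
  · simp [keep 21 (by decide), hs₂, hs₁]
  · rw [b16, b17, b18] at c11
    simp [c11, hs₂, hs₁]

theorem eval_walk {n κ β : ℕ} {edge : Cmd} {s₀ : Store}
    {P : List Bool → List Bool → List Bool → Bool} (hp : Prepared N n κ β s₀)
    (he : EdgeSpec O N n κ edge s₀ P) (v : List Bool) (i : ℕ) :
    ∀ (s : Store) (w : List Bool), Agree s s₀ → s 2 = w ++ v → w.length = i * (n + κ) →
    (s 16).length = n → s 17 = [] → s 18 = [] →
    let s' := ((walkStep edge).eval O N)^[i] s
    Agree s' s₀ ∧ s' 12 = w.reverse ++ s 12 ∧ s' 1 = s 1 ∧ s' 19 = s 19 ∧ s' 21 = s 21 ∧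
      (s' 11 = [] ↔ s 11 = [] ∧ isWalk P n κ i (s 16) w = true) := by
  induction i with
  | zero =>
    intro s w hs h2 hw _ _ _
    obtain rfl : w = [] := List.length_eq_zero_iff.1 (by simpa using hw)
    simp [hs, isWalk]
  | succ i ih =>
    intro s w hs h2 hw h16 h17 h18
    have hw' : w.length = n + κ + i * (n + κ) := by rw [hw]; ring
    have hsplit : w = w.take n ++ ((w.drop n).take κ ++ w.drop (n + κ)) := by
      rw [← List.drop_drop, List.take_append_drop, List.take_append_drop]
    obtain ⟨b1, b2, b12, b16, b17, b18, bb1, b19, b21, b11⟩ := eval_walkStep (y := w.take n)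
      (z := (w.drop n).take κ) (v := w.drop (n + κ) ++ v) hp he hs
      (by rw [h2, ← List.append_assoc, ← List.append_assoc, List.append_assoc (w.take n),
        ← hsplit]) (by simp; omega) (by simp; omega) h16 h17 h18
    obtain ⟨c1, c12, cc1, c19, c21, c11⟩ := ih _ (w.drop (n + κ)) b1 b2 (by simp; omega)
      (by rw [b16]; simp; omega) b17 b18
    rw [Function.iterate_succ_apply]
    refine ⟨c1, ?_, cc1.trans bb1, c19.trans b19, c21.trans b21, ?_⟩
    · rw [c12, b12]
      conv_rhs => rw [hsplit]
      simp only [List.reverse_append, List.append_assoc]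
    · rw [c11, b11, b16, isWalk, Bool.and_eq_true, and_assoc]

/-- Stack `21` holds the parity of the inner product, and stack `19` collects the used bits of stack
`12`, so that pouring them back restores it for the next row. -/
theorem eval_hashRow {s : Store} (h12 : (s 12).length ≤ N ^ 3) (h1 : (s 12).length ≤ (s 1).length)
    (h19 : s 19 = []) (h21 : s 21 = []) :
    let s' := hashRow.eval O N s
    (∀ r, r ∉ [1, 11] → s' r = s r) ∧ s' 1 = (s 1).drop (s 12).length ∧
      (s' 11 = [] ↔ s 11 = [] ∧ dot (s 12) (s 1) = false) := by
  intro s'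
  set c₀ := pop 1 ;; push 19 false with hc₀
  set c₁ := push 19 true ;;
    branch 1 skip (pop 1) (pop 1 ;; branch 21 (push 21 true) (pop 21) (pop 21)) with hc₁
  obtain ⟨⟨d, a12, a19, a1, -, a21, ad⟩, b12⟩ := forEach_induction (O := O) (N := N) (r := 12)
    (c₀ := c₀) (c₁ := c₁) rfl rfl
    -- The prefix `d` has been processed: the parity so far plus the inner product of the remaining
    -- bits equals the full inner product.
    (fun l t => ∃ d, s 12 = d ++ l ∧ t 19 = d.reverse ∧ t 1 = (s 1).drop d.length ∧
      l.length ≤ (t 1).length ∧ (t 21 = [] ∨ t 21 = [true]) ∧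
      (!(t 21).isEmpty ^^ dot l (t 1)) = dot (s 12) (s 1))
    (by
      rintro b l t - ⟨d, h12, h19, h1, hl, h21, hd⟩
      obtain ⟨a, q, hq⟩ : ∃ a q, t 1 = a :: q := List.exists_cons_of_length_pos
        (lt_of_lt_of_le (by simp) hl)
      have hq' : q = (s 1).drop (d.length + 1) := by
        rw [← List.drop_drop, ← h1, hq]; rfl
      refine ⟨d ++ [b], by simp [h12], ?_⟩
      rw [hq] at hl hd
      simp only [List.length_cons, Nat.add_le_add_iff_right] at hl
      rcases h21 with h21 | h21 <;> cases b <;> cases a <;>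
        simp [hc₀, hc₁, eval, h19, hq, h21, ← hd, dot, hl, ← hq'])
    s h12 ⟨[], by simp [h19, h21, h1]⟩
  set t := (forEach 12 c₀ c₁).eval O N s with ht
  obtain rfl : d = s 12 := by simpa using a12.symm
  have hs' : s' = (branch 21 skip (push 11 true ;; pop 21) (push 11 true ;; pop 21)).eval O N
      (Function.update (Function.update t 12 (s 12)) 19 []) := by
    simp only [s', hashRow, eval, ← hc₀, ← hc₁, ← ht]
    have := eval_move (O := O) (N := N) (a := 19) (b := 12) (by decide) (s := t) (by simpa [a19])
    rw [a19, b12, List.reverse_reverse, List.append_nil] at this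
    simp only [this]
  have keep : ∀ r, r ∉ [1, 12, 19, 21] → t r = s r := fun r hr => by
    simp only [List.mem_cons, List.not_mem_nil, or_false, not_or] at hr
    rw [ht, eval_keeps _ _ (by simp [forEach, long, keeps, hc₀, hc₁, hr])]
  have e11 := keep 11 (by decide)
  refine ⟨fun r hr => ?_, ?_, ?_⟩
  · simp only [List.mem_cons, List.not_mem_nil, or_false, not_or] at hr
    by_cases r12 : r = 12
    · subst r12
      rw [hs', eval_keeps _ _ rfl]; simp
    by_cases r19 : r = 19
    · subst r19
      rw [hs', eval_keeps _ _ rfl]; simp [h19]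
    by_cases r21 : r = 21
    · subst r21
      rcases a21 with h | h <;> simp [hs', eval, h, h21]
    · rw [hs', eval_keeps _ _ (by simp [keeps, hr, r21])]
      simp [r12, r19, keep r (by simp [hr, r12, r19, r21])]
  · rw [hs', eval_keeps _ _ rfl]; simp [a1]
  · rw [← ad]
    rcases a21 with h | h <;> simp [hs', eval, h, e11, dot]

theorem eval_hashRows {s : Store} (h12 : (s 12).length ≤ N ^ 3) (h15 : (s 15).length ≤ N ^ 3)
    (h20 : s 20 = []) (h37 : s 37 = []) (h19 : s 19 = []) (h21 : s 21 = [])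
    (h1 : (s 15).length * (s 12).length ≤ (s 1).length) :
    let s' := (copy 15 37 ;; forEach 37 hashRow hashRow).eval O N s
    (∀ r, r ∉ [1, 11] → s' r = s r) ∧
      s' 1 = (s 1).drop ((s 15).length * (s 12).length) ∧
      (s' 11 = [] ↔ s 11 = [] ∧ hashZero (s 15).length (s 12) (s 1) = true) := by
  intro s'
  set t := Function.update s 37 (s 15) with ht
  have hs' : s' = (forEach 37 hashRow hashRow).eval O N t := by
    simp only [s', eval]
    rw [eval_copy (by decide) (by decide) (by decide) h15 h20, h37, List.append_nil]
  obtain ⟨⟨i, hi, a, b, c⟩, d⟩ := forEach_induction (O := O) (N := N) (r := 37) (c₀ := hashRow)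
    (c₁ := hashRow) rfl rfl
    (fun l u => ∃ i, (s 15).length = i + l.length ∧ (∀ r, r ∉ [1, 11, 37] → u r = s r) ∧
      u 1 = (s 1).drop (i * (s 12).length) ∧
      (u 11 = [] ↔ s 11 = [] ∧ hashZero i (s 12) (s 1) = true))
    (by
      rintro v l u hv ⟨i, hi, a, b, c⟩
      obtain ⟨a', b', c'⟩ := eval_hashRow (O := O) (N := N) (s := Function.update u 37 l)
        (by simpa [a 12 (by decide)] using h12)
        (by
          simp [a 12 (by decide), b]
          rw [hi] at h1
          rw [List.length_cons, add_mul, add_mul] at h1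
          omega)
        (by simp [a 19 (by decide), h19]) (by simp [a 21 (by decide), h21])
      rw [Bool.cond_self]
      have u12 := a 12 (by decide)
      refine ⟨i + 1, by simp at hi; omega, fun r hr => ?_, ?_, ?_⟩
      · simp only [List.mem_cons, List.not_mem_nil, or_false, not_or] at hr
        rw [a' r (by simp [hr]), Function.update_of_ne hr.2.2, a r (by simp [hr])]
      · rw [b']; simp [b, u12]; ring_nf
      · rw [c']
        rw [hashZero_add]
        simp [c, u12, b, hashZero, dot_take, and_assoc])
    t (by simpa [ht]) ⟨0, by simp [ht], fun r hr => by
      simp only [List.mem_cons, List.not_mem_nil, or_false, not_or] at hr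
      simp [ht, hr], by simp [ht], by simp [ht, hashZero]⟩
  rw [hs']
  obtain rfl : (s 15).length = i := by simpa using hi
  refine ⟨fun r hr => ?_, b, c⟩
  simp only [List.mem_cons, List.not_mem_nil, or_false, not_or] at hr
  by_cases r37 : r = 37
  · subst r37; rw [d, h37]
  · exact a r (by simp [hr, r37])

/-- Each of the `i` rounds treats as many rows as stack `15` is high; with `N` rounds the hash value
has `N * β` bits. The hash function factors accordingly by `hashZero_add`. -/
theorem eval_rep_hashRows {s : Store} (h12 : (s 12).length ≤ N ^ 3) (h15 : (s 15).length ≤ N ^ 3)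
    (h20 : s 20 = []) (h37 : s 37 = []) (h19 : s 19 = []) (h21 : s 21 = []) (i : ℕ)
    (h1 : i * (s 15).length * (s 12).length ≤ (s 1).length) :
    let s' := ((copy 15 37 ;; forEach 37 hashRow hashRow).eval O N)^[i] s
    (∀ r, r ∉ [1, 11] → s' r = s r) ∧
      s' 1 = (s 1).drop (i * (s 15).length * (s 12).length) ∧
      (s' 11 = [] ↔ s 11 = [] ∧ hashZero (i * (s 15).length) (s 12) (s 1) = true) := by
  induction i with
  | zero => simp [hashZero]
  | succ i ih =>
    obtain ⟨a, b, c⟩ := ih (le_trans (by gcongr; omega) h1)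
    rw [Function.iterate_succ_apply']
    set t := ((copy 15 37 ;; forEach 37 hashRow hashRow).eval O N)^[i] s
    have t12 := a 12 (by decide)
    have t15 := a 15 (by decide)
    obtain ⟨a', b', c'⟩ := eval_hashRows (O := O) (N := N) (s := t) (by rwa [t12]) (by rwa [t15])
      (by rw [a 20 (by decide), h20]) (by rw [a 37 (by decide), h37])
      (by rw [a 19 (by decide), h19]) (by rw [a 21 (by decide), h21])
      (by
        rw [add_mul i 1, add_mul, one_mul] at h1
        rw [t12, t15, b, List.length_drop]
        omega)
    rw [t12, t15, b] at b' c'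
    refine ⟨fun r hr => (a' r hr).trans (a r hr), ?_, ?_⟩
    · rw [b', List.drop_drop, add_mul i 1, add_mul, one_mul]
    · rw [c', c, add_mul i 1, one_mul, hashZero_add, Bool.and_eq_true, and_assoc]

/-- The verifier accepts if and only if the beginning of the response is a witness whose hash value
vanishes. -/
theorem eval_verifier {n κ β : ℕ} {prep edge : Cmd} {x q r : List Bool}
    {P : List Bool → List Bool → List Bool → Bool}
    (hp : Prepared N n κ β (prep.eval O N (inputStore [x, q, r])))
    (hk : ∀ r ∈ [1, 2, 11, 12, 16, 17, 18, 19, 21], prep.keeps r = true)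
    (he : EdgeSpec O N n κ edge (prep.eval O N (inputStore [x, q, r])) P)
    (hr : 2 + (n + N * (n + κ)) ≤ r.length)
    (hq : N * β * (2 + (n + N * (n + κ)) + 1) ≤ q.length)
    (hN : 2 + (n + N * (n + κ)) + 1 ≤ N ^ 3) :
    (verifier prep edge).eval O N (inputStore [x, q, r]) 11 = [] ↔
      isWitness P n κ N (r.take (2 + (n + N * (n + κ)))) = true ∧
        hashZero (N * β) (true :: (r.take (2 + (n + N * (n + κ)))).reverse) q = true := by
  set s₀ := prep.eval O N (inputStore [x, q, r]) with hs₀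
  have keep : ∀ r' ∈ [1, 2, 11, 12, 16, 17, 18, 19, 21], s₀ r' = inputStore [x, q, r] r' :=
    fun r' hr' => eval_keeps _ _ (hk r' hr')
  set K := 2 + (n + N * (n + κ)) with hK
  -- The two free bits are read and recorded, but never tested; `w` is the starting point followed
  -- by the walk.
  obtain ⟨b, b', w, hw⟩ : ∃ b b' w, r.take K = b :: b' :: w := by
    have hl : (r.take K).length = K := by simp [hr]
    match r.take K, hl with
    | [], h => simp at h; omega
    | [_], h => simp at h; omega
    | b :: b' :: w, _ => exact ⟨b, b', w, rfl⟩
  have hwl : w.length = n + N * (n + κ) := by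
    have : (r.take K).length = K := by simp [hr]
    rw [hw] at this
    simp at this
    omega
  have h2 : s₀ 2 = b :: b' :: (w.take n ++ (w.drop n ++ r.drop K)) := by
    rw [keep 2 (by decide), ← List.append_assoc, List.take_append_drop, ← List.cons_append,
      ← List.cons_append, ← hw, List.take_append_drop]
    rfl
  have i1 : s₀ 1 = q := keep 1 (by decide)
  have i11 : s₀ 11 = [] := keep 11 (by decide)
  have i12 : s₀ 12 = [] := keep 12 (by decide)
  have i16 : s₀ 16 = [] := keep 16 (by decide)
  have i17 : s₀ 17 = [] := keep 17 (by decide)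
  have i18 : s₀ 18 = [] := keep 18 (by decide)
  have i19 : s₀ 19 = [] := keep 19 (by decide)
  have i21 : s₀ 21 = [] := keep 21 (by decide)
  have eb : ∀ (c : Bool) (l : List Bool) (s : Store), s 2 = c :: l →
      readBit.eval O N s = Function.update (Function.update s 2 l) 12 (c :: s 12) := by
    intro c l s h
    cases c <;> simp [readBit, eval, h]
  have e1 := eb _ _ _ h2
  set s₁ := Function.update (Function.update s₀ 2 _) 12 (b :: s₀ 12) with hs₁
  have a1 : Agree s₁ s₀ := by
    refine Agree.update (Agree.update (fun _ _ => rfl) ?_ _) ?_ _ <;> decide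
  have e2 := eb b' (w.take n ++ (w.drop n ++ r.drop K)) s₁ (by simp [hs₁])
  set s₂ := Function.update (Function.update s₁ 2 _) 12 (b' :: s₁ 12) with hs₂
  have a2 : Agree s₂ s₀ := by refine Agree.update (a1.update ?_ _) ?_ _ <;> decide
  have e3 := eval_readBits (O := O) (N := N) (a := 13) (b := 16) (s := s₂) (u := w.take n)
    (v := w.drop n ++ r.drop K) (by decide) (by decide) (by simp [hs₂])
    (by rw [a2 13 (by decide), hp.size]; simp; omega) (by simp; left; exact hp.size_le)
    (by rw [a2 20 (by decide), hp.h20]) (by rw [a2 33 (by decide), hp.h33])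
    (by rw [a2 37 (by decide), hp.h37]) (by simp [hs₂, hs₁, i16])
  set s₃ := Function.update (Function.update (Function.update s₂ 2 _) 12 _) 16 _ with hs₃
  have a3 : Agree s₃ s₀ := by
    refine Agree.update (Agree.update (a2.update ?_ _) ?_ _) ?_ _ <;> decide
  obtain ⟨a4, b12, b1, b19, b21, b11⟩ := eval_walk hp he (r.drop K) N s₃ (w.drop n) a3
    (by simp [hs₃]) (by simp; omega) (by simp [hs₃]; omega) (by simp [hs₃, hs₂, hs₁, i17])
    (by simp [hs₃, hs₂, hs₁, i18])
  set s₄ := ((walkStep edge).eval O N)^[N] s₃ with hs₄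
  have c12 : s₄ 12 = (r.take K).reverse := by
    rw [b12, hw]
    conv_rhs => rw [← List.take_append_drop n w]
    simp [-List.take_append_drop, hs₃, hs₂, hs₁, i12]
  have u1 : Function.update s₄ 12 (true :: s₄ 12) 1 = q := by simp [b1, hs₃, hs₂, hs₁, i1]
  have u12 : Function.update s₄ 12 (true :: s₄ 12) 12 = true :: (r.take K).reverse := by simp [c12]
  have u15 : (Function.update s₄ 12 (true :: s₄ 12) 15).length = β := by
    simp [a4 15 (by decide), hp.bits]
  obtain ⟨-, -, c11⟩ := eval_rep_hashRows (O := O) (N := N) (s := Function.update s₄ 12 (true :: s₄ 12))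
    (by rw [u12]; simp; omega) (by rw [u15]; exact hp.bits_le)
    (by simp [a4 20 (by decide), hp.h20]) (by simp [a4 37 (by decide), hp.h37])
    (by simp [b19, hs₃, hs₂, hs₁, i19]) (by simp [b21, hs₃, hs₂, hs₁, i21]) N (by
      rw [u1, u12, u15]
      refine le_trans ?_ hq
      gcongr
      simp)
  have key : (verifier prep edge).eval O N (inputStore [x, q, r]) =
      ((copy 15 37 ;; forEach 37 hashRow hashRow).eval O N)^[N]
        (Function.update s₄ 12 (true :: s₄ 12)) := by
    rw [hs₄, ← e3, ← e2, ← e1]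
    rfl
  rw [key, c11, u1, u12, u15, hw, isWitness]
  have d11 : s₃ 11 = [] := by simp [hs₃, hs₂, hs₁, i11]
  have d16 : s₃ 16 = w.take n := by simp [hs₃]
  rw [d11, d16] at b11
  -- In this form the simplifier can strip the two free bits in front of the walk.
  rw [show 2 + n = n + 1 + 1 by ring]
  simp [b11]

end Cmd
-- From walk counts to AM
theorem uniformProb_mono {n : ℕ} {A B : Set (Bits n)} (h : A ⊆ B) :
    uniformProb A ≤ uniformProb B := by
  unfold uniformProb
  gcongr
  exact Set.toFinite B

/-- Responses have a fixed length, so the prover pads a witness with zeros; the verifier reads only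
the beginning. -/
theorem take_ofFn_getD {s : List Bool} {l : ℕ} (h : s.length ≤ l) :
    (List.ofFn fun i : Fin l => s.getD i false).take s.length = s := by
  apply List.ext_getElem
  · simp [h]
  · intro i h1 h2
    simp [h2]

open Cmd in
/-- On input `x`, after the preparation `prep`, the program `edge` tests the labels of steps of the
walks on `Bits n` that are counted by the powers of `edgeMatrix P n κ`. -/
structure CountsWalks (O : Oracle) (N : ℕ) (prep edge : Cmd) (x : List Bool) (n κ β : ℕ)
    (P : List Bool → List Bool → List Bool → Bool) : Prop where
  spec : ∀ q r : List Bool, Prepared N n κ β (prep.eval O N (inputStore [x, q, r])) ∧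
    EdgeSpec O N n κ edge (prep.eval O N (inputStore [x, q, r])) P
  six_le : 6 ≤ N
  le_fuel : n ≤ N
  label_le : κ ≤ 4 * N
  bits_le : β ≤ 2 * N

open Cmd in
/-- Promise problems for which many walks and few walks are to be told apart are in AM. -/
theorem inAMWithOracle_of_walks {𝓞 : Set Oracle} {yes no : Set (List Bool × Oracle)}
    (prep edge : Cmd) (hprep : prep.ok = true) (hedge : edge.ok = true)
    (hk : ∀ r ∈ [1, 2, 11, 12, 16, 17, 18, 19, 21], prep.keeps r = true) (c : ℕ[X])
    (hyes : ∀ x O, (x, O) ∈ yes → ∃ n κ β P,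
      CountsWalks O (c.eval x.length) prep edge x n κ β P ∧
        2 ^ (c.eval x.length * β) ≤ ∑ a, ∑ b, (edgeMatrix P n κ ^ c.eval x.length) a b)
    (hno : ∀ x O, (x, O) ∈ no → ∃ n κ β P,
      CountsWalks O (c.eval x.length) prep edge x n κ β P ∧
        12 * ∑ a, ∑ b, (edgeMatrix P n κ ^ c.eval x.length) a b ≤ 2 ^ (c.eval x.length * β)) :
    InAMWithOracle 𝓞 yes no := by
  have hok : (verifier prep edge).ok = true := by
    simp only [verifier, walkStep, ok, hprep, hedge, Bool.true_and]
    decide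
  have hl : ∀ x : List Bool, (12 * c ^ 4).eval x.length = 12 * c.eval x.length ^ 4 := fun x => by
    simp
  -- The length `12 * N ^ 4` of questions and responses comes from the questions: at most `2 * N ^
  -- 2` rows, each of at most `6 * N ^ 2` bits.
  have bounds : ∀ {N n κ β : ℕ}, 6 ≤ N → n ≤ N → κ ≤ 4 * N → β ≤ 2 * N →
      2 + (n + N * (n + κ)) + 1 ≤ N ^ 3 ∧ 2 + (n + N * (n + κ)) ≤ 12 * N ^ 4 ∧
      N * β * (2 + (n + N * (n + κ)) + 1) ≤ 12 * N ^ 4 := by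
    intro N n κ β h6 hn hκ hβ
    have h1 : N * (n + κ) ≤ N * (5 * N) := Nat.mul_le_mul_left _ (by omega)
    have h2 : 2 + (n + N * (n + κ)) + 1 ≤ 6 * N ^ 2 := by nlinarith
    have h3 : N * β ≤ 2 * N ^ 2 := by nlinarith
    refine ⟨h2.trans ?_, ?_, ?_⟩
    · calc 6 * N ^ 2 ≤ N * N ^ 2 := by gcongr
        _ = N ^ 3 := by ring
    · calc 2 + (n + N * (n + κ)) ≤ 6 * N ^ 2 := by omega
        _ ≤ 12 * N ^ 4 := by gcongr <;> omega
    · calc N * β * (2 + (n + N * (n + κ)) + 1) ≤ 2 * N ^ 2 * (6 * N ^ 2) := Nat.mul_le_mul h3 h2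
        _ = 12 * N ^ 4 := by ring
  refine inAMWithOracle_of_cmd (verifier prep edge) hok c (12 * c ^ 4) ?_ ?_
  · intro x O hx
    obtain ⟨n, κ, β, P, ⟨hP, h6, hn, hκ, hβ⟩, hcount⟩ := hyes x O hx
    obtain ⟨b1, b2, b3⟩ := bounds h6 hn hκ hβ
    set N := c.eval x.length with hN
    classical
    -- The honest prover answers with a witness whose hash value is zero whenever there is one.
    let r : Bits ((12 * c ^ 4).eval x.length) → Bits ((12 * c ^ 4).eval x.length) := fun q =>
      if hq : ∃ s ∈ witnesses P n κ N, hashZero (N * β) (true :: s.reverse) (List.ofFn q) = true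
      then fun i => hq.choose.getD i false else fun _ => false
    refine ⟨r, (le_uniformProb_hash (K := 2 + (n + N * (n + κ))) (m := N * β) (witnesses P n κ N)
      (fun s hs => by simpa using (Finset.mem_filter.1 hs).1) (by rw [hl]; exact b3)
      (by rw [card_witnesses]; exact Nat.mul_le_mul_left _ hcount)).trans
      (uniformProb_mono fun q hq => ?_)⟩
    have hr : r q = fun i : Fin ((12 * c ^ 4).eval x.length) => hq.choose.getD i false := by
      have hq' : ∃ s ∈ witnesses P n κ N,
        hashZero (N * β) (true :: s.reverse) (List.ofFn q) = true := hq
      simp only [r]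
      rw [dif_pos hq']
    obtain ⟨h1, h2⟩ := hq.choose_spec
    obtain ⟨h1, h3⟩ := Finset.mem_filter.1 h1
    rw [mem_bitLists] at h1
    have ht : (List.ofFn (r q)).take (2 + (n + N * (n + κ))) = hq.choose := by
      rw [hr]
      conv_lhs => rw [← h1]
      exact take_ofFn_getD (by rw [h1, hl]; exact b2)
    refine (eval_verifier (hP _ _).1 hk (hP _ _).2 (by rw [List.length_ofFn, hl]; exact b2)
      (by rw [List.length_ofFn, hl]; exact b3) b1).2 ?_
    rw [ht]
    exact ⟨h3, h2⟩
  · intro x O hx r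
    obtain ⟨n, κ, β, P, ⟨hP, h6, hn, hκ, hβ⟩, hcount⟩ := hno x O hx
    obtain ⟨b1, b2, b3⟩ := bounds h6 hn hκ hβ
    set N := c.eval x.length with hN
    -- The constant 12 in the hypothesis is the 3 of the union bound times the 4 of the two free
    -- bits.
    refine uniformProb_hash_le (K := 2 + (n + N * (n + κ))) (m := N * β) (witnesses P n κ N)
      (fun s hs => by simpa using (Finset.mem_filter.1 hs).1) (by rw [hl]; exact b3)
      (by rw [card_witnesses, ← mul_assoc]; exact hcount) _ fun q hq => ?_
    obtain ⟨h1, h2⟩ := (eval_verifier (hP _ _).1 hk (hP _ _).2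
      (by rw [List.length_ofFn, hl]; exact b2) (by rw [List.length_ofFn, hl]; exact b3) b1).1 hq
    refine ⟨_, Finset.mem_filter.2 ⟨?_, h1⟩, h2⟩
    rw [mem_bitLists, List.length_take, List.length_ofFn, hl, min_eq_left b2]

/-! ### Binary arithmetic -/

/-- The number with the given binary digits, the least significant digit first. -/
def val : List Bool → ℕ
  | [] => 0
  | b :: l => b.toNat + 2 * val l

/-- The last `w` binary digits of a number, the least significant digit first. -/
def toBits (w v : ℕ) : List Bool := (List.range w).map v.testBit

theorem mod_two_pow_succ (x k : ℕ) :
    x % 2 ^ (k + 1) = x % 2 ^ k + 2 ^ k * (x.testBit k).toNat := by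
  rw [Nat.mod_pow_succ, Nat.testBit_eq_decide_div_mod_eq]
  rcases Nat.mod_two_eq_zero_or_one (x / 2 ^ k) with h | h <;> simp [h]

/-- The number given by the first `K` digits of a string (continued by zeros), the most significant
digit first. -/
def msbVal : ℕ → List Bool → ℕ
  | 0, _ => 0
  | K + 1, l => (l.headD false).toNat * 2 ^ K + msbVal K l.tail

@[simp] theorem length_toBits (w v : ℕ) : (toBits w v).length = w := by simp [toBits]

theorem val_append (l l' : List Bool) : val (l ++ l') = val l + 2 ^ l.length * val l' := by
  induction l with
  | nil => simp [val]
  | cons b l ih => simp only [List.cons_append, val, ih, List.length_cons, pow_succ]; ring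

theorem toBits_succ (w v : ℕ) : toBits (w + 1) v = toBits w v ++ [v.testBit w] := by
  simp [toBits, List.range_succ]

theorem val_toBits (w v : ℕ) : val (toBits w v) = v % 2 ^ w := by
  induction w with
  | zero => simp [toBits, val, Nat.mod_one]
  | succ w ih =>
    rw [toBits_succ, val_append, ih, mod_two_pow_succ, length_toBits]
    simp [val]

theorem val_lt (l : List Bool) : val l < 2 ^ l.length := by
  induction l with
  | nil => simp [val]
  | cons b l ih =>
    have := b.toNat_le
    simp only [val, List.length_cons, pow_succ]
    omega

theorem val_drop (l : List Bool) (i : ℕ) : val (l.drop i) = val l / 2 ^ i := by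
  induction i generalizing l with
  | zero => simp
  | succ i ih =>
    rcases l with _ | ⟨b, l⟩
    · simp [val]
    · rw [List.drop_succ_cons, ih, val, pow_succ', ← Nat.div_div_eq_div_mul]
      congr 1
      have := b.toNat_le
      omega

theorem val_bits (n : ℕ) : val n.bits = n := by
  induction n using Nat.binaryRec' with
  | zero => simp [val]
  | bit b n h ih =>
    rw [Nat.bits_append_bit n b h, val, ih, Nat.bit_val]
    omega

namespace Cmd

variable {O : Oracle} {N : ℕ}

/-- A flag as the contents of a stack. -/
def flag (b : Bool) : List Bool := if b then [true] else []

/-- Add one digit of stacks `a` and `31` and the carry on stack `32`. -/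
def addBit (a : ℕ) : Cmd :=
  branch a skip (pop a) (pop a ;; push 32 true) ;;
  branch 31 skip (pop 31) (pop 31 ;; push 32 true) ;;
  branch 32 (push 33 false)
    (pop 32 ;; branch 32 (push 33 true)
      (pop 32 ;; branch 32 (push 33 false ;; push 32 true) (push 33 true) (push 33 true))
      (pop 32 ;; branch 32 (push 33 false ;; push 32 true) (push 33 true) (push 33 true)))
    (pop 32 ;; branch 32 (push 33 true)
      (pop 32 ;; branch 32 (push 33 false ;; push 32 true) (push 33 true) (push 33 true))
      (pop 32 ;; branch 32 (push 33 false ;; push 32 true) (push 33 true) (push 33 true)))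

/-- A full adder, verified by cases. Empty stacks count as leading zeros, so summands of different
lengths need no padding. -/
theorem eval_addBit {a : ℕ} (ha : a ∉ [20, 31, 32, 33]) {s : Store} {c : Bool}
    (h : s 32 = flag c) :
    let s' := (addBit a).eval O N s
    s' a = (s a).tail ∧ s' 31 = (s 31).tail ∧
      s' 33 = decide ((val (s a) + val (s 31) + c.toNat) % 2 = 1) :: s 33 ∧
      ∃ c', s' 32 = flag c' ∧ val (s a).tail + val (s 31).tail + c'.toNat =
        (val (s a) + val (s 31) + c.toNat) / 2 := by
  simp only [List.mem_cons, List.not_mem_nil, or_false, not_or] at ha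
  obtain ⟨-, a31, a32, a33⟩ := ha
  have b31 := Ne.symm a31
  have b32 := Ne.symm a32
  have b33 := Ne.symm a33
  -- The outgoing carry: at least two of the three incoming bits are ones.
  obtain ⟨d, hd⟩ : ∃ d, d = decide (2 ≤ ((s a).headD false).toNat + ((s 31).headD false).toNat +
    c.toNat) := ⟨_, rfl⟩
  rcases hA : s a with _ | ⟨_ | _, A⟩ <;> rcases hB : s 31 with _ | ⟨_ | _, B⟩ <;> cases c <;>
    simp only [flag, if_true, Bool.false_eq_true, if_false] at h <;> simp [hA, hB] at hd <;>
    refine ⟨?_, ?_, ?_, d, ?_, ?_⟩ <;> subst hd <;>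
    simp [addBit, eval, hA, hB, h, a31, a32, a33, b31, b32, b33, val, flag] <;>
    first | omega | exact decide_eq_true (by omega)

/-- Add stack `31` to stack `a`, modulo `2 ^ N ^ 3`. -/
def add (a : ℕ) : Cmd := long (addBit a) ;; pop 32 ;; clear a ;; clear 31 ;; move 33 a

/-- After `i` digits, stack `33` holds the low digits of the sum in reverse, and the unread digits
plus the carry add up to the sum divided by `2 ^ i`. Stack `a` may be one bit too high, because
Horner's scheme doubles it just before the addition; the leftover bit is cleared. -/
theorem eval_add {a : ℕ} (ha : a ∉ [20, 31, 32, 33]) {s : Store} (hN : 1 ≤ N)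
    (hA : (s a).length ≤ N ^ 3 + 1) (hB : (s 31).length ≤ N ^ 3) (h32 : s 32 = [])
    (h33 : s 33 = []) :
    (add a).eval O N s = Function.update
      (Function.update s a (toBits (N ^ 3) (val (s a) + val (s 31)))) 31 [] := by
  have hN3 : 1 ≤ N ^ 3 := Nat.one_le_pow _ _ hN
  have main : ∀ i, let t := ((addBit a).eval O N)^[i] s
      t a = (s a).drop i ∧ t 31 = (s 31).drop i ∧
        t 33 = (toBits i (val (s a) + val (s 31))).reverse ∧
        (∀ r, r ∉ [a, 31, 32, 33] → t r = s r) ∧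
        ∃ c, t 32 = flag c ∧
          val ((s a).drop i) + val ((s 31).drop i) + c.toNat = (val (s a) + val (s 31)) / 2 ^ i := by
    intro i
    induction i with
    | zero => exact ⟨rfl, rfl, by simp [toBits, h33], fun _ _ => rfl, false, by simp [h32, flag]⟩
    | succ i ih =>
      obtain ⟨h1, h2, h3, h4, c, h5, h6⟩ := ih
      rw [Function.iterate_succ_apply']
      obtain ⟨k1, k2, k3, c', k4, k5⟩ := eval_addBit (O := O) (N := N) ha h5
      rw [h1, h2] at k3 k5
      refine ⟨by rw [k1, h1, List.tail_drop], by rw [k2, h2, List.tail_drop], ?_, fun r hr => ?_,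
        c', k4, ?_⟩
      · rw [k3, h3, h6, toBits_succ, List.reverse_append, Nat.testBit_eq_decide_div_mod_eq]
        rfl
      · rw [← h4 r hr]
        simp only [List.mem_cons, List.not_mem_nil, or_false, not_or] at hr
        exact eval_keeps _ _ (by simp [addBit, keeps, hr])
      · rw [List.tail_drop, List.tail_drop] at k5
        rw [k5, h6, Nat.div_div_eq_div_mul, pow_succ]
  obtain ⟨h1, h2, h3, h4, c, h5, -⟩ := main (N ^ 3)
  simp only [List.mem_cons, List.not_mem_nil, or_false, not_or] at ha
  obtain ⟨-, a31, a32, a33⟩ := ha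
  set t := ((addBit a).eval O N)^[N ^ 3] s with ht
  have e1 : (pop 32).eval O N t = Function.update t 32 [] := by
    cases c <;> simp [eval, h5, flag]
  have e2 := eval_clear (O := O) (N := N) (a := a) (s := Function.update t 32 [])
    (by simp [a32, h1]; omega)
  have e3 := eval_clear (O := O) (N := N) (a := 31) (s := Function.update (Function.update t 32 []) a [])
    (by simp [Ne.symm a31, h2]; omega)
  have e4 := eval_move (O := O) (N := N) (a := 33) (b := a) (Ne.symm a33)
    (s := Function.update (Function.update (Function.update t 32 []) a []) 31 [])
    (by simp [Ne.symm a33, h3])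
  change (move 33 a).eval O N ((clear 31).eval O N ((clear a).eval O N ((pop 32).eval O N
    ((long (addBit a)).eval O N s)))) = _
  rw [eval_long, ← ht, e1, e2, e3, e4]
  funext r
  by_cases r33 : r = 33
  · subst r33; simp [Ne.symm a33, h33]
  by_cases ra : r = a
  · subst ra; simp [a33, a31, Ne.symm a33, h3]
  by_cases r31 : r = 31
  · subst r31; simp [Ne.symm a31]
  by_cases r32 : r = 32
  · subst r32; simp [Ne.symm a32, h32]
  · simp [r33, ra, r31, r32, h4 r (by simp [ra, r31, r32, r33])]

/-- Compare one digit of stacks `34` and `35`. -/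
def ltBit : Cmd :=
  branch 34 (branch 35 skip (pop 35) (pop 35 ;; pop 36 ;; push 36 true))
    (pop 34 ;; branch 35 skip (pop 35) (pop 35 ;; pop 36 ;; push 36 true))
    (pop 34 ;; branch 35 (pop 36) (pop 35 ;; pop 36) (pop 35))

/-- Put a flag on stack `36` if stack `34` is less than stack `35`. -/
def lt : Cmd := long ltBit

theorem eval_ltBit {s : Store} {c : Bool} (h : s 36 = flag c) :
    let s' := ltBit.eval O N s
    s' 34 = (s 34).tail ∧ s' 35 = (s 35).tail ∧
      s' 36 = flag (if (s 34).headD false = (s 35).headD false then c else (s 35).headD false) := by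
  rcases hA : s 34 with _ | ⟨_ | _, A⟩ <;> rcases hB : s 35 with _ | ⟨_ | _, B⟩ <;> cases c <;>
    simp only [flag, if_true, Bool.false_eq_true, if_false] at h <;>
    simp [ltBit, eval, hA, hB, h, flag]

theorem headD_drop_eq_testBit (l : List Bool) (i : ℕ) :
    (l.drop i).headD false = (val l).testBit i := by
  rw [Nat.testBit_eq_decide_div_mod_eq, ← val_drop]
  rcases l.drop i with _ | ⟨_ | _, l'⟩ <;> simp [val]

/-- The digits arrive with the least significant one first, so each new position where they differ
overrules the verdict so far. After `i` rounds the flag compares the numbers modulo `2 ^ i`. -/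
theorem eval_lt {s : Store} (hA : (s 34).length ≤ N ^ 3) (hB : (s 35).length ≤ N ^ 3)
    (h36 : s 36 = []) :
    lt.eval O N s = Function.update (Function.update (Function.update s 34 []) 35 []) 36
      (flag (decide (val (s 34) < val (s 35)))) := by
  have main : ∀ i, let t := (ltBit.eval O N)^[i] s
      t 34 = (s 34).drop i ∧ t 35 = (s 35).drop i ∧
        (∀ r, r ∉ [34, 35, 36] → t r = s r) ∧
        t 36 = flag (decide (val (s 34) % 2 ^ i < val (s 35) % 2 ^ i)) := by
    intro i
    induction i with
    | zero => exact ⟨rfl, rfl, fun _ _ => rfl, by simp [h36, flag, Nat.mod_one]⟩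
    | succ i ih =>
      obtain ⟨h1, h2, h3, h4⟩ := ih
      rw [Function.iterate_succ_apply']
      obtain ⟨k1, k2, k3⟩ := eval_ltBit (O := O) (N := N) h4
      refine ⟨by rw [k1, h1, List.tail_drop], by rw [k2, h2, List.tail_drop], fun r hr => ?_, ?_⟩
      · rw [← h3 r hr]
        simp only [List.mem_cons, List.not_mem_nil, or_false, not_or] at hr
        exact eval_keeps _ _ (by simp [ltBit, keeps, hr])
      · rw [k3, h1, h2, headD_drop_eq_testBit, headD_drop_eq_testBit, mod_two_pow_succ,
          mod_two_pow_succ]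
        have l1 := Nat.mod_lt (val (s 34)) (Nat.two_pow_pos i)
        have l2 := Nat.mod_lt (val (s 35)) (Nat.two_pow_pos i)
        congr 1
        cases (val (s 34)).testBit i <;> cases (val (s 35)).testBit i <;> simp <;> omega
  obtain ⟨h1, h2, h3, h4⟩ := main (N ^ 3)
  have lA : val (s 34) < 2 ^ N ^ 3 := (val_lt _).trans_le (Nat.pow_le_pow_right (by norm_num) hA)
  have lB : val (s 35) < 2 ^ N ^ 3 := (val_lt _).trans_le (Nat.pow_le_pow_right (by norm_num) hB)
  rw [Nat.mod_eq_of_lt lA, Nat.mod_eq_of_lt lB] at h4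
  rw [lt, eval_long]
  funext r
  by_cases r36 : r = 36
  · subst r36; simp [h4]
  by_cases r35 : r = 35
  · subst r35; simp [h2, hB]
  by_cases r34 : r = 34
  · subst r34; simp [h1, hA]
  · simp [r34, r35, r36, h3]

/-- One step of Horner's scheme. -/
def mulStep (src m acc : ℕ) : Cmd :=
  push acc false ;; branch src skip (pop src) (pop src ;; copy m 31) ;; add acc

/-- Multiply stack `m` by the number given by the first `K` digits of stack `src` (which are
consumed), where `K` is the height of stack `cnt`; the product goes to the empty stack `acc`. -/
def mul (cnt src m acc : ℕ) : Cmd :=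
  copy cnt 37 ;; forEach 37 (mulStep src m acc) (mulStep src m acc)

theorem eval_mulStep {src m acc : ℕ} (hsrc : src ∉ [20, 31, 32, 33, 37])
    (hm : m ∉ [20, 31, 32, 33, 37]) (hacc : acc ∉ [20, 31, 32, 33, 37])
    (hsm : src ≠ m) (hsa : src ≠ acc) (hma : m ≠ acc) {s : Store} (hN : 1 ≤ N)
    (h20 : s 20 = []) (h31 : s 31 = []) (h32 : s 32 = []) (h33 : s 33 = [])
    (hml : (s m).length ≤ N ^ 3) (hal : (s acc).length ≤ N ^ 3) :
    (mulStep src m acc).eval O N s = Function.update (Function.update s src (s src).tail) acc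
      (toBits (N ^ 3) (2 * val (s acc) + ((s src).headD false).toNat * val (s m))) := by
  simp only [List.mem_cons, List.not_mem_nil, or_false, not_or] at hsrc hm
  have hacc' := hacc
  simp only [List.mem_cons, List.not_mem_nil, or_false, not_or] at hacc
  set s₁ := Function.update s acc (false :: s acc) with hs₁
  have e1 : (branch src skip (pop src) (pop src ;; copy m 31)).eval O N s₁ =
      Function.update (Function.update s₁ src (s src).tail) 31
        (if (s src).headD false then s m else []) := by
    have hsrc₁ : s₁ src = s src := by simp [hs₁, hsa]
    rcases hv : s src with _ | ⟨_ | _, l⟩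
    · simp only [eval, hsrc₁, hv]
      funext r
      by_cases r31 : r = 31
      · subst r31; simp [hs₁, h31, Ne.symm hacc.2.1]
      by_cases rs : r = src
      · subst rs; simp [r31, hsrc₁, hv]
      · simp [r31, rs]
    · simp only [eval, hsrc₁, hv]
      funext r
      by_cases r31 : r = 31
      · subst r31; simp [hs₁, h31, Ne.symm hacc.2.1, Ne.symm hsrc.2.1]
      · simp [r31]
    · simp only [eval, hsrc₁, hv]
      rw [eval_copy hm.2.1 hm.1 (by decide) (by simp [hs₁, hsm.symm, hma, hml])
        (by simp [hs₁, Ne.symm hsrc.1, Ne.symm hacc.1, h20])]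
      simp [hs₁, hsm.symm, hma, h31, Ne.symm hsrc.2.1, Ne.symm hacc.2.1]
  have e2 := eval_add (O := O) (N := N) (a := acc) (by simp [hacc]) hN
    (s := Function.update (Function.update s₁ src (s src).tail) 31
        (if (s src).headD false then s m else [])) (by simp [hs₁, hsa.symm, hacc, hal])
    (by
      rw [Function.update_self]
      split_ifs <;> simp [hml])
    (by simp [hs₁, Ne.symm hsrc.2.2.1, Ne.symm hacc.2.2.1, h32])
    (by simp [hs₁, Ne.symm hsrc.2.2.2.1, Ne.symm hacc.2.2.2.1, h33])
  change (add acc).eval O N ((branch src skip (pop src) (pop src ;; copy m 31)).eval O N s₁) = _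
  rw [e1, e2]
  funext r
  by_cases r31 : r = 31
  · subst r31; simp [Ne.symm hacc.2.1, Ne.symm hsrc.2.1, h31]
  by_cases ra : r = acc
  · subst ra
    simp only [hs₁, Function.update_of_ne r31, Function.update_self, Function.update_of_ne hsa.symm]
    cases (s src).headD false <;> simp [val]
  · simp [r31, ra, hs₁, Function.update_apply]

/-- Horner's scheme takes the digits of the multiplier from the most significant one on. That the
final product is below `2 ^ N ^ 3` ensures that no intermediate result is truncated. -/
theorem eval_mul {cnt src m acc K : ℕ} (hcnt : cnt ∉ [20, 37]) (hsrc : src ∉ [20, 31, 32, 33, 37])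
    (hm : m ∉ [20, 31, 32, 33, 37]) (hacc : acc ∉ [20, 31, 32, 33, 37])
    (hsm : src ≠ m) (hsa : src ≠ acc) (hma : m ≠ acc) {s : Store} (hN : 1 ≤ N)
    (h20 : s 20 = []) (h31 : s 31 = []) (h32 : s 32 = []) (h33 : s 33 = []) (h37 : s 37 = [])
    (hK : (s cnt).length = K) (hKN : K ≤ N ^ 3) (hml : (s m).length ≤ N ^ 3) (hal : s acc = [])
    (hlt : val (s m) * msbVal K (s src) < 2 ^ N ^ 3) :
    ∃ l, l.length ≤ N ^ 3 ∧ val l = val (s m) * msbVal K (s src) ∧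
      (mul cnt src m acc).eval O N s =
        Function.update (Function.update s src ((s src).drop K)) acc l := by
  simp only [List.mem_cons, List.not_mem_nil, or_false, not_or] at hcnt
  have hsrc' := hsrc
  have hacc' := hacc
  have hm' := hm
  simp only [List.mem_cons, List.not_mem_nil, or_false, not_or] at hsrc' hacc' hm'
  set t := Function.update s 37 (s cnt) with ht
  have e1 : (copy cnt 37).eval O N s = t := by
    rw [eval_copy hcnt.2 hcnt.1 (by decide) (by omega) h20, h37, List.append_nil]
  obtain ⟨⟨l, i, hi, hl, hv, he⟩, -⟩ := forEach_induction (O := O) (N := N) (r := 37)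
    (c₀ := mulStep src m acc) (c₁ := mulStep src m acc)
    (by simp [mulStep, copy, move, forEach, long, add, addBit, clear, keeps, Ne.symm hsrc'.2.2.2.2,
      Ne.symm hacc'.2.2.2.2, Ne.symm hm'.2.2.2.2])
    (by simp [mulStep, copy, move, forEach, long, add, addBit, clear, keeps, Ne.symm hsrc'.2.2.2.2,
      Ne.symm hacc'.2.2.2.2, Ne.symm hm'.2.2.2.2])
    -- The accumulated value, shifted by the number of remaining digits, plus the contribution of
    -- these digits is always the full product.
    (fun w u => ∃ l i, i + w.length = K ∧ l.length ≤ N ^ 3 ∧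
      val l * 2 ^ w.length + val (s m) * msbVal w.length ((s src).drop i) =
        val (s m) * msbVal K (s src) ∧
      u = Function.update (Function.update (Function.update s 37 w) src ((s src).drop i)) acc l)
    (by
      rintro b w u - ⟨l, i, hi, hl, hv, rfl⟩
      have e := eval_mulStep (O := O) (N := N) hsrc hm hacc hsm hsa hma
        (s := Function.update (Function.update (Function.update (Function.update s 37 (b :: w)) src
          ((s src).drop i)) acc l) 37 w) hN (by simp [Ne.symm hsrc'.1, Ne.symm hacc'.1, h20])
        (by simp [Ne.symm hsrc'.2.1, Ne.symm hacc'.2.1, h31])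
        (by simp [Ne.symm hsrc'.2.2.1, Ne.symm hacc'.2.2.1, h32])
        (by simp [Ne.symm hsrc'.2.2.2.1, Ne.symm hacc'.2.2.2.1, h33])
        (by simp [hm', hma, hsm.symm, hml]) (by simp [hacc', hl])
      simp only [Function.update_of_ne hacc'.2.2.2.2, Function.update_of_ne hma,
        Function.update_of_ne hsm.symm, Function.update_of_ne hsrc'.2.2.2.2,
        Function.update_of_ne hm'.2.2.2.2, Function.update_of_ne hsa, Function.update_self] at e
      rw [Bool.cond_self, e]
      simp only [List.length_cons] at hi hv
      refine ⟨toBits (N ^ 3) (2 * val l + (((s src).drop i).headD false).toNat * val (s m)),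
        i + 1, by omega, (length_toBits _ _).le, ?_, ?_⟩
      · simp only [msbVal, List.tail_drop] at hv
        rw [val_toBits]
        have hv' : (2 * val l + (((s src).drop i).headD false).toNat * val (s m)) * 2 ^ w.length +
            val (s m) * msbVal w.length ((s src).drop (i + 1)) =
            val (s m) * msbVal K (s src) := by
          rw [← hv]; ring
        rw [Nat.mod_eq_of_lt, hv']
        refine lt_of_le_of_lt (Nat.le_mul_of_pos_right _ (Nat.two_pow_pos w.length)) ?_
        omega
      · funext r
        by_cases ra : r = acc
        · subst ra; simp
        by_cases rs : r = src
        · subst rs; simp [hsa]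
        by_cases r37 : r = 37
        · subst r37; simp [ra, rs]
        · simp [ra, rs, r37]) t
    (by simp [ht]; omega)
    ⟨[], 0, by simp [ht, hK], by simp, by simp [ht, hK, val], by
      funext r
      by_cases ra : r = acc
      · subst ra; simp [ht, hal, hacc']
      by_cases rs : r = src
      · subst rs; simp [ht, ra, hsrc']
      · simp [ht, ra, rs]⟩
  obtain rfl : i = K := by simpa using hi
  refine ⟨l, hl, by simpa [msbVal] using hv, ?_⟩
  rw [mul, eval, e1, he]
  rw [← h37, Function.update_eq_self]

end Cmd
-- Binary digits and counting of labels
theorem msbVal_lt (K : ℕ) : ∀ l : List Bool, msbVal K l < 2 ^ K := by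
  induction K with
  | zero => intro l; simp [msbVal]
  | succ K ih =>
    intro l
    have h1 := ih l.tail
    rw [msbVal, pow_succ]
    have h2 : (l.headD false).toNat * 2 ^ K ≤ 1 * 2 ^ K :=
      Nat.mul_le_mul_right _ (Bool.toNat_le _)
    omega

/-- Binary digits of a real number, read as a natural number. -/
theorem binVal_mul_pow (K : ℕ) : ∀ l : List Bool, l.length ≤ K + 1 →
    binVal l * 2 ^ K = msbVal (K + 1) l := by
  induction K with
  | zero =>
    intro l hl
    match l, hl with
    | [], _ => simp [binVal, msbVal]
    | [b], _ => cases b <;> simp [binVal, msbVal]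
  | succ K ih =>
    intro l hl
    rcases l with _ | ⟨b, l⟩
    · have := ih [] (by simp)
      rw [msbVal]
      simp [binVal] at this ⊢
      exact this
    · have := ih l (by simpa using hl)
      rw [msbVal, List.tail_cons]
      push_cast
      rw [← this]
      cases b <;> simp [binVal, pow_succ] <;> ring

/-- Strings of `K` digits correspond bijectively to the numbers below `2 ^ K`, so counting labels is
counting numbers. -/
theorem sum_bitLists_msbVal (K : ℕ) (f : ℕ → ℕ) :
    ∑ l ∈ bitLists K, f (msbVal K l) = ∑ i ∈ Finset.range (2 ^ K), f i := by
  induction K generalizing f with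
  | zero => rw [sum_bitLists_zero]; simp [msbVal]
  | succ K ih =>
    rw [sum_bitLists_succ, Finset.sum_add_distrib, pow_succ, mul_two, Finset.sum_range_add, ← ih,
      ← ih fun i => f (2 ^ K + i)]
    simp [msbVal]

theorem sum_bitLists_val (K : ℕ) (f : ℕ → ℕ) :
    ∑ l ∈ bitLists K, f (val l) = ∑ i ∈ Finset.range (2 ^ K), f i := by
  induction K generalizing f with
  | zero => rw [sum_bitLists_zero]; simp [val]
  | succ K ih =>
    rw [sum_bitLists_add, pow_succ, mul_two, Finset.sum_range_add, ← ih,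
      ← ih fun i => f (2 ^ K + i), ← Finset.sum_add_distrib]
    refine Finset.sum_congr rfl fun l hl => ?_
    rw [mem_bitLists] at hl
    rw [sum_bitLists_one, val_append, val_append, hl]
    simp [val, add_comm]

/-- The count is `c / a` rounded up. This is how a comparison of products implements a division by
`a`. -/
theorem card_mul_lt {a c M : ℕ} (ha : 0 < a) (hM : c ≤ M) :
    c ≤ a * ∑ i ∈ Finset.range M, (if a * i < c then 1 else 0) ∧
      a * ∑ i ∈ Finset.range M, (if a * i < c then 1 else 0) < c + a := by
  have h : ∑ i ∈ Finset.range M, (if a * i < c then 1 else 0) = (c + a - 1) / a := by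
    rw [← Finset.card_filter, ← Finset.card_range ((c + a - 1) / a)]
    congr 1
    ext i
    rw [Finset.mem_filter, Finset.mem_range, Finset.mem_range, Nat.lt_iff_add_one_le (n := (_ / _)),
      Nat.le_div_iff_mul_le ha, add_mul, one_mul, mul_comm i a]
    constructor
    · rintro ⟨-, h⟩; omega
    · intro h
      have : i ≤ a * i := Nat.le_mul_of_pos_left i ha
      omega
  rw [h]
  have h1 := Nat.div_add_mod (c + a - 1) a
  have h2 := Nat.mod_lt (c + a - 1) ha
  omega

theorem eval_mono_nat (p : ℕ[X]) {m n : ℕ} (h : m ≤ n) : p.eval m ≤ p.eval n := by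
  rw [eval_eq_sum, eval_eq_sum]
  exact Finset.sum_le_sum fun i _ => Nat.mul_le_mul_left _ (Nat.pow_le_pow_left h i)

theorem length_frame (l : List Bool) : (frame l).length = 2 * l.length + 1 := by
  induction l with
  | nil => rfl
  | cons b l ih => simp [frame] at ih ⊢; omega

namespace Cmd

variable {O : Oracle} {N : ℕ}

/-- Push `k` ones. -/
def pushes (a : ℕ) : ℕ → Cmd
  | 0 => skip
  | k + 1 => push a true ;; pushes a k

theorem eval_pushes (a k : ℕ) : ∀ s : Store,
    (pushes a k).eval O N s = Function.update s a (List.replicate k true ++ s a) := by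
  induction k with
  | zero => intro s; simp [pushes, eval]
  | succ k ih =>
    intro s
    rw [pushes, eval, ih]
    simp [eval, List.replicate_succ', List.append_assoc]

theorem eval_rep_pushes (a k : ℕ) (s : Store) :
    (rep (pushes a k)).eval O N s = Function.update s a (List.replicate (N * k) true ++ s a) := by
  have main : ∀ (i : ℕ) (s : Store), ((pushes a k).eval O N)^[i] s =
      Function.update s a (List.replicate (i * k) true ++ s a) := by
    intro i
    induction i with
    | zero => intro s; simp
    | succ i ih =>
      intro s
      rw [Function.iterate_succ_apply, ih, eval_pushes, Function.update_idem, Function.update_self,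
        ← List.append_assoc, List.replicate_append_replicate, add_mul, one_mul]
  exact main N s

/-! ### The Stoquastic Largest Eigenvalue Problem -/

/-- Read the instance: stack `13` gets `n` ones, stacks `40` and `41` the numerator and the denominator
of the threshold. -/
def eigenvaluePrep : Cmd :=
  parse 0 13 ;; parse 0 40 ;; parse 0 41 ;; rep (pushes 14 3) ;; rep (pushes 15 2) ;;
    rep (pushes 42 2) ;; push 42 true

/-- Query a matrix element and compare it, scaled by the threshold, with the label. -/
def eigenvalueEdge : Cmd :=
  query 16 17 39 ;; mul 42 39 41 35 ;; mul 14 18 40 34 ;; lt ;;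
    branch 36 (push 11 true) (pop 36) (pop 36)

/-- Labels of steps from `x` to `y`. -/
def eigenvalueLabel (O : Oracle) (N a b : ℕ) (x y z : List Bool) : Bool :=
  decide (a * msbVal (3 * N) z < b * msbVal (2 * N + 1) (O x y))

/-- Two multiplications and a comparison. The factors have at most `N` and `3 * N` bits, so the
products stay far below the truncation bound. -/
theorem eigenvalueEdge_spec {n : ℕ} {s₀ : Store} (hN : 6 ≤ N)
    (h0 : ∀ r ∈ [20, 31, 32, 33, 34, 35, 36, 37], s₀ r = []) (h14 : (s₀ 14).length = 3 * N)
    (h42 : (s₀ 42).length = 2 * N + 1) (h40 : (s₀ 40).length ≤ N) (h41 : (s₀ 41).length ≤ N) :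
    EdgeSpec O N n (3 * N) eigenvalueEdge s₀
      (eigenvalueLabel O N (val (s₀ 40)) (val (s₀ 41))) := by
  refine ⟨fun s _ _ _ _ r hr => eval_keeps _ _ (by revert r; decide), fun s hs h16 h17 h18 => ?_⟩
  -- This is the role of `6 ≤ N`: all lengths that occur are small multiples of `N` and fit into a
  -- loop of `N ^ 3` rounds.
  have hN3 : 36 * N ≤ N ^ 3 := by nlinarith [pow_two N]
  have le : ∀ {k}, k ≤ 36 * N → k ≤ N ^ 3 := fun h => h.trans hN3
  have small : ∀ {l : List Bool} {v k : ℕ}, l.length ≤ N → v < 2 ^ k → N + k ≤ 36 * N →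
      val l * v < 2 ^ N ^ 3 := by
    intro l v k hl hv hk
    calc val l * v < 2 ^ N * 2 ^ k := Nat.mul_lt_mul''
          ((val_lt l).trans_le (Nat.pow_le_pow_right (by norm_num) hl)) hv
      _ = 2 ^ (N + k) := (pow_add _ _ _).symm
      _ ≤ _ := Nat.pow_le_pow_right (by norm_num) (le hk)
  set s₁ := Function.update s 39 (O (s 16) (s 17)) with hs₁
  have a1 : Agree s₁ s₀ := hs.update (by decide) _
  have z1 : ∀ r ∈ [20, 31, 32, 33, 34, 35, 36, 37], s₁ r = [] := fun r hr => by
    rw [a1 r (by revert r; decide), h0 r hr]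
  obtain ⟨l, hl, vl, e2⟩ := eval_mul (O := O) (N := N) (cnt := 42) (src := 39) (m := 41) (acc := 35)
    (K := 2 * N + 1) (s := s₁) (by decide) (by decide) (by decide) (by decide) (by decide)
    (by decide) (by decide) (by omega) (z1 _ (by decide)) (z1 _ (by decide)) (z1 _ (by decide))
    (z1 _ (by decide)) (z1 _ (by decide)) (by rw [a1 42 (by decide), h42]) (le (by omega))
    (by rw [a1 41 (by decide)]; exact le (by omega)) (z1 _ (by decide))
    (by rw [a1 41 (by decide)]; exact small h41 (msbVal_lt _ _) (by omega))
  set s₂ := Function.update (Function.update s₁ 39 ((s₁ 39).drop (2 * N + 1))) 35 l with hs₂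
  have z2 : ∀ r ∈ [20, 31, 32, 33, 34, 36, 37], s₂ r = [] := fun r hr => by
    rw [hs₂, Function.update_of_ne (by rintro rfl; revert hr; decide),
      Function.update_of_ne (by rintro rfl; revert hr; decide)]
    exact z1 r (by revert r; decide)
  have e18 : s₂ 18 = s 18 := by simp [hs₂, hs₁]
  have e40 : s₂ 40 = s₀ 40 := by simp [hs₂, a1 40 (by decide)]
  obtain ⟨l', hl', vl', e3⟩ := eval_mul (O := O) (N := N) (cnt := 14) (src := 18) (m := 40)
    (acc := 34) (K := 3 * N) (s := s₂) (by decide) (by decide) (by decide) (by decide) (by decide)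
    (by decide) (by decide) (by omega) (z2 _ (by decide)) (z2 _ (by decide)) (z2 _ (by decide))
    (z2 _ (by decide)) (z2 _ (by decide)) (by simp [hs₂, a1 14 (by decide), h14]) (le (by omega))
    (by rw [e40]; exact le (by omega)) (z2 _ (by decide))
    (by rw [e40]; exact small h40 (msbVal_lt _ _) (by omega))
  set s₃ := Function.update (Function.update s₂ 18 ((s₂ 18).drop (3 * N))) 34 l' with hs₃
  have e35 : s₃ 35 = l := by simp [hs₃, hs₂]
  have e34 : s₃ 34 = l' := by simp [hs₃]
  have e4 := eval_lt (O := O) (N := N) (s := s₃) (by rw [e34]; exact hl') (by rw [e35]; exact hl)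
    (by simp [hs₃, z2 36 (by decide)])
  set f := decide (val (s₃ 34) < val (s₃ 35)) with hf
  set s₄ := Function.update (Function.update (Function.update s₃ 34 []) 35 []) 36 (flag f) with hs₄
  have key : eigenvalueEdge.eval O N s =
      (branch 36 (push 11 true) (pop 36) (pop 36)).eval O N s₄ := by
    rw [← e4, ← e3, ← e2]; rfl
  have a4 : ∀ r, r ∉ volatile → r ≠ 36 → s₄ r = s₀ r := fun r hr h36 => by
    by_cases r34 : r = 34
    · subst r34; simp [hs₄, h0]
    by_cases r35 : r = 35
    · subst r35; simp [hs₄, h0]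
    rw [hs₄, Function.update_of_ne h36, Function.update_of_ne r35, Function.update_of_ne r34, hs₃,
      Function.update_of_ne r34, Function.update_of_ne (by rintro rfl; exact hr (by decide)), hs₂,
      Function.update_of_ne r35, Function.update_of_ne (by rintro rfl; exact hr (by decide))]
    exact a1 r hr
  have e11 : s₄ 11 = s 11 := by simp [hs₄, hs₃, hs₂, hs₁]
  have hf' : f = eigenvalueLabel O N (val (s₀ 40)) (val (s₀ 41)) (s 16) (s 17) (s 18) := by
    rw [hf, e34, e35, vl, vl', eigenvalueLabel, e40, e18, a1 41 (by decide)]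
    simp [hs₁]
  have s36 : s₄ 36 = flag f := by simp [hs₄]
  have e18' : s₄ 18 = [] := by simp [hs₄, hs₃, e18, h18]
  rw [key, ← hf']
  refine ⟨fun r hr => ?_, ?_, ?_⟩
  · by_cases r36 : r = 36
    · subst r36
      cases hb : f <;> simp [eval, s36, hb, flag, h0]
    · rw [← a4 r hr r36]
      exact eval_keeps _ _ (by
        have : r ≠ 11 := by rintro rfl; exact hr (by decide)
        simp [keeps, r36, this])
  · rw [eval_keeps _ _ rfl, e18']
  · cases hb : f <;> simp [eval, s36, hb, flag, e11]

/-- The prepared store for an instance of the eigenvalue problem. -/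
theorem eval_eigenvaluePrep {n : ℕ} {μp μm : ℚ} (hN : (eigenvalueCode n μp μm).length ≤ N)
    (hN6 : 6 ≤ N) (q r : List Bool) :
    let s₀ := eigenvaluePrep.eval O N (inputStore [eigenvalueCode n μp μm, q, r])
    (s₀ 13).length = n ∧ s₀ 40 = μp.num.natAbs.bits ∧ s₀ 41 = μp.den.bits ∧
      (s₀ 14).length = 3 * N ∧ (s₀ 15).length = 2 * N ∧ (s₀ 42).length = 2 * N + 1 ∧
      ∀ r ∈ [20, 31, 32, 33, 34, 35, 36, 37], s₀ r = [] := by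
  have hN3 : N < N ^ 3 := by nlinarith [pow_two N]
  have hlen := hN
  simp only [eigenvalueCode, unaryCode, ratCode, List.length_append, length_frame,
    List.length_replicate] at hlen
  set s := inputStore [eigenvalueCode n μp μm, q, r] with hs
  have z : ∀ r ∈ [13, 14, 15, 20, 31, 32, 33, 34, 35, 36, 37, 38, 40, 41, 42], s r = [] := by
    have hz : ∀ i, 3 ≤ i → s i = [] := fun i hi => by
      obtain ⟨j, rfl⟩ := Nat.exists_eq_add_of_le' hi
      simp [hs, inputStore]
    intro r hr
    exact hz r (by revert r; decide)
  have e1 := eval_parse (O := O) (N := N) (a := 0) (b := 13) (s := s) (u := List.replicate n true)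
    (v := frame μp.num.natAbs.bits ++ (frame μp.den.bits ++ ratCode μm)) (by decide) (by decide)
    (by decide) (by simp [hs, inputStore, eigenvalueCode, unaryCode, ratCode])
    (by rw [List.length_replicate]; omega) (z _ (by decide)) (z _ (by decide))
  have e2 := eval_parse (O := O) (N := N) (a := 0) (b := 40) (u := μp.num.natAbs.bits)
    (v := frame μp.den.bits ++ ratCode μm) (s := Function.update (Function.update s 0
      (frame μp.num.natAbs.bits ++ (frame μp.den.bits ++ ratCode μm))) 13
      (List.replicate n true ++ s 13)) (by decide) (by decide) (by decide) (by simp) (by omega)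
    (by simp [z]) (by simp [z])
  have e3 := eval_parse (O := O) (N := N) (a := 0) (b := 41) (u := μp.den.bits)
    (v := ratCode μm) (s := Function.update (Function.update (Function.update (Function.update s 0
      (frame μp.num.natAbs.bits ++ (frame μp.den.bits ++ ratCode μm))) 13
      (List.replicate n true ++ s 13)) 0 (frame μp.den.bits ++ ratCode μm)) 40
      (μp.num.natAbs.bits ++ Function.update (Function.update s 0
      (frame μp.num.natAbs.bits ++ (frame μp.den.bits ++ ratCode μm))) 13
      (List.replicate n true ++ s 13) 40)) (by decide) (by decide) (by decide) (by simp) (by omega)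
    (by simp [z]) (by simp [z])
  intro s₀
  have key : s₀ = (rep (pushes 14 3) ;; rep (pushes 15 2) ;; rep (pushes 42 2) ;;
      push 42 true).eval O N ((parse 0 41).eval O N ((parse 0 40).eval O N
        ((parse 0 13).eval O N s))) := rfl
  rw [e1, e2, e3, eval, eval, eval, eval_rep_pushes, eval_rep_pushes, eval_rep_pushes, eval] at key
  rw [key]
  refine ⟨by simp [z], by simp [z], by simp [z], by simp [z, mul_comm], by simp [z, mul_comm],
    by simp [z, mul_comm], fun r hr => ?_⟩
  rw [← z r (by revert r; decide)]
  have : ∀ i ∈ [0, 13, 14, 15, 40, 41, 42], r ≠ i := by revert r; decide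
  simp at this
  simp [this]

end Cmd
-- Walk counts for the largest eigenvalue
theorem cast_sum_pow {n : ℕ} (A : Matrix (Bits n) (Bits n) ℕ) (N : ℕ) :
    ((∑ x, ∑ y, (A ^ N) x y : ℕ) : ℝ) =
      ∑ x, ∑ y, ((A.map (Nat.cast : ℕ → ℝ)) ^ N) x y := by
  have : A.map (Nat.cast : ℕ → ℝ) ^ N = (A ^ N).map (Nat.cast : ℕ → ℝ) :=
    (map_pow (Nat.castRingHom ℝ).mapMatrix A N).symm
  rw [this]
  push_cast
  rfl

theorem sum_smul_pow {n : ℕ} (G : Matrix (Bits n) (Bits n) ℝ) (c : ℝ) (N : ℕ) :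
    ∑ x, ∑ y, ((c • G) ^ N) x y = c ^ N * ∑ x, ∑ y, (G ^ N) x y := by
  rw [_root_.smul_pow]
  simp [Finset.mul_sum]

/-- Equivalently, `2 ^ m * N ≤ 2 ^ N`. It keeps the total relative rounding error over `N` steps
bounded by one. -/
theorem le_two_pow_sub {m N : ℕ} (h : 2 * m + 2 ≤ N) : N ≤ 2 ^ (N - m) := by
  have h2 : ∀ k : ℕ, 1 ≤ k → 2 * k ≤ 2 ^ k := by
    intro k hk
    induction k, hk using Nat.le_induction with
    | base => norm_num
    | succ k hk ih => rw [pow_succ]; omega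
  have := h2 (N - m) (by omega)
  omega

open Cmd in
-- The number of labels is `2 ^ (2 * N) * b / a * G x y` rounded up, so it exceeds this value by
-- less than one. The error is turned into a multiple of `G x y` because entries have at most `N`
-- digits: a nonzero entry is at least `2 ^ (-N)`, and a zero entry has no labels at all.
theorem eigenvalueLabel_bounds {d : ℕ[X]} {n N : ℕ} {G : Matrix (Bits n) (Bits n) ℝ} {O : Oracle}
    (hO : IsBlackBox d G O) (h0 : ∀ x y, 0 ≤ G x y) (h1 : ∀ x y, G x y ≤ 1) {a b : ℕ} (ha : 0 < a)
    (hb : b < 2 ^ N) (hd : d.eval n ≤ N) (x y : Bits n) :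
    2 ^ (2 * N) * (b : ℝ) / a * G x y ≤ edgeMatrix (eigenvalueLabel O N a b) n (3 * N) x y ∧
      (edgeMatrix (eigenvalueLabel O N a b) n (3 * N) x y : ℝ) ≤
        (2 ^ (2 * N) * (b : ℝ) / a + 2 ^ N) * G x y := by
  obtain ⟨hl, hv⟩ := hO x y
  set w := O (List.ofFn x) (List.ofFn y) with hw
  set D := msbVal (2 * N + 1) w with hD
  have e1 : (D : ℝ) = G x y * 2 ^ (2 * N) := by
    rw [hD, ← binVal_mul_pow (2 * N) w (by omega), hv]
  have e2 : (msbVal (N + 1) w : ℝ) = G x y * 2 ^ N := by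
    rw [← binVal_mul_pow N w (by omega), hv]
  have ha' : (0 : ℝ) < a := by exact_mod_cast ha
  have hDle : D ≤ 2 ^ (2 * N) := by
    have : (D : ℝ) ≤ 2 ^ (2 * N) := by
      rw [e1]; exact mul_le_of_le_one_left (by positivity) (h1 x y)
    exact_mod_cast this
  have hM : b * D ≤ 2 ^ (3 * N) := by
    calc b * D ≤ 2 ^ N * 2 ^ (2 * N) := Nat.mul_le_mul hb.le hDle
      _ = 2 ^ (3 * N) := by rw [← pow_add]; congr 1; ring
  have hA : edgeMatrix (eigenvalueLabel O N a b) n (3 * N) x y =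
      ∑ i ∈ Finset.range (2 ^ (3 * N)), if a * i < b * D then 1 else 0 := by
    rw [← sum_bitLists_msbVal (3 * N) fun i => if a * i < b * D then 1 else 0]
    simp only [edgeMatrix, eigenvalueLabel, decide_eq_true_eq]
    rfl
  obtain ⟨c1, c2⟩ := card_mul_lt ha hM
  rw [← hA] at c1 c2
  set A := edgeMatrix (eigenvalueLabel O N a b) n (3 * N) x y
  have c1' : (b : ℝ) * D ≤ a * A := by exact_mod_cast c1
  have c2' : (a : ℝ) * A < b * D + a := by exact_mod_cast c2
  constructor
  · rw [div_mul_eq_mul_div, div_le_iff₀ ha']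
    calc 2 ^ (2 * N) * (b : ℝ) * G x y = b * D := by rw [e1]; ring
      _ ≤ _ := by linarith
  · rcases (h0 x y).eq_or_lt with hG | hG
    · have hD0 : D = 0 := by
        have : (D : ℝ) = 0 := by rw [e1, ← hG, zero_mul]
        exact_mod_cast this
      have : A = 0 := by
        rw [hA, hD0]; simp
      simp [this, ← hG]
    -- By the bound on the number of digits, `2 ^ N * G x y` is a natural number, and it is positive
    -- here.
    · have : (1 : ℝ) ≤ 2 ^ N * G x y := by
        have hpos : (0 : ℝ) < msbVal (N + 1) w := by rw [e2]; positivity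
        have : (1 : ℝ) ≤ msbVal (N + 1) w := by exact_mod_cast hpos
        rw [e2] at this
        linarith
      have h3 : (A : ℝ) ≤ b * D / a + 1 := by
        rw [div_add_one ha'.ne', le_div_iff₀ ha']
        linarith
      rw [e1] at h3
      calc (A : ℝ) ≤ b * (G x y * 2 ^ (2 * N)) / a + 1 := h3
        _ ≤ b * (G x y * 2 ^ (2 * N)) / a + 2 ^ N * G x y := by linarith
        _ = _ := by ring

open Cmd in
-- With `γ = 2 ^ (2 * N) / μp`, the label counts lie between `γ G` and `(γ + 2 ^ N) G`. The lower
-- bound and `μ ≥ μp` give at least `(γ μp) ^ N = 2 ^ (2 * N ^ 2)` walks. In the negative case the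
-- count, relative to this threshold, is at most the rounding factor times `2 ^ n` times the `N`-th
-- power of the ratio of the thresholds.
theorem eigenvalue_walks {p d : ℕ[X]} {n N m : ℕ} {G : Matrix (Bits n) (Bits n) ℝ} {O : Oracle}
    {μp μm : ℚ} (hI : IsEigenvalueInstance p n G μp μm) (hO : IsBlackBox d G O)
    (hp : 0 < p.eval n) (ha : μp.num.natAbs < 2 ^ m) (hb : μp.den < 2 ^ m) (hm : 2 * m + 2 ≤ N)
    (hd : d.eval n ≤ N) (hN : p.eval n * (n + 6) ≤ N) :
    ((μp : ℝ) ≤ largestEigenvalue G → 2 ^ (N * (2 * N)) ≤ ∑ x, ∑ y,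
        (edgeMatrix (eigenvalueLabel O N μp.num.natAbs μp.den) n (3 * N) ^ N) x y) ∧
      (largestEigenvalue G ≤ (μm : ℝ) → 12 * ∑ x, ∑ y,
        (edgeMatrix (eigenvalueLabel O N μp.num.natAbs μp.den) n (3 * N) ^ N) x y ≤
          2 ^ (N * (2 * N))) := by
  have hbN : μp.den < 2 ^ N := hb.trans_le (Nat.pow_le_pow_right (by norm_num) (by omega))
  have hnum : 0 < μp.num.natAbs := Int.natAbs_pos.2 (Rat.num_pos.2 hI.pos_plus).ne'
  have bounds := eigenvalueLabel_bounds hO hI.entry_nonneg hI.entry_le_one hnum hbN hd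
  obtain ⟨hμ0, hlow, hupp⟩ := eigenvalue_bounds hI.symm hI.entry_nonneg N
  set μ := largestEigenvalue G
  set a := μp.num.natAbs with ha_def
  set b := μp.den with hb_def
  set A := edgeMatrix (eigenvalueLabel O N a b) n (3 * N)
  have hμp : (μp : ℝ) = a / b := by
    have : (μp : ℝ) = (μp.num : ℝ) / μp.den := by exact_mod_cast (Rat.num_div_den μp).symm
    rw [this, ha_def, Nat.cast_natAbs, abs_of_pos (Rat.num_pos.2 hI.pos_plus)]
  have ha0 : (0 : ℝ) < a := by exact_mod_cast hnum
  have hb0 : (0 : ℝ) < b := by exact_mod_cast μp.den_pos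
  set γ : ℝ := 2 ^ (2 * N) * (b : ℝ) / a with hγ
  have hγ0 : 0 < γ := by positivity
  have hγμ : γ * μp = 2 ^ (2 * N) := by rw [hμp, hγ]; field_simp
  have hA0 : ∀ x y, 0 ≤ (γ • G) x y := fun x y => mul_nonneg hγ0.le (hI.entry_nonneg x y)
  have pos_plus : (0 : ℝ) < μp := by exact_mod_cast hI.pos_plus
  have pos_minus : (0 : ℝ) < μm := by exact_mod_cast hI.pos_minus
  constructor
  · intro h
    have h2 : (2 : ℝ) ^ (N * (2 * N)) ≤ ((∑ x, ∑ y, (A ^ N) x y : ℕ) : ℝ) := by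
      rw [cast_sum_pow]
      calc (2 : ℝ) ^ (N * (2 * N)) = γ ^ N * μp ^ N := by
            rw [← mul_pow, hγμ, ← pow_mul]; congr 1; ring
        _ ≤ γ ^ N * ∑ x, ∑ y, (G ^ N) x y := by
            gcongr
            exact (pow_le_pow_left₀ pos_plus.le h N).trans hlow
        _ = ∑ x, ∑ y, ((γ • G) ^ N) x y := (sum_smul_pow G γ N).symm
        _ ≤ _ := sum_pow_le_sum_pow hA0 (fun x y => (bounds x y).1) N
    exact_mod_cast h2
  · intro h
    -- The logarithms of the thresholds differ by at least `1 / p(n)`, and `N ≥ p(n) * (n + 6)`: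
    -- this cancels `2 ^ n` and leaves a factor 64.
    have hratio : (μm / μp : ℝ) ^ N ≤ (2 : ℝ)⁻¹ ^ (n + 6) := by
      have hp' : (0 : ℝ) < (p.eval n : ℕ) := by exact_mod_cast hp
      have hgap := hI.gap
      rw [← Real.logb_div pos_plus.ne' pos_minus.ne', div_le_iff₀ hp'] at hgap
      have h1 : ((n + 6 : ℕ) : ℝ) ≤ N * Real.logb 2 (μp / μm) := by
        have hN' : ((p.eval n : ℕ) : ℝ) * ((n + 6 : ℕ) : ℝ) ≤ N := by exact_mod_cast hN
        have hlog : 0 ≤ Real.logb 2 (μp / μm) := by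
          by_contra hneg
          push Not at hneg
          nlinarith
        calc ((n + 6 : ℕ) : ℝ) = ((n + 6 : ℕ) : ℝ) * 1 := by ring
          _ ≤ ((n + 6 : ℕ) : ℝ) * (Real.logb 2 (μp / μm) * (p.eval n : ℕ)) := by gcongr
          _ = ((p.eval n : ℕ) * ((n + 6 : ℕ) : ℝ)) * Real.logb 2 (μp / μm) := by ring
          _ ≤ _ := by gcongr
      have h2 : (2 : ℝ) ^ (n + 6) ≤ (μp / μm : ℝ) ^ N := by
        have hq : (0 : ℝ) < (μp / μm : ℝ) ^ N := by positivity
        rw [← Real.rpow_natCast, ← Real.le_logb_iff_rpow_le (by norm_num) hq, Real.logb_pow]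
        exact h1
      have h3 : (μm / μp : ℝ) = (μp / μm : ℝ)⁻¹ := by rw [inv_div]
      rw [h3, inv_pow, inv_pow]
      exact inv_anti₀ (by positivity) h2
    -- The relative error per step is `μp / 2 ^ N`, at most `1 / N`, so `N` steps cost at most a
    -- factor `e < 3`.
    have herr : (1 + 2 ^ N / γ) ^ N ≤ (3 : ℝ) := by
      have h1 : (2 : ℝ) ^ N / γ * N ≤ 1 := by
        have hx : (2 : ℝ) ^ N / γ = a / b / 2 ^ N := by
          rw [hγ, two_mul, pow_add]; field_simp
        have hab : (a / b : ℝ) ≤ 2 ^ m := by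
          have hb1 : (1 : ℝ) ≤ b := by exact_mod_cast μp.den_pos
          have ha2 : (a : ℝ) ≤ 2 ^ m := by exact_mod_cast ha.le
          exact (div_le_self ha0.le hb1).trans ha2
        have hNm : (N : ℝ) ≤ 2 ^ (N - m) := by exact_mod_cast le_two_pow_sub hm
        rw [hx, div_mul_eq_mul_div, div_le_one (by positivity)]
        calc (a / b : ℝ) * N ≤ 2 ^ m * 2 ^ (N - m) := by gcongr
          _ = 2 ^ N := by rw [← pow_add]; congr 1; omega
      calc (1 + 2 ^ N / γ) ^ N ≤ Real.exp (2 ^ N / γ) ^ N := by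
            gcongr
            rw [add_comm]; exact Real.add_one_le_exp _
        _ = Real.exp (N * (2 ^ N / γ)) := (Real.exp_nat_mul _ _).symm
        _ ≤ Real.exp 1 := by gcongr; linarith
        _ ≤ 3 := Real.exp_one_lt_three.le
    have h2 : 12 * ((∑ x, ∑ y, (A ^ N) x y : ℕ) : ℝ) ≤ 2 ^ (N * (2 * N)) := by
      rw [cast_sum_pow]
      have step : ∑ x, ∑ y, ((A.map (Nat.cast : ℕ → ℝ)) ^ N) x y ≤
          (γ + 2 ^ N) ^ N * (2 ^ n * μm ^ N) := by
        calc ∑ x, ∑ y, ((A.map (Nat.cast : ℕ → ℝ)) ^ N) x y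
            ≤ ∑ x, ∑ y, (((γ + 2 ^ N) • G) ^ N) x y :=
              sum_pow_le_sum_pow (fun x y => Nat.cast_nonneg _) (fun x y => (bounds x y).2) N
          _ = (γ + 2 ^ N) ^ N * ∑ x, ∑ y, (G ^ N) x y := sum_smul_pow G _ N
          _ ≤ (γ + 2 ^ N) ^ N * (2 ^ n * μm ^ N) := by
              gcongr
              exact hupp.trans (by gcongr)
      have e : (γ + 2 ^ N) ^ N * (2 ^ n * (μm : ℝ) ^ N) =
          2 ^ (N * (2 * N)) * (1 + 2 ^ N / γ) ^ N * (2 ^ n * (μm / μp : ℝ) ^ N) := by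
        have e1 : γ + 2 ^ N = γ * (1 + 2 ^ N / γ) := by field_simp
        have e2 : (2 : ℝ) ^ (N * (2 * N)) = γ ^ N * μp ^ N := by
          rw [← mul_pow, hγμ, ← pow_mul]; congr 1; ring
        rw [e1, e2, mul_pow, div_pow (μm : ℝ)]
        field_simp
      rw [e] at step
      calc 12 * ∑ x, ∑ y, ((A.map (Nat.cast : ℕ → ℝ)) ^ N) x y
          ≤ 12 * (2 ^ (N * (2 * N)) * (1 + 2 ^ N / γ) ^ N * (2 ^ n * (μm / μp : ℝ) ^ N)) := by
            gcongr
        _ ≤ 12 * (2 ^ (N * (2 * N)) * 3 * (2 ^ n * (2 : ℝ)⁻¹ ^ (n + 6))) := by gcongr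
        -- `36 = 12 * 3` for the required separation and the rounding, `64 = 2 ^ 6` from the ratio
        -- of the thresholds.
        _ = 2 ^ (N * (2 * N)) * (36 / 64) := by
            rw [pow_add, inv_pow]; field_simp; norm_num
        _ ≤ 2 ^ (N * (2 * N)) := mul_le_of_le_one_right (by positivity) (by norm_num)
    exact_mod_cast h2

theorem val_bits_lt (a : ℕ) {m : ℕ} (h : a.bits.length ≤ m) : a < 2 ^ m := by
  conv_lhs => rw [← val_bits a]
  exact (val_lt _).trans_le (Nat.pow_le_pow_right (by norm_num) h)

open Cmd in
/-- The Stoquastic Largest Eigenvalue Problem is in AM. -/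
theorem largestEigenvalue_inAM (p d : ℕ[X]) (hp : ∀ n : ℕ, 1 ≤ n → 0 < p.eval n) :
    InAMWithOracle Set.univ (largestEigenvalueYes p d) (largestEigenvalueNo p d) := by
  -- The summands of the polynomial for `N`: `2 * X` (with the constant) leaves room for the
  -- numerator and the denominator of the threshold, `d` bounds the number of digits of the entries,
  -- `p * (X + 6)` amplifies the gap, and 6 gives `6 ≤ N`.
  have key : ∀ {n : ℕ} {G : Matrix (Bits n) (Bits n) ℝ} {μp μm : ℚ} {O : Oracle},
      IsEigenvalueInstance p n G μp μm → IsBlackBox d G O → ∀ {N : ℕ},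
      (2 * X + d + p * (X + 6) + 6 : ℕ[X]).eval (eigenvalueCode n μp μm).length = N →
      CountsWalks O N eigenvaluePrep eigenvalueEdge (eigenvalueCode n μp μm) n (3 * N) (2 * N)
          (eigenvalueLabel O N μp.num.natAbs μp.den) ∧
        ((μp : ℝ) ≤ largestEigenvalue G → 2 ^ (N * (2 * N)) ≤ ∑ x, ∑ y,
          (edgeMatrix (eigenvalueLabel O N μp.num.natAbs μp.den) n (3 * N) ^ N) x y) ∧
        (largestEigenvalue G ≤ (μm : ℝ) → 12 * ∑ x, ∑ y,
          (edgeMatrix (eigenvalueLabel O N μp.num.natAbs μp.den) n (3 * N) ^ N) x y ≤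
            2 ^ (N * (2 * N))) := by
    intro n G μp μm O hI hO N hN
    have hlen : 2 * n + 1 + μp.num.natAbs.bits.length + μp.den.bits.length ≤
        (eigenvalueCode n μp μm).length := by
      simp only [eigenvalueCode, unaryCode, ratCode, List.length_append, length_frame,
        List.length_replicate]
      omega
    set L := (eigenvalueCode n μp μm).length with hL
    have hN' : N = 2 * L + d.eval L + p.eval L * (L + 6) + 6 := by rw [← hN]; simp
    have h6 : 6 ≤ N := by omega
    have hNN : N ≤ N ^ 3 := Nat.le_self_pow (by norm_num) N
    have hN3 : 36 * N ≤ N ^ 3 := by nlinarith [pow_two N]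
    have hdn : d.eval n ≤ d.eval L := eval_mono_nat d (by omega)
    have hpn : p.eval n * (n + 6) ≤ p.eval L * (L + 6) :=
      Nat.mul_le_mul (eval_mono_nat p (by omega)) (by omega)
    refine ⟨⟨fun q r => ?_, h6, by omega, by omega, le_rfl⟩,
      eigenvalue_walks (m := L) hI hO (hp n hI.one_le) (val_bits_lt _ (by omega))
        (val_bits_lt _ (by omega)) (by omega) (by omega) (by omega)⟩
    obtain ⟨h13, h40, h41, h14, h15, h42, h0⟩ :=
      eval_eigenvaluePrep (O := O) (N := N) (n := n) (μp := μp) (μm := μm) (by omega) h6 q r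
    have hspec := eigenvalueEdge_spec (O := O) (n := n) h6 h0 h14 h42 (by rw [h40]; omega)
      (by rw [h41]; omega)
    rw [h40, h41, val_bits, val_bits] at hspec
    exact ⟨⟨h13, h14, h15, h0 _ (by decide), h0 _ (by decide), h0 _ (by decide), by omega, by omega,
      by omega⟩, hspec⟩
  refine inAMWithOracle_of_walks eigenvaluePrep eigenvalueEdge (by decide) (by decide) (by decide)
    (2 * X + d + p * (X + 6) + 6) ?_ ?_
  · rintro x O ⟨n, G, μp, μm, hI, rfl : x = _, hO, hμ⟩
    obtain ⟨h1, h2, -⟩ := key hI hO rfl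
    exact ⟨n, _, _, _, h1, h2 hμ⟩
  · rintro x O ⟨n, G, μp, μm, hI, rfl : x = _, hO, hμ⟩
    obtain ⟨h1, -, h2⟩ := key hI hO rfl
    exact ⟨n, _, _, _, h1, h2 hμ⟩

/-- Whether `⟨x| A |y⟩` gets a contribution from `⟨u| A |v⟩` if `A` acts on the masked positions. -/
def matchBits : List Bool → List Bool → List Bool → List Bool → List Bool → Bool
  | [], _, _, _, _ => true
  | b :: M, x, y, u, v =>
    (bif b then x.headD false == u.headD false && y.headD false == v.headD false
      else x.headD false == y.headD false) && matchBits M x.tail y.tail u.tail v.tail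

namespace Cmd

variable {O : Oracle} {N : ℕ}

/-! ### Logarithms and zeros -/

/-- Put as many zeros on stack `b` as there are bits on stack `a`. -/
def zeros (a b : ℕ) : Cmd := copy a 37 ;; forEach 37 (push b false) (push b false)

theorem eval_zeros {a b : ℕ} (ha : a ∉ [20, 37]) (hb : b ∉ [20, 37]) {s : Store}
    (h : (s a).length ≤ N ^ 3) (h20 : s 20 = []) (h37 : s 37 = []) :
    (zeros a b).eval O N s =
      Function.update s b (List.replicate (s a).length false ++ s b) := by
  simp only [List.mem_cons, List.not_mem_nil, or_false, not_or] at ha hb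
  rw [zeros, eval, eval_copy ha.2 ha.1 (by decide) h h20, h37, List.append_nil]
  obtain ⟨h1, h2⟩ := forEach_induction (O := O) (N := N) (r := 37)
    (c₀ := push b false) (c₁ := push b false) (by simp [keeps, Ne.symm hb.2])
    (by simp [keeps, Ne.symm hb.2])
    (fun l t => List.replicate l.length false ++ t b =
      List.replicate (s a).length false ++ s b)
    (fun v l t _ ih => by
      rw [← ih]
      simp [eval, hb.2, List.replicate_succ', List.append_assoc]) (Function.update s 37 (s a))
    (by simpa using h) (by simp [hb.2])
  funext r
  by_cases rb : r = b
  · subst rb; simpa using h1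
  by_cases r37 : r = 37
  · subst r37; rw [h2, Function.update_of_ne rb, h37]
  · rw [eval_keeps _ _ (by simp [forEach, long, keeps, rb, r37])]
    simp [rb, r37]

/-- Halve the height of stack `50`, and push `e` bits on stack `15`. -/
def halve (e : ℕ) : Cmd :=
  forEach 50 (branch 51 (push 51 true) (pop 51 ;; push 52 true) (pop 51 ;; push 52 true))
    (branch 51 (push 51 true) (pop 51 ;; push 52 true) (pop 51 ;; push 52 true)) ;;
  pop 51 ;; move 52 50 ;; pushes 15 e

theorem keeps_pushes (r a : ℕ) (h : r ≠ a) : ∀ e, (pushes a e).keeps r = true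
  | 0 => rfl
  | e + 1 => by simp [pushes, keeps, h, keeps_pushes r a h e]

/-- Bits are removed from stack `50` in pairs: stack `51` remembers an unpaired one, and stack `52`
gets one bit per pair. -/
theorem eval_halve (e : ℕ) {s : Store} (h : (s 50).length ≤ N ^ 3) (h51 : s 51 = [])
    (h52 : s 52 = []) :
    ∃ l, l.length = (s 50).length / 2 ∧ (halve e).eval O N s =
      Function.update (Function.update s 50 l) 15 (List.replicate e true ++ s 15) := by
  obtain ⟨⟨h1, h2⟩, h3⟩ := forEach_induction (O := O) (N := N) (r := 50)
    (c₀ := branch 51 (push 51 true) (pop 51 ;; push 52 true) (pop 51 ;; push 52 true))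
    (c₁ := branch 51 (push 51 true) (pop 51 ;; push 52 true) (pop 51 ;; push 52 true)) rfl rfl
    (fun l t => (t 51).length ≤ 1 ∧ (s 50).length = l.length + 2 * (t 52).length + (t 51).length)
    (fun v l t _ ih => by
      rcases e51 : t 51 with _ | ⟨b, m⟩
      · rw [e51] at ih
        simp only [List.length_cons, List.length_nil] at ih
        cases v <;> simp [eval, e51] <;> omega
      · rw [e51] at ih
        simp only [List.length_cons] at ih
        cases v <;> cases b <;> simp [eval, e51] <;> omega) s h (by simp [h51, h52])
  set t := (forEach 50 (branch 51 (push 51 true) (pop 51 ;; push 52 true) (pop 51 ;; push 52 true))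
    (branch 51 (push 51 true) (pop 51 ;; push 52 true) (pop 51 ;; push 52 true))).eval O N s with ht
  simp only [List.length_nil, Nat.zero_add] at h2
  refine ⟨(t 52).reverse, by rw [List.length_reverse]; omega, ?_⟩
  rw [halve, eval, ← ht, eval, eval, eval, eval_move (by decide) (by simp; omega), eval_pushes]
  have e51 : (t 51).tail = [] := by
    rw [← List.length_eq_zero_iff, List.length_tail]; omega
  have keep : ∀ r, r ≠ 50 → r ≠ 51 → r ≠ 52 → t r = s r := fun r h50 h51 h52 => by
    rw [ht]
    exact eval_keeps _ _ (by simp [forEach, long, keeps, h50, h51, h52])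
  funext r
  by_cases r15 : r = 15
  · subst r15; simp [keep]
  by_cases r50 : r = 50
  · subst r50; simp [h3]
  by_cases r51 : r = 51
  · subst r51; simp [e51, h51]
  by_cases r52 : r = 52
  · subst r52; simp [h52]
  · simp [r15, r50, r51, r52, keep r r50 r51 r52]

/-- Push `e` bits on stack `15` for each binary digit of the height of stack `0`. -/
def logarithm (e : ℕ) : Cmd := copy 0 50 ;; rep (branch 50 skip (halve e) (halve e))

theorem size_eq_size_half_add_one {l : ℕ} (h : l ≠ 0) : l.size = (l / 2).size + 1 := by
  conv_lhs => rw [← Nat.bit_bodd_div2 l]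
  rw [Nat.size_bit (by rwa [Nat.bit_bodd_div2]), Nat.div2_val]

/-- A number can be halved as often as it has binary digits until it vanishes, and `N` rounds
suffice because the height is below `2 ^ N`. This yields an exponent `t` that is logarithmic in the
input length, so that `2 ^ t` is both large enough as a shift and polynomially bounded. -/
theorem eval_logarithm (e : ℕ) {s : Store} (h : (s 0).length ≤ N) (h20 : s 20 = [])
    (h50 : s 50 = []) (h51 : s 51 = []) (h52 : s 52 = []) :
    (logarithm e).eval O N s = Function.update s 15
      (List.replicate (e * (s 0).length.size) true ++ s 15) := by
  have hN3 : N ≤ N ^ 3 := Nat.le_self_pow (by norm_num) N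
  have main : ∀ (i : ℕ) (s : Store), (s 50).length < 2 ^ i → (s 50).length ≤ N ^ 3 → s 51 = [] →
      s 52 = [] → ((branch 50 skip (halve e) (halve e)).eval O N)^[i] s =
        Function.update (Function.update s 50 []) 15
          (List.replicate (e * (s 50).length.size) true ++ s 15) := by
    intro i
    induction i with
    | zero =>
      intro s hs _ _ _
      have : s 50 = [] := List.length_eq_zero_iff.1 (by simpa using hs)
      simp [this]
      rw [← this, Function.update_eq_self, Function.update_eq_self]
    | succ i ih =>
      intro s hs hsN hs51 hs52
      rw [Function.iterate_succ_apply]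
      rcases hv : s 50 with _ | ⟨b, v⟩
      · have e1 : (branch 50 skip (halve e) (halve e)).eval O N s = s := by simp [eval, hv]
        rw [e1, ih s (by simp [hv]) hsN hs51 hs52, hv]
      · obtain ⟨l, hl, e1⟩ := eval_halve (O := O) e hsN hs51 hs52
        have e2 : (branch 50 skip (halve e) (halve e)).eval O N s = (halve e).eval O N s := by
          cases b <;> simp [eval, hv]
        rw [e2, e1, ih _ (by simp [hl, pow_succ] at hs ⊢; omega) (by simp [hl]; omega)
          (by simp [hs51]) (by simp [hs52]), ← hv]
        funext r
        by_cases r15 : r = 15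
        · subst r15
          have : (s 50).length.size = ((s 50).length / 2).size + 1 :=
            size_eq_size_half_add_one (by simp [hv])
          simp [hl, this, mul_add, ← List.append_assoc]
        by_cases r50 : r = 50
        · subst r50; simp
        · simp [r15, r50]
  rw [logarithm, eval, eval_copy (by decide) (by decide) (by decide) (by omega) h20, h50,
    List.append_nil]
  change ((branch 50 skip (halve e) (halve e)).eval O N)^[N] _ = _
  rw [main N _ (by simpa using h.trans_lt Nat.lt_two_pow_self) (by simp; omega) (by simp [h51])
    (by simp [h52])]
  funext r
  by_cases r15 : r = 15
  · subst r15; simp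
  by_cases r50 : r = 50
  · subst r50; simp [h50]
  · simp [r15, r50]

/-! ### Matching positions -/

/-- Raise the flag on stack `53` if the top bits of two stacks differ. -/
def eqTop (a b : ℕ) : Cmd :=
  branch a (branch b skip skip (pop 53 ;; push 53 true))
    (branch b skip skip (pop 53 ;; push 53 true))
    (branch b (pop 53 ;; push 53 true) (pop 53 ;; push 53 true) skip)

theorem eval_eqTop (a b : ℕ) {s : Store} {c : Bool} (h : s 53 = flag c) :
    (eqTop a b).eval O N s =
      Function.update s 53 (flag (c || !((s a).headD false == (s b).headD false))) := by
  rcases hA : s a with _ | ⟨_ | _, A⟩ <;> rcases hB : s b with _ | ⟨_ | _, B⟩ <;>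
    simp only [eqTop, eval, hA, hB] <;> cases c <;> simp [h, flag]

/-- Compare one position. -/
def matchStep (b : Bool) : Cmd :=
  (bif b then eqTop 54 46 ;; eqTop 55 47 else eqTop 54 55) ;; pop 54 ;; pop 55 ;; pop 46 ;; pop 47

theorem eval_matchStep (b : Bool) {s : Store} {c : Bool} (h : s 53 = flag c) :
    let s' := (matchStep b).eval O N s
    s' 54 = (s 54).tail ∧ s' 55 = (s 55).tail ∧ s' 46 = (s 46).tail ∧ s' 47 = (s 47).tail ∧
      s' 53 = flag (c || !(bif b then (s 54).headD false == (s 46).headD false &&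
        (s 55).headD false == (s 47).headD false
        else (s 54).headD false == (s 55).headD false)) := by
  cases b
  · simp only [matchStep, cond_false, eval]
    rw [eval_eqTop 54 55 h]
    simp
  · simp only [matchStep, cond_true, eval]
    rw [eval_eqTop 54 46 h, eval_eqTop 55 47 (Function.update_self ..)]
    simp [Bool.or_assoc]

/-- Match stacks `16` and `17` with `46` and `47` under the mask on stack `45`. -/
def matchMask : Cmd := copy 16 54 ;; copy 17 55 ;; forEach 45 (matchStep false) (matchStep true)

/-- The positions are compared one by one under the control of the mask, and any mismatch raises the
flag for good. -/
theorem eval_matchMask {s : Store} (h45 : (s 45).length ≤ N ^ 3)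
    (h16 : (s 16).length ≤ (s 45).length) (h17 : (s 17).length ≤ (s 45).length)
    (h46 : (s 46).length ≤ (s 45).length) (h47 : (s 47).length ≤ (s 45).length)
    (h20 : s 20 = []) (h53 : s 53 = []) (h54 : s 54 = []) (h55 : s 55 = []) :
    matchMask.eval O N s = Function.update (Function.update (Function.update (Function.update s 45 [])
      46 []) 47 []) 53 (flag !(matchBits (s 45) (s 16) (s 17) (s 46) (s 47))) := by
  rw [matchMask, eval, eval_copy (by decide) (by decide) (by decide) (by omega) h20, eval,
    eval_copy (by decide) (by decide) (by decide) (by simp; omega) (by simp [h20])]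
  set t := Function.update (Function.update s 54 (s 16 ++ s 54)) 55
    (Function.update s 54 (s 16 ++ s 54) 17 ++ Function.update s 54 (s 16 ++ s 54) 55) with ht
  have t54 : t 54 = s 16 := by simp [ht, h54]
  have t55 : t 55 = s 17 := by simp [ht, h55]
  obtain ⟨⟨m54, m55, m46, m47, c, m53, hm⟩, m45⟩ := forEach_induction (O := O) (N := N) (r := 45)
    (c₀ := matchStep false) (c₁ := matchStep true) rfl rfl
    -- The verdict so far combined with the match of the remaining positions is the final verdict.
    -- The bounds on the lengths make all four stacks empty in the end.
    (fun M u => (u 54).length ≤ M.length ∧ (u 55).length ≤ M.length ∧ (u 46).length ≤ M.length ∧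
      (u 47).length ≤ M.length ∧ ∃ c, u 53 = flag c ∧
        (!c && matchBits M (u 54) (u 55) (u 46) (u 47)) =
          matchBits (s 45) (s 16) (s 17) (s 46) (s 47))
    (by
      rintro b M u hu ⟨m54, m55, m46, m47, c, m53, hm⟩
      obtain ⟨k54, k55, k46, k47, k53⟩ := eval_matchStep (O := O) (N := N) b (c := c)
        (s := Function.update u 45 M) (by simp [m53])
      have eb : (bif b then matchStep true else matchStep false) = matchStep b := by
        cases b <;> rfl
      simp only [List.length_cons] at m54 m55 m46 m47
      rw [eb, k54, k55, k46, k47, k53]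
      simp only [Function.update_of_ne (show (54 : ℕ) ≠ 45 by decide),
        Function.update_of_ne (show (55 : ℕ) ≠ 45 by decide),
        Function.update_of_ne (show (46 : ℕ) ≠ 45 by decide),
        Function.update_of_ne (show (47 : ℕ) ≠ 45 by decide), List.length_tail]
      refine ⟨by omega, by omega, by omega, by omega, _, rfl, ?_⟩
      rw [← hm, matchBits]
      simp [Bool.and_assoc]) t (by simpa [ht] using h45)
    (by
      rw [t54, t55]
      exact ⟨by simpa [ht] using h16, by simpa [ht] using h17, by simpa [ht] using h46,
        by simpa [ht] using h47, false, by simp [ht, h53, flag], by simp [ht]⟩)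
  set t' := (forEach 45 (matchStep false) (matchStep true)).eval O N t with ht'
  simp only [List.length_nil, Nat.le_zero, List.length_eq_zero_iff] at m54 m55 m46 m47
  have hc : c = !(matchBits (s 45) (s 16) (s 17) (s 46) (s 47)) := by
    rw [← hm, matchBits]; simp
  funext r
  by_cases r53 : r = 53
  · subst r53; simp [m53, hc]
  by_cases r47 : r = 47
  · subst r47; simp [m47]
  by_cases r46 : r = 46
  · subst r46; simp [m46]
  by_cases r45 : r = 45
  · subst r45; simp [m45]
  by_cases r54 : r = 54
  · subst r54; simp [m54, h54]
  by_cases r55 : r = 55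
  · subst r55; simp [m55, h55]
  · rw [ht', eval_keeps _ _ (by
      simp [forEach, long, keeps, matchStep, eqTop, r45, r46, r47, r53, r54, r55]), ht]
    simp [r45, r46, r47, r53, r54, r55]

end Cmd
-- Reading the records of a Hamiltonian
/-- Whether the record of a matrix element matches the two basis states. -/
def matchesPosition {n : ℕ} (e : Position n) (x y : List Bool) : Bool :=
  matchBits (List.ofFn fun i : Fin n => decide (i ∈ e.1)) x y (padded e.1 e.2.1) (padded e.1 e.2.2)

/-- The absolute value of a matrix element if it is matched and has the given sign. -/
def weight {n : ℕ} (re : Position n → ℤ) (neg : Bool) (x y : List Bool) (e : Position n) : ℕ :=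
  if matchesPosition e x y = true ∧ decide (re e < 0) = neg then (re e).natAbs else 0

namespace Cmd

variable {O : Oracle} {N : ℕ}

/-- Read a record, and add the absolute value of the real part to stack `34` or `35`, according to
its sign, if the record matches. -/
def readRecord : Cmd :=
  parse 44 45 ;; parse 44 46 ;; parse 44 47 ;; parse 44 31 ;; parse 44 49 ;; clear 49 ;; matchMask ;;
    branch 53 (branch 31 skip (pop 31 ;; add 34) (pop 31 ;; add 35)) (pop 53 ;; clear 31)
      (pop 53 ;; clear 31)

/-- The temporary stacks that are used while records are read. -/
def recordTemps : List ℕ := [20, 31, 32, 33, 38, 45, 46, 47, 49, 53, 54, 55]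

/-- Positive and negative contributions are accumulated on two separate stacks, so addition of
natural numbers suffices and no signed arithmetic is needed. -/
theorem eval_readRecord {n : ℕ} {e : Position n} {a b : ℤ} {s : Store} {w : List Bool} (hN : 1 ≤ N)
    (h44 : s 44 = recordCode e a b ++ w) (hlen : (s 44).length ≤ N ^ 3)
    (h0 : ∀ r ∈ recordTemps, s r = []) (h16 : (s 16).length = n) (h17 : (s 17).length = n)
    (h34 : (s 34).length ≤ N ^ 3) (h35 : (s 35).length ≤ N ^ 3) :
    readRecord.eval O N s = Function.update (if matchesPosition e (s 16) (s 17) = true then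
      Function.update s (if a < 0 then 35 else 34)
        (toBits (N ^ 3) (val (s (if a < 0 then 35 else 34)) + a.natAbs)) else s) 44 w := by
  rw [h44] at hlen
  simp only [recordCode, intCode, List.length_append, length_frame, List.length_ofFn, padded,
    List.length_cons] at hlen
  set M := List.ofFn fun i : Fin n => decide (i ∈ e.1) with hM
  have z : ∀ r ∈ recordTemps, s r = [] := h0
  simp only [recordTemps, List.mem_cons, List.not_mem_nil, or_false, forall_eq_or_imp,
    forall_eq] at z
  obtain ⟨z20, z31, z32, z33, z38, z45, z46, z47, z49, z53, z54, z55⟩ := z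
  set s₁ := Function.update (Function.update s 44 (frame (padded e.1 e.2.1) ++
    (frame (padded e.1 e.2.2) ++ (intCode a ++ (intCode b ++ w))))) 45 M with hs₁
  have e1 : (parse 44 45).eval O N s = s₁ := by
    rw [eval_parse (u := M) (v := frame (padded e.1 e.2.1) ++
      (frame (padded e.1 e.2.2) ++ (intCode a ++ (intCode b ++ w)))) (by decide) (by decide)
      (by decide) (by rw [h44]; simp [recordCode, hM]) (by simp [hM]; omega) z33 z38, z45,
      List.append_nil]
  set s₂ := Function.update (Function.update s₁ 44 (frame (padded e.1 e.2.2) ++ (intCode a ++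
    (intCode b ++ w)))) 46 (padded e.1 e.2.1) with hs₂
  have e2 : (parse 44 46).eval O N s₁ = s₂ := by
    rw [eval_parse (u := padded e.1 e.2.1) (v := frame (padded e.1 e.2.2) ++ (intCode a ++
      (intCode b ++ w))) (by decide) (by decide)
      (by decide) (by simp [hs₁]) (by simp [padded]; omega) (by simp [hs₁, z33])
      (by simp [hs₁, z38])]
    simp [hs₂, hs₁, z46]
  set s₃ := Function.update (Function.update s₂ 44 (intCode a ++ (intCode b ++ w))) 47
    (padded e.1 e.2.2) with hs₃
  have e3 : (parse 44 47).eval O N s₂ = s₃ := by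
    rw [eval_parse (u := padded e.1 e.2.2) (v := intCode a ++
      (intCode b ++ w)) (by decide) (by decide)
      (by decide) (by simp [hs₂]) (by simp [padded]; omega) (by simp [hs₂, hs₁, z33])
      (by simp [hs₂, hs₁, z38])]
    simp [hs₃, hs₂, hs₁, z47]
  set s₄ := Function.update (Function.update s₃ 44 (intCode b ++ w)) 31
    (decide (a < 0) :: a.natAbs.bits) with hs₄
  have e4 : (parse 44 31).eval O N s₃ = s₄ := by
    rw [eval_parse (u := decide (a < 0) :: a.natAbs.bits) (v := intCode b ++ w) (by decide)
      (by decide) (by decide) (by simp [hs₃, intCode]) (by simp; omega) (by simp [hs₃, hs₂, hs₁, z33])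
      (by simp [hs₃, hs₂, hs₁, z38])]
    simp [hs₄, hs₃, hs₂, hs₁, z31]
  set s₅ := Function.update s₄ 44 w with hs₅
  -- The imaginary part is parsed and thrown away: `H` has real entries, so the imaginary parts
  -- cancel in the sum over all interactions.
  have e5 : (clear 49).eval O N ((parse 44 49).eval O N s₄) = s₅ := by
    rw [eval_parse (u := decide (b < 0) :: b.natAbs.bits) (v := w) (by decide)
      (by decide) (by decide) (by simp [hs₄, intCode]) (by simp; omega)
      (by simp [hs₄, hs₃, hs₂, hs₁, z33]) (by simp [hs₄, hs₃, hs₂, hs₁, z38]),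
      eval_clear (by simp [hs₄, hs₃, hs₂, hs₁, z49]; omega)]
    funext r
    by_cases r49 : r = 49
    · subst r49; simp [hs₅, hs₄, hs₃, hs₂, hs₁, z49]
    · simp [r49, hs₅]
  have v16 : s₅ 16 = s 16 := by simp [hs₅, hs₄, hs₃, hs₂, hs₁]
  have v17 : s₅ 17 = s 17 := by simp [hs₅, hs₄, hs₃, hs₂, hs₁]
  have v45 : s₅ 45 = M := by simp [hs₅, hs₄, hs₃, hs₂, hs₁]
  have v46 : s₅ 46 = padded e.1 e.2.1 := by simp [hs₅, hs₄, hs₃, hs₂]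
  have v47 : s₅ 47 = padded e.1 e.2.2 := by simp [hs₅, hs₄, hs₃]
  have lM : M.length = n := by simp [hM]
  have e6 := eval_matchMask (O := O) (N := N) (s := s₅) (by rw [v45, lM]; omega)
    (by rw [v16, v45, lM, h16]) (by rw [v17, v45, lM, h17])
    (by rw [v46, v45, lM]; simp [padded]) (by rw [v47, v45, lM]; simp [padded])
    (by simp [hs₅, hs₄, hs₃, hs₂, hs₁, z20]) (by simp [hs₅, hs₄, hs₃, hs₂, hs₁, z53])
    (by simp [hs₅, hs₄, hs₃, hs₂, hs₁, z54]) (by simp [hs₅, hs₄, hs₃, hs₂, hs₁, z55])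
  rw [v45, v46, v47, v16, v17] at e6
  set f := matchesPosition e (s 16) (s 17) with hf
  set s₆ := Function.update (Function.update s 44 w) 31 (decide (a < 0) :: a.natAbs.bits) with hs₆
  have e6' : matchMask.eval O N s₅ = Function.update s₆ 53 (flag !f) := by
    rw [e6]
    funext r
    by_cases r53 : r = 53
    · subst r53; simp [hf, matchesPosition, hM]
    by_cases r47 : r = 47
    · subst r47; simp [hs₆, z47]
    by_cases r46 : r = 46
    · subst r46; simp [hs₆, z46]
    by_cases r45 : r = 45
    · subst r45; simp [hs₆, z45]
    by_cases r31 : r = 31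
    · subst r31; simp [hs₆, hs₅, hs₄]
    by_cases r44 : r = 44
    · subst r44; simp [hs₆, hs₅]
    · simp [r53, r47, r46, r45, r31, r44, hs₆, hs₅, hs₄, hs₃, hs₂, hs₁]
  have key : readRecord.eval O N s =
      (branch 53 (branch 31 skip (pop 31 ;; add 34) (pop 31 ;; add 35)) (pop 53 ;; clear 31)
        (pop 53 ;; clear 31)).eval O N (Function.update s₆ 53 (flag !f)) := by
    rw [← e6', ← e5, ← e4, ← e3, ← e2, ← e1]; rfl
  rw [key]
  have b53 : Function.update s₆ 53 [] = s₆ := by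
    rw [Function.update_eq_self_iff]; simp [hs₆, z53]
  rcases hfc : f with _ | _
  · simp only [Bool.not_false, flag, if_true, eval, Function.update_self, List.tail_cons,
      Function.update_idem, b53, Bool.false_eq_true, if_false]
    rw [eval_clear (by simp [hs₆]; omega)]
    funext r
    by_cases r31 : r = 31
    · subst r31; simp [z31]
    · simp [r31, hs₆]
  · by_cases ha : a < 0
    · have e7 : (branch 53 (branch 31 skip (pop 31 ;; add 34) (pop 31 ;; add 35)) (pop 53 ;; clear 31)
          (pop 53 ;; clear 31)).eval O N (Function.update s₆ 53 (flag !true)) =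
          (add 35).eval O N (Function.update s₆ 31 a.natAbs.bits) := by
        simp only [Bool.not_true, flag, Bool.false_eq_true, if_false, b53, eval]
        simp [hs₆, ha, z53]
      rw [e7, eval_add (by decide) hN (by simp [hs₆]; omega) (by simp; omega) (by simp [hs₆, z32])
        (by simp [hs₆, z33])]
      funext r
      by_cases r31 : r = 31
      · subst r31; simp [ha, z31]
      by_cases r35 : r = 35
      · subst r35; simp [ha, hs₆, val_bits]
      · simp [ha, r31, r35, hs₆, Function.update_apply]
    · have e7 : (branch 53 (branch 31 skip (pop 31 ;; add 34) (pop 31 ;; add 35)) (pop 53 ;; clear 31)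
          (pop 53 ;; clear 31)).eval O N (Function.update s₆ 53 (flag !true)) =
          (add 34).eval O N (Function.update s₆ 31 a.natAbs.bits) := by
        simp only [Bool.not_true, flag, Bool.false_eq_true, if_false, b53, eval]
        simp [hs₆, ha, z53]
      rw [e7, eval_add (by decide) hN (by simp [hs₆]; omega) (by simp; omega) (by simp [hs₆, z32])
        (by simp [hs₆, z33])]
      funext r
      by_cases r31 : r = 31
      · subst r31; simp [ha, z31]
      by_cases r34 : r = 34
      · subst r34; simp [ha, hs₆, val_bits]
      · simp [ha, r31, r34, hs₆, Function.update_apply]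

/-- Read all records on stack `44`. -/
def readRecords : Cmd := rep (branch 44 skip readRecord readRecord)

theorem recordCode_ne_nil {n : ℕ} (e : Position n) (a b : ℤ) : recordCode e a b ≠ [] := by
  intro h
  have := congrArg List.length h
  simp [recordCode, length_frame] at this

/-- Every record is nonempty, so the height of stack `44` tells whether records are left. The bounds
on the final sums exclude truncation at every intermediate stage, since the weights are
non-negative. -/
theorem eval_readRecords {n : ℕ} (re im : Position n → ℤ) (hN : 1 ≤ N) (i : ℕ) :
    ∀ (L : List (Position n)) (s : Store), L.length ≤ i →
      s 44 = (L.flatMap fun e => recordCode e (re e) (im e)) → (s 44).length ≤ N ^ 3 →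
      (∀ r ∈ recordTemps, s r = []) → (s 16).length = n → (s 17).length = n →
      (s 34).length ≤ N ^ 3 → (s 35).length ≤ N ^ 3 →
      val (s 34) + (L.map (weight re false (s 16) (s 17))).sum < 2 ^ N ^ 3 →
      val (s 35) + (L.map (weight re true (s 16) (s 17))).sum < 2 ^ N ^ 3 →
      ∃ l l', l.length ≤ N ^ 3 ∧ l'.length ≤ N ^ 3 ∧
        val l = val (s 34) + (L.map (weight re false (s 16) (s 17))).sum ∧
        val l' = val (s 35) + (L.map (weight re true (s 16) (s 17))).sum ∧
        ((branch 44 skip readRecord readRecord).eval O N)^[i] s =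
          Function.update (Function.update (Function.update s 44 []) 34 l) 35 l' := by
  have done : ∀ (i : ℕ) (s : Store), s 44 = [] →
      ((branch 44 skip readRecord readRecord).eval O N)^[i] s = s := fun i s hs => by
    apply Function.iterate_fixed
    simp [eval, hs]
  induction i with
  | zero =>
    intro L s hL h44 _ _ _ _ h34 h35 _ _
    obtain rfl : L = [] := List.length_eq_zero_iff.1 (by omega)
    simp only [List.flatMap_nil] at h44
    exact ⟨s 34, s 35, h34, h35, by simp, by simp, by simp [← h44]⟩
  | succ i ih =>
    intro L s hL h44 hlen h0 h16 h17 h34 h35 hv34 hv35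
    rcases L with _ | ⟨e, L⟩
    · simp only [List.flatMap_nil] at h44
      exact ⟨s 34, s 35, h34, h35, by simp, by simp, by rw [done _ _ h44]; simp [← h44]⟩
    rw [List.flatMap_cons] at h44
    have e1 : (branch 44 skip readRecord readRecord).eval O N s = readRecord.eval O N s := by
      rcases hv : s 44 with _ | ⟨_ | _, v⟩
      · rw [hv] at h44
        exact absurd (List.append_eq_nil_iff.1 h44.symm).1 (recordCode_ne_nil _ _ _)
      · simp [eval, hv]
      · simp [eval, hv]
    set w := L.flatMap fun e => recordCode e (re e) (im e) with hw
    have e2 := eval_readRecord (O := O) hN h44 hlen h0 h16 h17 h34 h35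
    have hlw : w.length ≤ N ^ 3 := by
      rw [h44, List.length_append] at hlen; omega
    rw [Function.iterate_succ_apply, e1, e2]
    simp only [List.map_cons, List.sum_cons] at hv34 hv35 ⊢
    simp only [List.length_cons, Nat.add_le_add_iff_right] at hL
    by_cases hm : matchesPosition e (s 16) (s 17) = true
    · rw [if_pos hm]
      by_cases ha : re e < 0
      · simp only [ha, if_true]
        have w0 : weight re false (s 16) (s 17) e = 0 := by simp [weight, ha]
        have w1 : weight re true (s 16) (s 17) e = (re e).natAbs := by simp [weight, ha, hm]
        rw [w0, zero_add] at hv34 ⊢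
        rw [w1] at hv35 ⊢
        set t := Function.update (Function.update s 35
          (toBits (N ^ 3) (val (s 35) + (re e).natAbs))) 44 w with ht
        have t16 : t 16 = s 16 := by simp [ht]
        have t17 : t 17 = s 17 := by simp [ht]
        have t34 : t 34 = s 34 := by simp [ht]
        have t35 : val (t 35) = val (s 35) + (re e).natAbs := by
          simp only [ht, Function.update_self, Function.update_of_ne (show (35 : ℕ) ≠ 44 by decide)]
          rw [val_toBits, Nat.mod_eq_of_lt (by omega)]
        obtain ⟨l, l', hl, hl', vl, vl', he⟩ := ih L t hL (by simp [ht, hw]) (by simpa [ht] using hlw)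
          (fun r hr => by
            rw [← h0 r hr, ht, Function.update_of_ne (by rintro rfl; revert hr; decide),
              Function.update_of_ne (by rintro rfl; revert hr; decide)])
          (by rw [t16, h16]) (by rw [t17, h17]) (by rw [t34]; exact h34) (by simp [ht])
          (by rw [t34, t16, t17]; exact hv34) (by rw [t35, t16, t17]; omega)
        rw [t34, t16, t17] at vl
        rw [t35, t16, t17] at vl'
        refine ⟨l, l', hl, hl', vl, by omega, ?_⟩
        rw [he]
        funext r
        by_cases r35 : r = 35
        · simp [r35]
        by_cases r34 : r = 34
        · simp [r34]
        by_cases r44 : r = 44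
        · simp [r44]
        · simp [ht, r35, r34, r44]
      · simp only [ha, if_false]
        have w0 : weight re true (s 16) (s 17) e = 0 := by simp [weight, ha]
        have w1 : weight re false (s 16) (s 17) e = (re e).natAbs := by simp [weight, ha, hm]
        rw [w0, zero_add] at hv35 ⊢
        rw [w1] at hv34 ⊢
        set t := Function.update (Function.update s 34
          (toBits (N ^ 3) (val (s 34) + (re e).natAbs))) 44 w with ht
        have t16 : t 16 = s 16 := by simp [ht]
        have t17 : t 17 = s 17 := by simp [ht]
        have t35 : t 35 = s 35 := by simp [ht]
        have t34 : val (t 34) = val (s 34) + (re e).natAbs := by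
          simp only [ht, Function.update_self, Function.update_of_ne (show (34 : ℕ) ≠ 44 by decide)]
          rw [val_toBits, Nat.mod_eq_of_lt (by omega)]
        obtain ⟨l, l', hl, hl', vl, vl', he⟩ := ih L t hL (by simp [ht, hw]) (by simpa [ht] using hlw)
          (fun r hr => by
            rw [← h0 r hr, ht, Function.update_of_ne (by rintro rfl; revert hr; decide),
              Function.update_of_ne (by rintro rfl; revert hr; decide)])
          (by rw [t16, h16]) (by rw [t17, h17]) (by simp [ht]) (by rw [t35]; exact h35)
          (by rw [t34, t16, t17]; omega) (by rw [t35, t16, t17]; exact hv35)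
        rw [t34, t16, t17] at vl
        rw [t35, t16, t17] at vl'
        refine ⟨l, l', hl, hl', by omega, vl', ?_⟩
        rw [he]
        funext r
        by_cases r35 : r = 35
        · simp [r35]
        by_cases r34 : r = 34
        · simp [r34]
        by_cases r44 : r = 44
        · simp [r44]
        · simp [ht, r35, r34, r44]
    · rw [if_neg hm]
      have w0 : ∀ c, weight re c (s 16) (s 17) e = 0 := fun c => by simp [weight, hm]
      rw [w0, zero_add] at hv34 hv35 ⊢
      rw [w0, zero_add]
      set t := Function.update s 44 w with ht
      have t16 : t 16 = s 16 := by simp [ht]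
      have t17 : t 17 = s 17 := by simp [ht]
      have t34 : t 34 = s 34 := by simp [ht]
      have t35 : t 35 = s 35 := by simp [ht]
      obtain ⟨l, l', hl, hl', vl, vl', he⟩ := ih L t hL (by simp [ht, hw]) (by simpa [ht] using hlw)
        (fun r hr => by
          rw [← h0 r hr, ht, Function.update_of_ne (by rintro rfl; revert hr; decide)])
        (by rw [t16, h16]) (by rw [t17, h17]) (by rw [t34]; exact h34) (by rw [t35]; exact h35)
        (by rw [t34, t16, t17]; exact hv34) (by rw [t35, t16, t17]; exact hv35)
      rw [t34, t16, t17] at vl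
      rw [t35, t16, t17] at vl'
      refine ⟨l, l', hl, hl', vl, vl', ?_⟩
      rw [he, ht, Function.update_idem]

end Cmd
-- The program for Hamiltonians
-- The empty mask lets the matching program double as the equality test that is needed for the
-- diagonal shift.
theorem matchBits_replicate_false (n : ℕ) : ∀ x y u v : List Bool, x.length = n → y.length = n →
    (matchBits (List.replicate n false) x y u v = true ↔ x = y) := by
  induction n with
  | zero =>
    intro x y u v hx hy
    rw [List.length_eq_zero_iff.1 hx, List.length_eq_zero_iff.1 hy]
    simp [matchBits]
  | succ n ih =>
    intro x y u v hx hy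
    obtain ⟨a, x, rfl⟩ := List.exists_cons_of_length_eq_add_one hx
    obtain ⟨b, y, rfl⟩ := List.exists_cons_of_length_eq_add_one hy
    simp [matchBits, List.replicate_succ, ih x y _ _ (by simpa using hx) (by simpa using hy)]

theorem val_replicate_false_append (k : ℕ) (l : List Bool) :
    val (List.replicate k false ++ l) = 2 ^ k * val l := by
  induction k with
  | zero => simp
  | succ k ih => rw [List.replicate_succ, List.cons_append, val, ih, pow_succ]; simp; ring

/-- Labels of steps from `x` to `y` for a Hamiltonian: there are
`2 ^ β * δ(x, y) - 2 ^ m * ⟨x| H |y⟩` of them. -/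
def hamiltonianLabel {n : ℕ} (β : ℕ) (re : Position n → ℤ) (L : List (Position n))
    (x y z : List Bool) : Bool :=
  decide ((L.map (weight re false x y)).sum + val z <
    (if x = y then 2 ^ β else 0) + (L.map (weight re true x y)).sum)

namespace Cmd

variable {O : Oracle} {N : ℕ}

/-- Read the header of a Hamiltonian; the records remain on stack `0`. -/
def hamiltonianPrep (e : ℕ) : Cmd :=
  logarithm e ;; parse 0 13 ;; parse 0 43 ;; zeros 43 15 ;; zeros 15 14 ;; push 14 true ;;
    zeros 13 56 ;; push 57 true ;; zeros 15 57

/-- Sum up the matching matrix elements and compare with the label. -/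
def hamiltonianEdge : Cmd :=
  copy 56 45 ;; matchMask ;; branch 53 (copy 57 35) (pop 53) (pop 53) ;; copy 0 44 ;; readRecords ;;
    copy 18 31 ;; add 34 ;; clear 18 ;; lt ;; branch 36 (push 11 true) (pop 36) (pop 36)

/-- The exponent is `β = m + t`, where `m` scales the fixed-point numbers to integers and `2 ^ t` is
the shift. Stack `57` gets the number `2 ^ β`, least significant digit first. -/
theorem eval_hamiltonianPrep (e : ℕ) {n m : ℕ} {w q r : List Bool}
    (hN : (unaryCode n ++ unaryCode m ++ w).length ≤ N)
    (he : e * (unaryCode n ++ unaryCode m ++ w).length.size ≤ N) (hN6 : 6 ≤ N) :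
    let β := m + e * (unaryCode n ++ unaryCode m ++ w).length.size
    let s₀ := (hamiltonianPrep e).eval O N (inputStore [unaryCode n ++ unaryCode m ++ w, q, r])
    (s₀ 13).length = n ∧ (s₀ 14).length = β + 1 ∧ (s₀ 15).length = β ∧ s₀ 0 = w ∧
      s₀ 56 = List.replicate n false ∧ s₀ 57 = List.replicate β false ++ [true] ∧
      ∀ r ∈ 34 :: 35 :: 36 :: 37 :: 44 :: recordTemps, s₀ r = [] := by
  have hN3 : 36 * N ≤ N ^ 3 := by nlinarith [pow_two N]
  set x := unaryCode n ++ unaryCode m ++ w with hx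
  have hlen := hN
  simp only [hx, unaryCode, List.length_append, length_frame, List.length_replicate] at hlen
  set s := inputStore [x, q, r] with hs
  have z : ∀ i, 3 ≤ i → s i = [] := fun i hi => by
    obtain ⟨j, rfl⟩ := Nat.exists_eq_add_of_le' hi
    simp [hs, inputStore]
  have s0 : s 0 = x := by simp [hs, inputStore]
  set τ := e * x.length.size with hτ
  intro β s₀
  set s₁ := Function.update s 15 (List.replicate τ true) with hs₁
  have e1 : (logarithm e).eval O N s = s₁ := by
    rw [eval_logarithm e (by rw [s0]; exact hN) (z _ (by decide)) (z _ (by decide))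
      (z _ (by decide)) (z _ (by decide)), s0, z 15 (by decide), List.append_nil]
  set s₂ := Function.update (Function.update s₁ 0 (unaryCode m ++ w)) 13
    (List.replicate n true) with hs₂
  have e2 : (parse 0 13).eval O N s₁ = s₂ := by
    rw [eval_parse (u := List.replicate n true) (v := unaryCode m ++ w) (by decide) (by decide)
      (by decide) (by simp [hs₁, s0, hx, unaryCode]) (by simp; omega) (by simp [hs₁, z])
      (by simp [hs₁, z])]
    simp [hs₂, hs₁, z]
  set s₃ := Function.update (Function.update s₂ 0 w) 43 (List.replicate m true) with hs₃
  have e3 : (parse 0 43).eval O N s₂ = s₃ := by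
    rw [eval_parse (u := List.replicate m true) (v := w) (by decide) (by decide)
      (by decide) (by simp [hs₂, unaryCode]) (by simp; omega) (by simp [hs₂, hs₁, z])
      (by simp [hs₂, hs₁, z])]
    simp [hs₃, hs₂, hs₁, z]
  set s₄ := Function.update s₃ 15 (List.replicate m false ++ List.replicate τ true) with hs₄
  have e4 : (zeros 43 15).eval O N s₃ = s₄ := by
    rw [eval_zeros (by decide) (by decide) (by simp [hs₃]; omega) (by simp [hs₃, hs₂, hs₁, z])
      (by simp [hs₃, hs₂, hs₁, z])]
    simp [hs₄, hs₃, hs₂, hs₁]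
  have l15 : (s₄ 15).length = β := by simp [hs₄, β]
  set s₅ := Function.update s₄ 14 (true :: List.replicate β false) with hs₅
  have e5 : (push 14 true).eval O N ((zeros 15 14).eval O N s₄) = s₅ := by
    rw [eval_zeros (by decide) (by decide) (by rw [l15]; omega) (by simp [hs₄, hs₃, hs₂, hs₁, z])
      (by simp [hs₄, hs₃, hs₂, hs₁, z]), l15]
    simp [hs₅, hs₄, hs₃, hs₂, hs₁, z, eval]
  set s₆ := Function.update s₅ 56 (List.replicate n false) with hs₆
  have e6 : (zeros 13 56).eval O N s₅ = s₆ := by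
    rw [eval_zeros (by decide) (by decide) (by simp [hs₅, hs₄, hs₃, hs₂]; omega)
      (by simp [hs₅, hs₄, hs₃, hs₂, hs₁, z]) (by simp [hs₅, hs₄, hs₃, hs₂, hs₁, z])]
    simp [hs₆, hs₅, hs₄, hs₃, hs₂, hs₁, z]
  set s₇ := Function.update s₆ 57 (List.replicate β false ++ [true]) with hs₇
  have e7 : (zeros 15 57).eval O N ((push 57 true).eval O N s₆) = s₇ := by
    have l15' : ((push 57 true).eval O N s₆ 15).length = β := by
      rw [← l15]; simp [eval, hs₆, hs₅]
    rw [eval_zeros (by decide) (by decide) (by rw [l15']; omega)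
      (by simp [eval, hs₆, hs₅, hs₄, hs₃, hs₂, hs₁, z])
      (by simp [eval, hs₆, hs₅, hs₄, hs₃, hs₂, hs₁, z]), l15']
    simp [eval, hs₇, hs₆, hs₅, hs₄, hs₃, hs₂, hs₁, z]
  have key : s₀ = s₇ := by
    rw [← e7, ← e6, ← e5, ← e4, ← e3, ← e2, ← e1]; rfl
  rw [key]
  refine ⟨by simp [hs₇, hs₆, hs₅, hs₄, hs₃, hs₂], by simp [hs₇, hs₆, hs₅],
    by simp [hs₇, hs₆, hs₅, hs₄, β], by simp [hs₇, hs₆, hs₅, hs₄, hs₃], by simp [hs₇, hs₆],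
    by simp [hs₇], fun r hr => ?_⟩
  rw [← z r (by revert r; decide)]
  have : ∀ i ∈ [0, 13, 14, 15, 43, 56, 57], r ≠ i := by revert r; decide
  simp at this
  simp [hs₇, hs₆, hs₅, hs₄, hs₃, hs₂, hs₁, this]

/-- The negative matrix elements and the shift are summed on stack `35`, the positive ones and the
label on stack `34`. Comparing the two sums accepts as many labels as the matrix element of the
shifted operator says, without any subtraction. -/
theorem eval_hamiltonianEdge {n β : ℕ} (re im : Position n → ℤ) (L : List (Position n)) {s : Store}
    (hN : 6 ≤ N) (hL : L.length ≤ N) (hβ : β ≤ 2 * N) (hn : n ≤ N)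
    (h0 : s 0 = L.flatMap fun e => recordCode e (re e) (im e)) (hlen : (s 0).length ≤ N)
    (h56 : s 56 = List.replicate n false) (h57 : s 57 = List.replicate β false ++ [true])
    (hz : ∀ r ∈ 34 :: 35 :: 36 :: 37 :: 44 :: recordTemps, s r = [])
    (h16 : (s 16).length = n) (h17 : (s 17).length = n) (h18 : (s 18).length = β + 1)
    (hpos : (L.map (weight re false (s 16) (s 17))).sum < 2 ^ N)
    (hneg : (L.map (weight re true (s 16) (s 17))).sum < 2 ^ N) :
    hamiltonianEdge.eval O N s =
      if hamiltonianLabel β re L (s 16) (s 17) (s 18) = true then Function.update s 18 []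
      else Function.update (Function.update s 18 []) 11 (true :: s 11) := by
  have hN3 : 36 * N ≤ N ^ 3 := by nlinarith [pow_two N]
  have z := hz
  simp only [recordTemps, List.mem_cons, List.not_mem_nil, or_false, forall_eq_or_imp,
    forall_eq] at z
  obtain ⟨z34, z35, z36, z37, z44, z20, z31, z32, z33, z38, z45, z46, z47, z49, z53, z54, z55⟩ := z
  -- Each sum is less than `2 ^ (β + 1) + 2 ^ N`, which is below the truncation bound.
  have two : 2 ^ (2 * N + 2) ≤ 2 ^ N ^ 3 := Nat.pow_le_pow_right (by norm_num) (by omega)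
  have two' : 2 ^ (β + 1) + 2 ^ N ≤ 2 ^ (2 * N + 2) := by
    have h1 : 2 ^ (β + 1) ≤ 2 ^ (2 * N + 1) := Nat.pow_le_pow_right (by norm_num) (by omega)
    have h2 : 2 ^ N ≤ 2 ^ (2 * N + 1) := Nat.pow_le_pow_right (by norm_num) (by omega)
    rw [pow_succ 2 (2 * N + 1)]
    omega
  have two'' : 2 ^ β ≤ 2 ^ (β + 1) := Nat.pow_le_pow_right (by norm_num) (by omega)
  set Q := (L.map (weight re false (s 16) (s 17))).sum with hQ
  set R := (L.map (weight re true (s 16) (s 17))).sum with hR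
  have e1 : (copy 56 45).eval O N s = Function.update s 45 (List.replicate n false) := by
    rw [eval_copy (by decide) (by decide) (by decide) (by rw [h56]; simp; omega) z20, h56, z45,
      List.append_nil]
  have e2 : matchMask.eval O N (Function.update s 45 (List.replicate n false)) =
      Function.update s 53 (flag !(decide (s 16 = s 17))) := by
    rw [eval_matchMask (by simp; omega) (by simp [h16]) (by simp [h17]) (by simp [z46])
      (by simp [z47]) (by simp [z20]) (by simp [z53]) (by simp [z54]) (by simp [z55])]
    have hb : matchBits (List.replicate n false) (s 16) (s 17) [] [] = decide (s 16 = s 17) := by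
      rw [Bool.eq_iff_iff, decide_eq_true_iff]
      exact matchBits_replicate_false n _ _ _ _ h16 h17
    funext r
    by_cases r53 : r = 53
    · subst r53; simp [z46, z47, hb]
    by_cases r47 : r = 47
    · subst r47; simp [z47]
    by_cases r46 : r = 46
    · subst r46; simp [z46]
    by_cases r45 : r = 45
    · subst r45; simp [z45]
    · simp [r45, r46, r47, r53]
  set D : List Bool := if s 16 = s 17 then List.replicate β false ++ [true] else [] with hD
  have lD : D.length ≤ β + 1 := by rw [hD]; split_ifs <;> simp
  have vD : val D = if s 16 = s 17 then 2 ^ β else 0 := by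
    rw [hD]; split_ifs <;> simp [val_replicate_false_append, val]
  have e3 : (branch 53 (copy 57 35) (pop 53) (pop 53)).eval O N
      (Function.update s 53 (flag !(decide (s 16 = s 17)))) = Function.update s 35 D := by
    by_cases h : s 16 = s 17
    · have : Function.update s 53 (flag !(decide (s 16 = s 17))) = s := by
        rw [Function.update_eq_self_iff]; simp [h, flag, z53]
      rw [this, eval, z53]
      simp only
      rw [eval_copy (by decide) (by decide) (by decide) (by rw [h57]; simp; omega) z20]
      simp [hD, h, h57, z35]
    · simp only [h, decide_false, Bool.not_false, flag, if_true, eval, Function.update_self,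
        List.tail_cons, Function.update_idem, hD, if_false]
      rw [← z53, Function.update_eq_self, z53, ← z35, Function.update_eq_self]
  set s₄ := Function.update (Function.update s 35 D) 44 (s 0) with hs₄
  have e4 : (copy 0 44).eval O N (Function.update s 35 D) = s₄ := by
    rw [eval_copy (by decide) (by decide) (by decide) (by simp; omega) (by simp [z20])]
    simp [hs₄, z44]
  have t16 : s₄ 16 = s 16 := by simp [hs₄]
  have t17 : s₄ 17 = s 17 := by simp [hs₄]
  have t34 : s₄ 34 = [] := by simp [hs₄, z34]
  have t35 : s₄ 35 = D := by simp [hs₄]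
  obtain ⟨l, l', hl, hl', vl, vl', e5⟩ := eval_readRecords (O := O) re im (N := N) (by omega) N L s₄
    hL (by simp [hs₄, h0]) (by simp [hs₄]; omega) (fun r hr => by
      rw [← hz r (by simp [hr]), hs₄, Function.update_of_ne (by rintro rfl; revert hr; decide),
        Function.update_of_ne (by rintro rfl; revert hr; decide)])
    (by rw [t16, h16]) (by rw [t17, h17]) (by rw [t34]; simp) (by rw [t35]; omega)
    (by rw [t34, t16, t17]; simp only [val]; omega)
    (by rw [t35, vD, t16, t17]; split_ifs <;> omega)
  rw [t34, t16, t17, ← hQ, val, zero_add] at vl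
  rw [t35, t16, t17, ← hR, vD] at vl'
  set s₅ := Function.update (Function.update s 34 l) 35 l' with hs₅
  have e5' : readRecords.eval O N s₄ = s₅ := by
    refine Eq.trans e5 ?_
    funext r
    by_cases r35 : r = 35
    · simp [r35, hs₅]
    by_cases r34 : r = 34
    · simp [r34, hs₅]
    by_cases r44 : r = 44
    · simp [r44, hs₅, z44]
    · simp [hs₄, hs₅, r35, r34, r44]
  have e6 : (copy 18 31).eval O N s₅ = Function.update s₅ 31 (s 18) := by
    rw [eval_copy (by decide) (by decide) (by decide) (by simp [hs₅]; omega) (by simp [hs₅, z20])]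
    simp [hs₅, z31]
  have hζ := val_lt (s 18)
  rw [h18] at hζ
  set s₇ := Function.update s₅ 34 (toBits (N ^ 3) (Q + val (s 18))) with hs₇
  have e7 : (add 34).eval O N (Function.update s₅ 31 (s 18)) = s₇ := by
    rw [eval_add (by decide) (by omega) (by simp [hs₅]; omega) (by simp; omega) (by simp [hs₅, z32])
      (by simp [hs₅, z33])]
    funext r
    by_cases r31 : r = 31
    · subst r31; simp [hs₇, hs₅, z31]
    by_cases r34 : r = 34
    · subst r34; simp [hs₇, hs₅, vl]
    · simp [r31, r34, hs₇]
  have e8 : (clear 18).eval O N s₇ = Function.update s₇ 18 [] :=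
    eval_clear (by simp [hs₇, hs₅]; omega)
  set f := hamiltonianLabel β re L (s 16) (s 17) (s 18) with hf
  have e9 : lt.eval O N (Function.update s₇ 18 []) =
      Function.update (Function.update s 18 []) 36 (flag f) := by
    rw [eval_lt (by simp [hs₇]) (by simp [hs₇, hs₅, hl']) (by simp [hs₇, hs₅, z36])]
    have e34 : Function.update s₇ 18 [] 34 = toBits (N ^ 3) (Q + val (s 18)) := by simp [hs₇]
    have e35 : Function.update s₇ 18 [] 35 = l' := by simp [hs₇, hs₅]
    rw [e34, e35, val_toBits, Nat.mod_eq_of_lt (by omega), vl']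
    funext r
    by_cases r36 : r = 36
    · subst r36
      simp [hf, hamiltonianLabel, hQ, hR]
    by_cases r35 : r = 35
    · subst r35; simp [z35]
    by_cases r34 : r = 34
    · subst r34; simp [z34]
    by_cases r18 : r = 18
    · subst r18; simp
    · simp [r36, r35, r34, r18, hs₇, hs₅]
  have key : hamiltonianEdge.eval O N s =
      (branch 36 (push 11 true) (pop 36) (pop 36)).eval O N
        (Function.update (Function.update s 18 []) 36 (flag f)) := by
    rw [← e9, ← e8, ← e7, ← e6, ← e5', ← e4, ← e3, ← e2, ← e1]; rfl
  rw [key]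
  have b36 : Function.update (Function.update s 18 []) 36 [] = Function.update s 18 [] := by
    rw [Function.update_eq_self_iff]; simp [z36]
  cases hfc : f
  · simp [flag, b36, eval]
  · simp [flag, b36, eval]

theorem hamiltonianEdge_spec {n β : ℕ} (re im : Position n → ℤ) (L : List (Position n)) {s₀ : Store}
    (hN : 6 ≤ N) (hL : L.length ≤ N) (hβ : β ≤ 2 * N) (hn : n ≤ N)
    (h0 : s₀ 0 = L.flatMap fun e => recordCode e (re e) (im e)) (hlen : (s₀ 0).length ≤ N)
    (h56 : s₀ 56 = List.replicate n false) (h57 : s₀ 57 = List.replicate β false ++ [true])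
    (hz : ∀ r ∈ 34 :: 35 :: 36 :: 37 :: 44 :: recordTemps, s₀ r = [])
    (hw : ∀ c x y, (L.map (weight re c x y)).sum < 2 ^ N) :
    EdgeSpec O N n (β + 1) hamiltonianEdge s₀ (hamiltonianLabel β re L) := by
  have main : ∀ s, Agree s s₀ → (s 16).length = n → (s 17).length = n → (s 18).length = β + 1 →
      hamiltonianEdge.eval O N s =
        if hamiltonianLabel β re L (s 16) (s 17) (s 18) = true then Function.update s 18 []
        else Function.update (Function.update s 18 []) 11 (true :: s 11) := by
    intro s hs h16 h17 h18
    have e0 : s 0 = s₀ 0 := hs 0 (by decide)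
    exact eval_hamiltonianEdge re im L hN hL hβ hn (e0.trans h0) (e0 ▸ hlen)
      ((hs 56 (by decide)).trans h56) ((hs 57 (by decide)).trans h57)
      (fun r hr => (hs r (by revert r; decide)).trans (hz r hr)) h16 h17 h18 (hw _ _ _) (hw _ _ _)
  refine ⟨fun s hs h16 h17 h18 r hr => ?_, fun s hs h16 h17 h18 => ?_⟩
  · rw [main s hs h16 h17 h18]
    have h1 : r ≠ 18 := by rintro rfl; revert hr; decide
    have h2 : r ≠ 11 := by rintro rfl; revert hr; decide
    split_ifs <;> simp [h1, h2]
  · rw [main s hs h16 h17 h18]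
    split_ifs with h
    · exact ⟨hs.update (by decide) _, by simp, by simp [h]⟩
    · exact ⟨(hs.update (by decide) _).update (by decide) _, by simp, by simp [h]⟩

end Cmd
/-! ### Matrix elements of Hamiltonians -/

theorem matchBits_ofFn {n : ℕ} (M x y u v : Fin n → Bool) :
    matchBits (List.ofFn M) (List.ofFn x) (List.ofFn y) (List.ofFn u) (List.ofFn v) = true ↔
      ∀ i, (M i = true → x i = u i ∧ y i = v i) ∧ (M i = false → x i = y i) := by
  induction n with
  | zero => simp [matchBits]
  | succ n ih =>
    simp only [List.ofFn_succ, matchBits, Bool.and_eq_true, List.tail_cons, List.headD_cons, ih,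
      Fin.forall_fin_succ]
    refine and_congr_left fun _ => ?_
    cases M 0 <;> simp

theorem matchesPosition_iff {n : ℕ} (e : Position n) (x y : Bits n) :
    matchesPosition e (List.ofFn x) (List.ofFn y) = true ↔
      (∀ i, i ∉ e.1 → x i = y i) ∧ e.2 = (fun i : e.1 => x i, fun i : e.1 => y i) := by
  rw [matchesPosition, padded, padded, matchBits_ofFn, Prod.ext_iff, funext_iff, funext_iff]
  constructor
  · intro h
    refine ⟨fun i hi => (h i).2 (by simpa using hi), fun i => ?_, fun i => ?_⟩
    · have := ((h i).1 (by simp)).1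
      simpa using this.symm
    · have := ((h i).1 (by simp)).2
      simpa using this.symm
  · rintro ⟨h1, h2, h3⟩ i
    refine ⟨fun hi => ?_, fun hi => h1 i (by simpa using hi)⟩
    have hi' : i ∈ e.1 := by simpa using hi
    simp only [hi', dif_pos]
    exact ⟨(h2 ⟨i, hi'⟩).symm, (h3 ⟨i, hi'⟩).symm⟩

/-- For each `S` only the record of the restrictions of `x` and `y` can match, and it does so
precisely if `x` and `y` agree outside `S`. This mirrors the tensor product with the identity in
`extendById`. -/
theorem sum_matchesPosition {k n : ℕ} {L : List (Position n)} (hL : L.Nodup)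
    (hmem : ∀ e : Position n, e ∈ L ↔ e.1.card = k) (f : Position n → ℤ) (x y : Bits n) :
    (L.map fun e => if matchesPosition e (List.ofFn x) (List.ofFn y) = true then f e else 0).sum =
      ∑ S ∈ (Finset.univ : Finset (Fin n)).powersetCard k,
        if ∀ i, i ∉ S → x i = y i then f ⟨S, fun i => x i, fun i => y i⟩ else 0 := by
  classical
  rw [← List.sum_toFinset _ hL]
  have : L.toFinset = ((Finset.univ : Finset (Fin n)).powersetCard k).sigma
      fun S => (Finset.univ : Finset ((S → Bool) × (S → Bool))) := by
    ext e
    simp [hmem, Finset.mem_powersetCard]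
  rw [this, Finset.sum_sigma]
  refine Finset.sum_congr rfl fun S _ => ?_
  simp only [matchesPosition_iff]
  by_cases h : ∀ i, i ∉ S → x i = y i
  · rw [if_pos h, Finset.sum_eq_single ((fun i => x i, fun i => y i) : (S → Bool) × (S → Bool))]
    · rw [if_pos ⟨h, rfl⟩]
    · exact fun p _ hp => if_neg fun hp' => hp hp'.2
    · exact fun h => absurd (Finset.mem_univ _) h
  · rw [if_neg h]
    exact Finset.sum_eq_zero fun p _ => if_neg fun hp => h hp.1

theorem sum_weight_sub {n : ℕ} (re : Position n → ℤ) (x y : List Bool) (L : List (Position n)) :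
    ((L.map (weight re true x y)).sum : ℤ) - (L.map (weight re false x y)).sum =
      -(L.map fun e => if matchesPosition e x y = true then re e else 0).sum := by
  induction L with
  | nil => simp
  | cons e L ih =>
    simp only [List.map_cons, List.sum_cons]
    push_cast at ih ⊢
    have : (weight re true x y e : ℤ) - weight re false x y e =
        -(if matchesPosition e x y = true then re e else 0) := by
      by_cases hm : matchesPosition e x y = true <;> by_cases ha : re e < 0 <;>
        simp [weight, hm, ha] <;> omega
    linarith

/-- The number in each record is less than two to the length of the record, and the product of these
powers exceeds the sum of the numbers. Hence the sums have no more digits than the input. -/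
theorem sum_weight_lt {n : ℕ} (re im : Position n → ℤ) (c : Bool) (x y : List Bool)
    (L : List (Position n)) : (L.map (weight re c x y)).sum <
      2 ^ (L.flatMap fun e => recordCode e (re e) (im e)).length := by
  induction L with
  | nil => simp
  | cons e L ih =>
    rw [List.map_cons, List.sum_cons, List.flatMap_cons, List.length_append, pow_add]
    have h1 : weight re c x y e < 2 ^ (recordCode e (re e) (im e)).length := by
      have h2 : (re e).natAbs < 2 ^ (recordCode e (re e) (im e)).length := val_bits_lt _ (by
        simp only [recordCode, intCode, List.length_append, length_frame, List.length_cons]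
        omega)
      rw [weight]
      split_ifs
      · exact h2
      · exact Nat.two_pow_pos _
    -- For natural numbers, `a + b < (a + 1) * (b + 1)`.
    calc _ ≤ (weight re c x y e + 1) * ((L.map (weight re c x y)).sum + 1) - 1 := by
          rw [add_mul, mul_add]; omega
      _ < (weight re c x y e + 1) * ((L.map (weight re c x y)).sum + 1) := by
          apply Nat.sub_lt (by positivity) (by norm_num)
      _ ≤ _ := Nat.mul_le_mul h1 ih

theorem length_le_length_flatMap_recordCode {n : ℕ} (re im : Position n → ℤ)
    (L : List (Position n)) :
    L.length ≤ (L.flatMap fun e => recordCode e (re e) (im e)).length := by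
  induction L with
  | nil => simp
  | cons e L ih =>
    have := List.length_pos_iff.2 (Cmd.recordCode_ne_nil e (re e) (im e))
    rw [List.flatMap_cons, List.length_append, List.length_cons]
    omega

theorem sum_bitLists_add_val_lt {κ Q P : ℕ} (h : Q ≤ P) (h' : P ≤ Q + 2 ^ κ) :
    ∑ z ∈ bitLists κ, (if Q + val z < P then 1 else 0) = P - Q := by
  rw [sum_bitLists_val κ fun i => if Q + i < P then 1 else 0, ← Finset.card_filter,
    ← Finset.card_range (P - Q)]
  congr 1
  ext i
  simp only [Finset.mem_filter, Finset.mem_range]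
  omega

/-- Apply the operator to a standard basis vector; a coordinate of the image is no larger than its
norm. -/
theorem norm_entry_le_norm_toEuclideanCLM {ι : Type*} [Fintype ι] [DecidableEq ι]
    (A : Matrix ι ι ℂ) (u v : ι) : ‖A u v‖ ≤ ‖Matrix.toEuclideanCLM (n := ι) (𝕜 := ℂ) A‖ := by
  have h1 := (Matrix.toEuclideanCLM (n := ι) (𝕜 := ℂ) A).le_opNorm (EuclideanSpace.single v 1)
  rw [PiLp.norm_single, norm_one, mul_one] at h1
  refine le_trans ?_ h1
  refine le_trans (le_of_eq ?_) (PiLp.norm_apply_le _ u)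
  congr 1
  rw [Matrix.ofLp_toEuclideanCLM]
  simp

theorem norm_hamiltonian_le {k : ℕ} {p₁ : ℕ[X]} {n : ℕ} {h : Interactions n}
    (hI : IsStoquasticInstance k p₁ n h) (x y : Bits n) :
    ‖hamiltonian k h x y‖ ≤ ((n ^ k * p₁.eval n : ℕ) : ℝ) := by
  rw [hamiltonian, Matrix.sum_apply]
  calc _ ≤ ∑ S ∈ (Finset.univ : Finset (Fin n)).powersetCard k, ‖extendById S (h S) x y‖ :=
        norm_sum_le _ _
    _ ≤ ∑ S ∈ (Finset.univ : Finset (Fin n)).powersetCard k, ((p₁.eval n : ℕ) : ℝ) := by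
        refine Finset.sum_le_sum fun S hS => ?_
        rw [extendById]
        split_ifs
        · exact (norm_entry_le_norm_toEuclideanCLM _ _ _).trans
            (hI.norm_le S (Finset.mem_powersetCard.1 hS).2)
        · simp
    _ = ((n.choose k * p₁.eval n : ℕ) : ℝ) := by simp
    _ ≤ _ := by
        gcongr
        exact Nat.choose_le_pow n k

theorem isHermitian_hamiltonian {k : ℕ} {n : ℕ} {h : Interactions n}
    (hh : ∀ S : Finset (Fin n), S.card = k → (h S).IsHermitian) :
    (hamiltonian k h).IsHermitian := by
  refine Matrix.IsHermitian.ext fun x y => ?_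
  rw [hamiltonian, Matrix.sum_apply, Matrix.sum_apply, star_sum]
  refine Finset.sum_congr rfl fun S hS => ?_
  have hiff : (∀ i, i ∉ S → y i = x i) ↔ ∀ i, i ∉ S → x i = y i :=
    forall_congr' fun i => imp_congr_right fun _ => eq_comm
  simp only [extendById, hiff]
  split_ifs
  · exact (hh S (Finset.mem_powersetCard.1 hS).2).apply _ _
  · simp

/-- Diagonal entries are real because `H` is Hermitian, the others by the definition of
stoquasticity. -/
theorem hamiltonian_eq_map_ofReal {k : ℕ} {p₁ : ℕ[X]} {n : ℕ} {h : Interactions n}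
    (hI : IsStoquasticInstance k p₁ n h) :
    hamiltonian k h = ((hamiltonian k h).map Complex.re).map Complex.ofReal := by
  ext x y
  refine Complex.ext rfl ?_
  simp only [Matrix.map_apply, Complex.ofReal_im]
  by_cases hxy : x = y
  · subst hxy
    have := (isHermitian_hamiltonian hI.hermitian).apply x x
    exact Complex.conj_eq_iff_im.1 this
  · exact (hI.stoquastic x y hxy).1

/-- The labels of a Hamiltonian are counted by its matrix elements. -/
theorem edgeMatrix_hamiltonianLabel {k : ℕ} {p₁ : ℕ[X]} {n m t : ℕ} {h : Interactions n}
    (hI : IsStoquasticInstance k p₁ n h) {re im : Position n → ℤ} {L : List (Position n)}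
    (hL : L.Nodup) (hmem : ∀ e : Position n, e ∈ L ↔ e.1.card = k)
    (hval : ∀ e ∈ L, h e.1 e.2.1 e.2.2 = ((re e : ℂ) + (im e : ℂ) * Complex.I) / 2 ^ m)
    (ht : n ^ k * p₁.eval n ≤ 2 ^ t) (x y : Bits n) :
    0 ≤ (algebraMap ℝ (Matrix (Bits n) (Bits n) ℝ) (2 ^ t) - (hamiltonian k h).map Complex.re) x y ∧
      (edgeMatrix (hamiltonianLabel (m + t) re L) n (m + t + 1) x y : ℝ) = 2 ^ m *
        (algebraMap ℝ (Matrix (Bits n) (Bits n) ℝ) (2 ^ t) -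
          (hamiltonian k h).map Complex.re) x y := by
  set c : ℝ := (algebraMap ℝ (Matrix (Bits n) (Bits n) ℝ) (2 ^ t) -
          (hamiltonian k h).map Complex.re) x y with hc
  have hc' : c = (if x = y then 2 ^ t else 0) - (hamiltonian k h x y).re := by
    rw [hc, Matrix.sub_apply, Matrix.algebraMap_matrix_apply]
    rfl
  have hn : |(hamiltonian k h x y).re| ≤ 2 ^ t := by
    refine (Complex.abs_re_le_norm _).trans ((norm_hamiltonian_le hI x y).trans ?_)
    exact_mod_cast ht
  obtain ⟨n1, n2⟩ := abs_le.1 hn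
  have c0 : 0 ≤ c := by
    rw [hc']
    split_ifs with hxy
    · linarith
    · linarith [(hI.stoquastic x y hxy).2]
  -- A diagonal entry of `H` may be as low as `-2 ^ t`, which is why labels have one bit more than
  -- `m + t`.
  have c1 : c ≤ 2 * 2 ^ t := by
    rw [hc']
    split_ifs
    · linarith
    · linarith
  refine ⟨c0, ?_⟩
  have hre : (2 : ℝ) ^ m * (hamiltonian k h x y).re = ((L.map fun e =>
      if matchesPosition e (List.ofFn x) (List.ofFn y) = true then re e else 0).sum : ℤ) := by
    rw [sum_matchesPosition hL hmem, hamiltonian, Matrix.sum_apply, Complex.re_sum, Finset.mul_sum]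
    push_cast
    refine Finset.sum_congr rfl fun S hS => ?_
    rw [extendById]
    split_ifs
    · have := hval ⟨S, fun i => x i, fun i => y i⟩ ((hmem _).2 (Finset.mem_powersetCard.1 hS).2)
      simp only at this
      rw [this]
      have e2 : ((2 : ℂ) ^ m) = (((2 : ℝ) ^ m : ℝ) : ℂ) := by push_cast; rfl
      rw [e2, Complex.div_ofReal_re]
      simp
      field_simp
    · simp
  set Q := (L.map (weight re false (List.ofFn x) (List.ofFn y))).sum with hQ
  set R := (L.map (weight re true (List.ofFn x) (List.ofFn y))).sum with hR
  have hsub : (R : ℝ) - Q = -(2 ^ m * (hamiltonian k h x y).re) := by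
    rw [hre]
    exact_mod_cast sum_weight_sub re (List.ofFn x) (List.ofFn y) L
  set P := (if List.ofFn x = List.ofFn y then 2 ^ (m + t) else 0) + R with hP
  have hPQ : (P : ℝ) - Q = 2 ^ m * c := by
    rw [hP, hc', mul_sub]
    simp only [List.ofFn_inj]
    split_ifs
    · push_cast
      rw [pow_add]
      linarith
    · push_cast
      linarith
  have p1 : Q ≤ P := by
    have : (0 : ℝ) ≤ (P : ℝ) - Q := by rw [hPQ]; positivity
    exact_mod_cast sub_nonneg.1 this
  have p2 : P ≤ Q + 2 ^ (m + t + 1) := by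
    have : (P : ℝ) - Q ≤ 2 ^ (m + t + 1) := by
      rw [hPQ, pow_succ, pow_add, mul_assoc]
      gcongr
      linarith
    have : (P : ℝ) ≤ Q + 2 ^ (m + t + 1) := by linarith
    exact_mod_cast this
  have : edgeMatrix (hamiltonianLabel (m + t) re L) n (m + t + 1) x y = P - Q := by
    rw [← sum_bitLists_add_val_lt p1 p2]
    simp only [edgeMatrix, hamiltonianLabel, decide_eq_true_eq]
    rfl
  rw [this, Nat.cast_sub p1, hPQ]

/-- The matrix `B = 2 ^ t - H` has non-negative entries and largest eigenvalue `2 ^ t - λ`, and the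
label counts are exactly `2 ^ m * B`, so there is no rounding. For `λ ≤ 0` the threshold is reached;
for `λ ≥ 1 / M` each step loses a factor `1 - 1 / (2 ^ t * M)`. -/
theorem hamiltonian_walks {k : ℕ} {p₁ : ℕ[X]} {n m t N M : ℕ} {h : Interactions n}
    (hI : IsStoquasticInstance k p₁ n h) {re im : Position n → ℤ} {L : List (Position n)}
    (hL : L.Nodup) (hmem : ∀ e : Position n, e ∈ L ↔ e.1.card = k)
    (hval : ∀ e ∈ L, h e.1 e.2.1 e.2.2 = ((re e : ℂ) + (im e : ℂ) * Complex.I) / 2 ^ m)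
    (ht : n ^ k * p₁.eval n ≤ 2 ^ t) (hM : 0 < M) (hN : 2 ^ t * M * (n + 4) ≤ N) :
    (smallestEigenvalue (hamiltonian k h) ≤ 0 → 2 ^ (N * (m + t)) ≤ ∑ x, ∑ y,
        (edgeMatrix (hamiltonianLabel (m + t) re L) n (m + t + 1) ^ N) x y) ∧
      (1 / (M : ℝ) ≤ smallestEigenvalue (hamiltonian k h) → 12 * ∑ x, ∑ y,
        (edgeMatrix (hamiltonianLabel (m + t) re L) n (m + t + 1) ^ N) x y ≤
          2 ^ (N * (m + t))) := by
  have hE := edgeMatrix_hamiltonianLabel hI hL hmem hval ht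
  set A := edgeMatrix (hamiltonianLabel (m + t) re L) n (m + t + 1)
  set Hr := (hamiltonian k h).map Complex.re with hHr
  set B := algebraMap ℝ (Matrix (Bits n) (Bits n) ℝ) (2 ^ t) - Hr with hB
  have hsymm : Hr.IsSymm := by
    refine Matrix.IsSymm.ext fun x y => ?_
    have := (isHermitian_hamiltonian hI.hermitian).apply x y
    rw [hHr, Matrix.map_apply, Matrix.map_apply, ← this]
    rfl
  have hBsymm : B.IsSymm := by
    rw [hB, Matrix.IsSymm, Matrix.transpose_sub, hsymm.eq, Matrix.algebraMap_eq_diagonal,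
      Matrix.diagonal_transpose]
  obtain ⟨hμ0, hlow, hupp⟩ := eigenvalue_bounds hBsymm (fun x y => (hE x y).1) N
  have hlam : smallestEigenvalue (hamiltonian k h) = 2 ^ t - largestEigenvalue B := by
    conv_lhs => rw [hamiltonian_eq_map_ofReal hI]
    exact smallestEigenvalue_map_ofReal Hr hsymm (2 ^ t)
  have hA : A.map (Nat.cast : ℕ → ℝ) = (2 ^ m : ℝ) • B := by
    ext x y
    exact (hE x y).2
  have hsum : ((∑ x, ∑ y, (A ^ N) x y : ℕ) : ℝ) = (2 ^ m) ^ N * ∑ x, ∑ y, (B ^ N) x y := by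
    rw [cast_sum_pow, hA, sum_smul_pow]
  have hpow : (2 : ℝ) ^ (N * (m + t)) = (2 ^ m) ^ N * (2 ^ t) ^ N := by
    rw [← mul_pow, ← pow_add, ← pow_mul, mul_comm]
  rw [hlam]
  set μ := largestEigenvalue B
  constructor
  · intro hyes
    have : (2 : ℝ) ^ (N * (m + t)) ≤ ((∑ x, ∑ y, (A ^ N) x y : ℕ) : ℝ) := by
      rw [hsum, hpow]
      gcongr
      exact (pow_le_pow_left₀ (by positivity) (by linarith) N).trans hlow
    exact_mod_cast this
  · intro hno
    have hM' : (0 : ℝ) < M := by exact_mod_cast hM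
    -- As `N ≥ 2 ^ t * M * (n + 4)`, the accumulated loss is at least `exp (n + 4)`, hence at least
    -- `2 ^ (n + 4)`: it cancels `2 ^ n` and leaves 16, more than the required 12.
    have hμ : μ ^ N ≤ (2 ^ t) ^ N * (2 : ℝ)⁻¹ ^ (n + 4) := by
      have h1 : μ ≤ 2 ^ t * Real.exp (-(1 / (2 ^ t * M))) := by
        have := Real.add_one_le_exp (-(1 / (2 ^ t * (M : ℝ))))
        calc μ ≤ 2 ^ t - 1 / M := by linarith
          _ = 2 ^ t * (-(1 / (2 ^ t * M)) + 1) := by field_simp; ring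
          _ ≤ _ := by gcongr
      have h2 : Real.exp (-(1 / (2 ^ t * (M : ℝ)))) ^ N ≤ (2 : ℝ)⁻¹ ^ (n + 4) := by
        have h3 : Real.exp (-1) ≤ (2 : ℝ)⁻¹ := by
          rw [Real.exp_neg]
          exact inv_anti₀ (by norm_num) (by linarith [Real.add_one_le_exp (1 : ℝ)])
        rw [← Real.exp_nat_mul]
        calc Real.exp (N * -(1 / (2 ^ t * (M : ℝ)))) ≤ Real.exp ((n + 4 : ℕ) * (-1)) := by
              apply Real.exp_le_exp.2
              have : (2 : ℝ) ^ t * M * ((n + 4 : ℕ) : ℝ) ≤ N := by exact_mod_cast hN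
              have h5 : ((n + 4 : ℕ) : ℝ) ≤ N * (1 / (2 ^ t * (M : ℝ))) := by
                rw [mul_one_div, le_div_iff₀ (by positivity)]
                linarith
              linarith
          _ = Real.exp (-1) ^ (n + 4) := Real.exp_nat_mul _ _
          _ ≤ _ := by gcongr
      calc μ ^ N ≤ (2 ^ t * Real.exp (-(1 / (2 ^ t * M)))) ^ N := pow_le_pow_left₀ hμ0 h1 N
        _ = (2 ^ t) ^ N * Real.exp (-(1 / (2 ^ t * M))) ^ N := mul_pow _ _ _
        _ ≤ _ := by gcongr
    have : 12 * ((∑ x, ∑ y, (A ^ N) x y : ℕ) : ℝ) ≤ 2 ^ (N * (m + t)) := by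
      rw [hsum, hpow]
      calc 12 * ((2 ^ m) ^ N * ∑ x, ∑ y, (B ^ N) x y)
          ≤ 12 * ((2 ^ m) ^ N * (2 ^ n * ((2 ^ t) ^ N * (2 : ℝ)⁻¹ ^ (n + 4)))) := by
            gcongr
            exact hupp.trans (by gcongr)
        _ = (2 ^ m) ^ N * (2 ^ t) ^ N * (12 / 16) := by
            rw [pow_add, inv_pow]; field_simp; norm_num
        _ ≤ _ := mul_le_of_le_one_right (by positivity) (by norm_num)
    exact_mod_cast this

/-! ### Stoquastic LH-MIN -/

/-- A polynomial is bounded by a power of any power of two that exceeds its argument. -/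
theorem exists_eval_le_two_pow_mul_size (p : ℕ[X]) :
    ∃ e, ∀ l : ℕ, 1 ≤ l → p.eval l ≤ 2 ^ (e * l.size) := by
  induction p using Polynomial.induction_on' with
  | add p q hp hq =>
    obtain ⟨e, he⟩ := hp
    obtain ⟨f, hf⟩ := hq
    refine ⟨e + f + 1, fun l hl => ?_⟩
    have hs : 1 ≤ l.size := Nat.size_pos.2 hl
    rw [eval_add]
    calc p.eval l + q.eval l ≤ 2 ^ (e * l.size) + 2 ^ (f * l.size) := add_le_add (he l hl) (hf l hl)
      _ ≤ 2 ^ ((e + f) * l.size) + 2 ^ ((e + f) * l.size) := by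
          gcongr <;> omega
      _ = 2 ^ ((e + f) * l.size + 1) := by rw [pow_succ]; ring
      _ ≤ _ := by
          gcongr
          · norm_num
          · rw [add_mul _ 1]; omega
  | monomial i a =>
    refine ⟨a + i, fun l hl => ?_⟩
    have hs : 1 ≤ l.size := Nat.size_pos.2 hl
    rw [eval_monomial, add_mul, pow_add, mul_comm i, pow_mul 2 l.size i]
    gcongr
    · exact Nat.lt_two_pow_self.le.trans
        (Nat.pow_le_pow_right (by norm_num) (Nat.le_mul_of_pos_right _ hs))
    · exact (Nat.lt_size_self l).le

/-- This keeps the shift polynomial: with `t = e * l.size`, it follows that `2 ^ t ≤ (2 * l) ^ e`.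
-/
theorem two_pow_size_le {l : ℕ} (hl : 1 ≤ l) : 2 ^ l.size ≤ 2 * l := by
  obtain ⟨s, hs⟩ := Nat.exists_eq_add_of_le' (Nat.size_pos.2 hl)
  have : 2 ^ s ≤ l := Nat.lt_size.1 (by omega)
  rw [hs, pow_succ]
  omega

namespace Cmd

theorem ok_pushes {a : ℕ} (h : okReg a = true) : ∀ e, (pushes a e).ok = true
  | 0 => rfl
  | e + 1 => by simp [pushes, ok, h, ok_pushes h e]

end Cmd

open Cmd in
/-- Stoquastic LH-MIN is in AM. -/
theorem stoquasticLH_inAM (k : ℕ) (p₁ p₂ d : ℕ[X]) (hp₂ : ∀ n : ℕ, 1 ≤ n → 0 < p₂.eval n) :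
    InAM (stoquasticLHYes k p₁ d) (stoquasticLHNo k p₁ p₂ d) := by
  -- There are at most `n ^ k` interactions, each of norm at most `p₁(n)`, so `X ^ k * p₁` bounds
  -- the entries of `H`, and `2 ^ (e * l.size)` is a sufficient shift.
  obtain ⟨e, he⟩ := exists_eval_le_two_pow_mul_size (X ^ k * p₁)
  -- In the polynomial for `N`, the first summand amplifies the gap, where `(2 * X) ^ e` dominates
  -- the shift; the second bounds the input length and the exponent `t`.
  have key : ∀ {n : ℕ} {h : Interactions n} {x : List Bool} (O : Oracle),
      IsStoquasticInstance k p₁ n h → Describes k h x → ∀ {N : ℕ},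
      ((2 * X) ^ e * p₂ * (X + 4) + (C e + 1) * X + 6 : ℕ[X]).eval x.length = N →
      ∃ β P, CountsWalks O N (hamiltonianPrep e) hamiltonianEdge x n (β + 1) β P ∧
        (smallestEigenvalue (hamiltonian k h) ≤ 0 → 2 ^ (N * β) ≤ ∑ x, ∑ y,
          (edgeMatrix P n (β + 1) ^ N) x y) ∧
        (1 / ((p₂.eval n : ℕ) : ℝ) ≤ smallestEigenvalue (hamiltonian k h) → 12 * ∑ x, ∑ y,
          (edgeMatrix P n (β + 1) ^ N) x y ≤ 2 ^ (N * β)) := by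
    rintro n h x O hI ⟨m, re, im, L, hL, hmem, hval, hx⟩ N hN
    have hlen : 2 * n + 1 + (2 * m + 1) +
        (L.flatMap fun e => recordCode e (re e) (im e)).length = x.length := by
      simp only [hx, unaryCode, List.length_append, length_frame, List.length_replicate]
    set w := L.flatMap fun e => recordCode e (re e) (im e) with hw
    set l := x.length with hl
    have hN' : N = (2 * l) ^ e * p₂.eval l * (l + 4) + (e + 1) * l + 6 := by rw [← hN]; simp
    have hl1 : 1 ≤ l := by omega
    have hsize : l.size ≤ l := Nat.size_le.2 Nat.lt_two_pow_self
    have hes : e * l.size ≤ e * l := Nat.mul_le_mul_left _ hsize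
    have hel : (e + 1) * l = e * l + l := by ring
    have h6 : 6 ≤ N := by omega
    have hlN : l ≤ N := by omega
    have hwN : w.length ≤ N := by omega
    have hLN : L.length ≤ w.length := length_le_length_flatMap_recordCode re im L
    have ht : n ^ k * p₁.eval n ≤ 2 ^ (e * l.size) := by
      calc n ^ k * p₁.eval n ≤ l ^ k * p₁.eval l :=
            Nat.mul_le_mul (Nat.pow_le_pow_left (by omega) k) (eval_mono_nat p₁ (by omega))
        _ = (X ^ k * p₁ : ℕ[X]).eval l := by simp
        _ ≤ _ := he l hl1
    have hgap : 2 ^ (e * l.size) * p₂.eval n * (n + 4) ≤ N := by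
      have h1 : 2 ^ (e * l.size) ≤ (2 * l) ^ e := by
        rw [mul_comm, pow_mul]
        exact Nat.pow_le_pow_left (two_pow_size_le hl1) e
      calc 2 ^ (e * l.size) * p₂.eval n * (n + 4) ≤ (2 * l) ^ e * p₂.eval l * (l + 4) :=
            Nat.mul_le_mul (Nat.mul_le_mul h1 (eval_mono_nat p₂ (by omega))) (by omega)
        _ ≤ N := by omega
    have hN3 : 36 * N ≤ N ^ 3 := by nlinarith [pow_two N]
    refine ⟨m + e * l.size, hamiltonianLabel (m + e * l.size) re L,
      ⟨fun q r => ?_, h6, by omega, by omega, by omega⟩,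
      hamiltonian_walks hI hL hmem hval ht (hp₂ n hI.one_le) hgap⟩
    have hx' : x = unaryCode n ++ unaryCode m ++ w := hx
    obtain ⟨h13, h14, h15, h0, h56, h57, hz⟩ := eval_hamiltonianPrep (O := O) (N := N) e (n := n)
      (m := m) (w := w) (q := q) (r := r) (by rw [← hx']; exact hlN)
      (by rw [← hx', ← hl]; omega) h6
    rw [← hx'] at h13 h14 h15 h0 h56 h57 hz
    rw [← hl] at h14 h15 h57
    refine ⟨⟨h13, h14, h15, hz _ (by decide), hz _ (by decide), hz _ (by decide), by omega, by omega,
      by omega⟩, hamiltonianEdge_spec re im L h6 (by omega) (by omega) (by omega) h0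
      (by rw [h0]; exact hwN) h56 h57 hz fun c x y => ?_⟩
    exact (sum_weight_lt re im c x y L).trans_le (Nat.pow_le_pow_right (by norm_num) hwN)
  refine inAMWithOracle_of_walks (hamiltonianPrep e) hamiltonianEdge ?_ (by decide) ?_
    ((2 * X) ^ e * p₂ * (X + 4) + (C e + 1) * X + 6) ?_ ?_
  -- The program depends on the variable `e` through `pushes`, so this part is settled by a lemma
  -- before the rest is decided by computation.
  · simp only [hamiltonianPrep, logarithm, halve, ok, ok_pushes (a := 15) rfl]
    decide
  · intro r hr
    have h15 : r ≠ 15 := by rintro rfl; revert hr; decide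
    simp only [hamiltonianPrep, logarithm, halve, keeps, keeps_pushes r 15 h15]
    revert r
    decide
  · rintro x O ⟨⟨n, h, hI, hD, -, hlam⟩, -⟩
    obtain ⟨β, P, h1, h2, -⟩ := key O hI hD rfl
    exact ⟨n, _, β, P, h1, h2 hlam⟩
  · rintro x O ⟨⟨n, h, hI, hD, -, hlam⟩, -⟩
    obtain ⟨β, P, h1, -, h2⟩ := key O hI hD rfl
    exact ⟨n, _, β, P, h1, h2 hlam⟩

end StoqAM

theorem theorem1 :
    (∀ p d : Polynomial ℕ, (∀ n : ℕ, 1 ≤ n → 0 < p.eval n) →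
      InAMWithOracle Set.univ (largestEigenvalueYes p d) (largestEigenvalueNo p d)) ∧
    (∀ (k : ℕ) (p₁ p₂ d : Polynomial ℕ), (∀ n : ℕ, 1 ≤ n → 0 < p₂.eval n) →
      InAM (stoquasticLHYes k p₁ d) (stoquasticLHNo k p₁ p₂ d)) :=
  ⟨largestEigenvalue_inAM, stoquasticLH_inAM⟩
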